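/- Let $0<q<1$ and $\mathbb N=\{0,1,2,\dots\}$. Let $\mathcal A_q=\mathcal A_q(\mathrm{SU}(2))$ be the complex unital algebra generated by $\alpha,\beta,\gamma,\delta$ with relations $$\alpha\beta=q\beta\alpha,\quad \alpha\gamma=q\gamma\alpha,\quad \beta\delta=q\delta\beta,\quad \gamma\delta=q\delta\gamma,\quad \beta\gamma=\gamma\beta,\quad \alpha\delta-q\beta\gamma=1=\delta\alpha-q^{-1}\beta\gamma,$$ with $\gamma^*=-q^{-1}\beta$ and comultiplication $\Delta(\alpha)=\alpha\otimes\alpha+\beta\otimes\gamma$, $\Delta(\beta)=\alpha\otimes\beta+\beta\otimes\delta$, $\Delta(\gamma)=\gamma\otimes\alpha+\delta\otimes\gamma$, $\Delta(\delta)=\delta\otimes\delta+\gamma\otimes\beta$. Let $\pi_0$ be the representation on $\ell^2(\mathbb N)$ with standard basis $(e_n)$ given by $$\pi_0(\alpha)e_n=\sqrt{1-q^{2n}}\,e_{n-1},\quad \pi_0(\beta)e_n=-q^{n+1}e_n,\quad \pi_0(\gamma)e_n=q^ne_n,\quad \pi_0(\delta)e_n=\sqrt{1-q^{2n+2}}\,e_{n+1},$$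 and on $\ell^2(\mathbb N)^{\otimes 3}$ put $\pi_{1(23)}=(\pi_0\otimes\pi_0\otimes\pi_0)(1\otimes\Delta)\Delta$ and $\pi_{(12)3}=(\pi_0\otimes\pi_0\otimes\pi_0)(\Delta\otimes1)\Delta$. With the standard notation $(a;q)_k$ and ${}_r\varphi_s$ for $q$-shifted factorials and basic hypergeometric series, let $$p_n(y;a;q)={}_2\varphi_1\!\left(q^{-n},0;aq;q,qy\right),\qquad \bar p_n(q^x;a;q)=(-1)^{n+x}\sqrt{\frac{(aq)^{x-n}(aq;q)_\infty(aq;q)_n}{(q;q)_n(q;q)_x}}\;p_n(q^x;a;q)$$ for $n,x\in\mathbb N$ (Wall polynomials), and for $x,m,n\in\mathbb N$ let $$C_{x,m,n}=\bar p_{\min(m,n)}\big(q^{2x};q^{2|n-m|};q^2\big),$$ with $C_{x,m,n}=0$ if one of the integers $x,m,n$ is negative. For $x\in\mathbb N$ and $p,r\in\mathbb Z$ define $$e^{1(23)}_{x,p,r}=\sum_{\substack{n,m,k\in\mathbb N\\ n-m+k=x-r}}C_{x,n,n+p}\,C_{n+p,m,k}\;e_n\otimes e_m\otimes e_k,\qquad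 e^{(12)3}_{x,p,r}=\sum_{\substack{n,m,k\in\mathbb N\\ n-m+k=x-r}}C_{x,k-p,k}\,C_{k-p,n,m}\;e_n\otimes e_m\otimes e_k .$$ Define the $6j$-symbols by $R^x_{p_1,r_1;p_2,r_2}=\langle e^{1(23)}_{x,p_1,r_1},e^{(12)3}_{x,p_2,r_2}\rangle$. Finally let $$J_\nu(x;q)=x^{\nu/2}\,\frac{(q^{\nu+1};q)_\infty}{(q;q)_\infty}\;{}_1\varphi_1\!\left(0;q^{\nu+1};q,qx\right)\quad(\nu\in\mathbb N),\qquad J_{-n}(x;q)=(-1)^nq^{n/2}J_n(xq^n;q)\quad(n\in\mathbb N)$$ be Jackson's third (Hahn--Exton) $q$-Bessel function. Then: 1. $\{e^{1(23)}_{x,p,r}\}_{x\in\mathbb N,\,p,r\in\mathbb Z}$ and $\{e^{(12)3}_{x,p,r}\}_{x\in\mathbb N,\,p,r\in\mathbb Z}$ are orthonormal bases of $\ell^2(\mathbb N)^{\otimes3}$, consisting of eigenvectors: $\pi_{1(23)}(\gamma\gamma^*)e^{1(23)}_{x,p,r}=q^{2x}e^{1(23)}_{x,p,r}$ and $\pi_{(12)3}(\gamma\gamma^*)e^{(12)3}_{x,p,r}=q^{2x}e^{(12)3}_{x,p,r}$.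 2. The $6j$-symbols are the recoupling coefficients between these bases: for all $x\in\mathbb N$, $p_1,r_1\in\mathbb Z$, $$e^{1(23)}_{x,p_1,r_1}=\sum_{p_2,r_2\in\mathbb Z}R^x_{p_1,r_1;p_2,r_2}\,e^{(12)3}_{x,p_2,r_2}.$$ 3. For all $x\in\mathbb N$ and $p_1,r_1,p_2,r_2\in\mathbb Z$ (in particular independently of $x$), $$R^x_{p_1,r_1;p_2,r_2}=\delta_{r_1,r_2}\,(-q)^{p_1-p_2}\,J_{r_1}\big(q^{2p_1-2p_2};q^2\big).$$ -/

import Mathlib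

open scoped TensorProduct

noncomputable section

namespace QSU2

/-! ## Basic hypergeometric series, `q`-Bessel functions and Wall polynomials -/

/-- The finite `q`-shifted factorial `(a; q)_k`. -/
def qPoch (a q : ℝ) (k : ℕ) : ℝ := ∏ i ∈ Finset.range k, (1 - a * q ^ i)

/-- The infinite `q`-shifted factorial `(a; q)_∞`, for `0 < q < 1`. -/
def qPochInf (a q : ℝ) : ℝ := ∏' i : ℕ, (1 - a * q ^ i)

/-- The basic hypergeometric series `₁φ₁(a; b; q, z)`. -/
def phi11 (a b q z : ℝ) : ℝ :=
  ∑' k : ℕ, qPoch a q k / (qPoch b q k * qPoch q q k) *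
    ((-1) ^ k * q ^ (k * (k - 1) / 2)) * z ^ k

/-- The basic hypergeometric series `₂φ₁(a, b; c; q, z)`. -/
def phi21 (a b c q z : ℝ) : ℝ :=
  ∑' k : ℕ, qPoch a q k * qPoch b q k / (qPoch c q k * qPoch q q k) * z ^ k

/-- Jackson's third (Hahn-Exton) `q`-Bessel function `J_ν(x; q)` for real `ν > -1`
and `x ≥ 0`. -/
def jackson3 (ν x q : ℝ) : ℝ :=
  x ^ (ν / 2) * (qPochInf (q ^ (ν + 1)) q / qPochInf q q) * phi11 0 (q ^ (ν + 1)) q (q * x)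

/-- Jackson's third `q`-Bessel function of integer order; for negative order it is defined by
`J_{-n}(x; q) = (-1)^n q^{n/2} J_n(x q^n; q)`. -/
def qBessel : ℤ → ℝ → ℝ → ℝ
  | Int.ofNat n, x, q => jackson3 n x q
  | Int.negSucc k, x, q =>
      (-1) ^ (k + 1) * q ^ (((k + 1 : ℕ) : ℝ) / 2) *
        jackson3 ((k + 1 : ℕ) : ℝ) (x * q ^ (k + 1)) q

/-- The Wall polynomial `p_n(y; a; q) = ₂φ₁(q^{-n}, 0; aq; q, qy)`. -/
def wall (n : ℕ) (y a q : ℝ) : ℝ := phi21 (q ^ (-(n : ℤ))) 0 (a * q) q (q * y)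

/-- The normalized Wall function `p̄_n(q^x; a; q)`, for `x ∈ ℕ`. -/
def wallBar (n x : ℕ) (a q : ℝ) : ℝ :=
  (-1) ^ (n + x) *
    √((a * q) ^ ((x : ℤ) - (n : ℤ)) * qPochInf (a * q) q * qPoch (a * q) q n /
      (qPoch q q n * qPoch q q x)) *
    wall n (q ^ x) a q

/-- The Clebsch-Gordan coefficient `C_{x,m,n}`; it vanishes if one of `x, m, n` is negative. -/
def clebschGordan (q : ℝ) (x m n : ℤ) : ℝ :=
  if 0 ≤ x ∧ 0 ≤ m ∧ 0 ≤ n then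
    if m ≤ n then wallBar m.toNat x.toNat (q ^ (2 * (n - m))) (q ^ 2)
    else wallBar n.toNat x.toNat (q ^ (2 * (m - n))) (q ^ 2)
  else 0

/-! ## The algebra `𝒜_q(SU(2))` and its comultiplication -/

/-- The four generators `α, β, γ, δ`. -/
inductive Gen
  | al | be | ga | de

/-- The generator `g` in the free algebra. -/
abbrev gen (g : Gen) : FreeAlgebra ℂ Gen := FreeAlgebra.ι ℂ g

open Gen in
/-- The defining relations of `𝒜_q(SU(2))`. -/
inductive Rel (q : ℝ) : FreeAlgebra ℂ Gen → FreeAlgebra ℂ Gen → Prop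
  | al_be : Rel q (gen al * gen be) ((q : ℂ) • (gen be * gen al))
  | al_ga : Rel q (gen al * gen ga) ((q : ℂ) • (gen ga * gen al))
  | be_de : Rel q (gen be * gen de) ((q : ℂ) • (gen de * gen be))
  | ga_de : Rel q (gen ga * gen de) ((q : ℂ) • (gen de * gen ga))
  | be_ga : Rel q (gen be * gen ga) (gen ga * gen be)
  | al_de : Rel q (gen al * gen de - (q : ℂ) • (gen be * gen ga)) 1
  | de_al : Rel q (gen de * gen al - ((q : ℂ)⁻¹) • (gen be * gen ga)) 1

/-- The complex unital algebra `𝒜_q(SU(2))`. -/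
abbrev Alg (q : ℝ) : Type := RingQuot (Rel q)

/-- The generators of `𝒜_q(SU(2))`. -/
def Alg.of (q : ℝ) (g : Gen) : Alg q := RingQuot.mkAlgHom ℂ (Rel q) (gen g)

/-- Algebra maps out of `𝒜_q(SU(2))` are given by images of the generators that satisfy the
relations. -/
def Alg.lift {q : ℝ} {B : Type*} [Ring B] [Algebra ℂ B] (f : Gen → B)
    (hf : ∀ ⦃x y⦄, Rel q x y → FreeAlgebra.lift ℂ f x = FreeAlgebra.lift ℂ f y) :
    Alg q →ₐ[ℂ] B :=
  RingQuot.liftAlgHom ℂ ⟨FreeAlgebra.lift ℂ f, hf⟩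

theorem Alg.lift_of {q : ℝ} {B : Type*} [Ring B] [Algebra ℂ B] (f : Gen → B)
    (hf : ∀ ⦃x y⦄, Rel q x y → FreeAlgebra.lift ℂ f x = FreeAlgebra.lift ℂ f y) (g : Gen) :
    Alg.lift f hf (Alg.of q g) = f g := by
  simp [Alg.lift, Alg.of, RingQuot.liftAlgHom_mkAlgHom_apply]

theorem Alg.rel {q : ℝ} {x y : FreeAlgebra ℂ Gen} (h : Rel q x y) :
    FreeAlgebra.lift ℂ (Alg.of q) x = FreeAlgebra.lift ℂ (Alg.of q) y := by
  have key : FreeAlgebra.lift ℂ (Alg.of q) = RingQuot.mkAlgHom ℂ (Rel q) := by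
    ext g
    simp [Alg.of]
  rw [key]
  exact RingQuot.mkAlgHom_rel ℂ h

/-- The element `γ* = -q⁻¹ β` prescribed by the `*`-structure of `𝒜_q(SU(2))`. -/
def gaStar (q : ℝ) : Alg q := -((q : ℂ)⁻¹ • Alg.of q Gen.be)

open Gen in
/-- The comultiplication on the generators. -/
def comulGen (q : ℝ) : Gen → Alg q ⊗[ℂ] Alg q
  | al => Alg.of q al ⊗ₜ Alg.of q al + Alg.of q be ⊗ₜ Alg.of q ga
  | be => Alg.of q al ⊗ₜ Alg.of q be + Alg.of q be ⊗ₜ Alg.of q de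
  | ga => Alg.of q ga ⊗ₜ Alg.of q al + Alg.of q de ⊗ₜ Alg.of q ga
  | de => Alg.of q de ⊗ₜ Alg.of q de + Alg.of q ga ⊗ₜ Alg.of q be

open Gen in
theorem Alg.rels {q : ℝ} :
    of q al * of q be = (q : ℂ) • (of q be * of q al) ∧
    of q al * of q ga = (q : ℂ) • (of q ga * of q al) ∧
    of q be * of q de = (q : ℂ) • (of q de * of q be) ∧
    of q ga * of q de = (q : ℂ) • (of q de * of q ga) ∧
    of q be * of q ga = of q ga * of q be ∧
    of q al * of q de = 1 + (q : ℂ) • (of q be * of q ga) ∧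
    of q de * of q al = 1 + (q : ℂ)⁻¹ • (of q be * of q ga) := by
  have h1 := Alg.rel (Rel.al_be (q := q))
  have h2 := Alg.rel (Rel.al_ga (q := q))
  have h3 := Alg.rel (Rel.be_de (q := q))
  have h4 := Alg.rel (Rel.ga_de (q := q))
  have h5 := Alg.rel (Rel.be_ga (q := q))
  have h6 := Alg.rel (Rel.al_de (q := q))
  have h7 := Alg.rel (Rel.de_al (q := q))
  simp only [map_mul, map_smul, map_sub, map_one, FreeAlgebra.lift_ι_apply] at h1 h2 h3 h4 h5 h6 h7
  exact ⟨h1, h2, h3, h4, h5, by rw [← h6]; abel, by rw [← h7]; abel⟩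

theorem comulGen_rel {q : ℝ} (hq : q ≠ 0) ⦃x y : FreeAlgebra ℂ Gen⦄ (h : Rel q x y) :
    FreeAlgebra.lift ℂ (comulGen q) x = FreeAlgebra.lift ℂ (comulGen q) y := by
  have hq' : (q : ℂ) ≠ 0 := by exact_mod_cast hq
  obtain ⟨h1, h2, h3, h4, h5, h6, h7⟩ := Alg.rels (q := q)
  cases h <;>
  · simp only [map_mul, map_smul, map_sub, map_one, FreeAlgebra.lift_ι_apply, comulGen,
      mul_add, add_mul, Algebra.TensorProduct.tmul_mul_tmul, h1, h2, h3, h4, h5, h6, h7,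
      TensorProduct.tmul_add, TensorProduct.add_tmul, TensorProduct.tmul_smul,
      ← TensorProduct.smul_tmul', smul_add, smul_smul, Algebra.TensorProduct.one_def]
    match_scalars <;> field_simp <;> ring

/-- The comultiplication `Δ : 𝒜_q → 𝒜_q ⊗ 𝒜_q`. -/
def comul {q : ℝ} (hq : q ≠ 0) : Alg q →ₐ[ℂ] Alg q ⊗[ℂ] Alg q :=
  Alg.lift (comulGen q) (comulGen_rel hq)

/-! ## Operators on `ℓ²` -/

/-- The Hilbert space `ℓ²(ι)`. -/
abbrev L2 (ι : Type*) : Type _ := lp (fun _ : ι => ℂ) 2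

theorem sum_sq_le {ι : Type*} (f : L2 ι) (s : Finset ι) : ∑ i ∈ s, ‖f i‖ ^ 2 ≤ ‖f‖ ^ 2 := by
  have := lp.sum_rpow_le_norm_rpow (p := 2) (by norm_num) f s
  simpa using this

theorem hasSum_sq {ι : Type*} (f : L2 ι) : HasSum (fun i => ‖f i‖ ^ 2) (‖f‖ ^ 2) := by
  have := lp.hasSum_norm (p := 2) (by norm_num) f
  simpa using this

theorem memL2 {ι : Type*} {f : ι → ℂ} {C : ℝ} (h : ∀ s : Finset ι, ∑ i ∈ s, ‖f i‖ ^ 2 ≤ C) :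
    Memℓp f 2 :=
  memℓp_gen' (C := C) (by simpa using h)

theorem norm_le_of_sum {ι : Type*} {f : L2 ι} {C : ℝ} (hC : 0 ≤ C)
    (h : ∀ s : Finset ι, ∑ i ∈ s, ‖f i‖ ^ 2 ≤ C ^ 2) : ‖f‖ ≤ C :=
  lp.norm_le_of_forall_sum_le (p := 2) (by norm_num) hC (by simpa using h)

theorem sum_shift_le {w : ℕ → ℝ} {τ : ℕ → ℕ} (hw : ∀ n, |w n| ≤ 1)
    (hτ : Set.InjOn τ {n | w n ≠ 0}) (f : L2 ℕ) (s : Finset ℕ) :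
    ∑ n ∈ s, ‖(w n : ℂ) * f (τ n)‖ ^ 2 ≤ ‖f‖ ^ 2 := by
  classical
  calc ∑ n ∈ s, ‖(w n : ℂ) * f (τ n)‖ ^ 2
      = ∑ n ∈ s.filter (fun n => w n ≠ 0), ‖(w n : ℂ) * f (τ n)‖ ^ 2 := by
        rw [Finset.sum_filter]
        refine Finset.sum_congr rfl fun n _ => ?_
        by_cases h : w n = 0 <;> simp [h]
    _ ≤ ∑ n ∈ s.filter (fun n => w n ≠ 0), ‖f (τ n)‖ ^ 2 := by
        refine Finset.sum_le_sum fun n _ => ?_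
        rw [norm_mul, Complex.norm_real, Real.norm_eq_abs]
        gcongr
        exact mul_le_of_le_one_left (norm_nonneg _) (hw n)
    _ = ∑ m ∈ (s.filter (fun n => w n ≠ 0)).image τ, ‖f m‖ ^ 2 := by
        rw [Finset.sum_image]
        intro a ha b hb hab
        simp only [Finset.coe_filter, Set.mem_ofPred_eq] at ha hb
        exact hτ ha.2 hb.2 hab
    _ ≤ ‖f‖ ^ 2 := sum_sq_le f _

/-- The bounded operator `(T f)(n) = w(n) f(τ(n))` on `ℓ²(ℕ)`. -/
def weighted (w : ℕ → ℝ) (τ : ℕ → ℕ) (hw : ∀ n, |w n| ≤ 1)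
    (hτ : Set.InjOn τ {n | w n ≠ 0}) : L2 ℕ →L[ℂ] L2 ℕ :=
  LinearMap.mkContinuous
    { toFun := fun f => ⟨fun n => (w n : ℂ) * f (τ n), memL2 (sum_shift_le hw hτ f)⟩
      map_add' := fun f g => by ext n; exact mul_add _ _ _
      map_smul' := fun c f => by ext n; simp [mul_left_comm] }
    1 (fun f => by
      rw [one_mul]
      exact norm_le_of_sum (norm_nonneg f) (sum_shift_le hw hτ f))

theorem weighted_apply {w : ℕ → ℝ} {τ : ℕ → ℕ} (hw : ∀ n, |w n| ≤ 1)
    (hτ : Set.InjOn τ {n | w n ≠ 0}) (f : L2 ℕ) (n : ℕ) :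
    weighted w τ hw hτ f n = (w n : ℂ) * f (τ n) := rfl

section amplification

variable {ι κ ω : Type*} (e : κ × ι ≃ ω)

theorem summable_slice (f : L2 ω) : Summable fun p : κ × ι => ‖f (e p)‖ ^ 2 :=
  (e.summable_iff (f := fun i => ‖f i‖ ^ 2)).2 (hasSum_sq f).summable

/-- The vector `f(j, ·)` in `ℓ²(ι)`, for `f` in `ℓ²(ω)` and `ω ≃ κ × ι`. -/
def slice (f : L2 ω) (j : κ) : L2 ι :=
  ⟨fun i => f (e (j, i)), memL2 (C := ‖f‖ ^ 2) fun s => by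
    have := sum_sq_le f ((s.map (Function.Embedding.sectR j ι)).map e.toEmbedding)
    simpa using this⟩

theorem slice_apply (f : L2 ω) (j : κ) (i : ι) : slice e f j i = f (e (j, i)) := rfl

theorem sum_slice_le (f : L2 ω) (s : Finset κ) : ∑ j ∈ s, ‖slice e f j‖ ^ 2 ≤ ‖f‖ ^ 2 := by
  have h1 : HasSum (fun p : κ × ι => ‖f (e p)‖ ^ 2) (‖f‖ ^ 2) :=
    (e.hasSum_iff (f := fun i => ‖f i‖ ^ 2)).2 (hasSum_sq f)
  have h2 : HasSum (fun j => ‖slice e f j‖ ^ 2) (‖f‖ ^ 2) :=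
    h1.prod_fiberwise fun j => hasSum_sq (slice e f j)
  exact sum_le_hasSum s (fun _ _ => sq_nonneg _) h2

theorem sum_amp_le (T : L2 ι →L[ℂ] L2 ι) (f : L2 ω) (s : Finset ω) :
    ∑ i ∈ s, ‖T (slice e f (e.symm i).1) (e.symm i).2‖ ^ 2 ≤ (‖T‖ * ‖f‖) ^ 2 := by
  classical
  set t := s.map e.symm.toEmbedding with ht
  calc ∑ i ∈ s, ‖T (slice e f (e.symm i).1) (e.symm i).2‖ ^ 2
      = ∑ p ∈ t, ‖T (slice e f p.1) p.2‖ ^ 2 := by simp [ht]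
    _ ≤ ∑ p ∈ t.image Prod.fst ×ˢ t.image Prod.snd, ‖T (slice e f p.1) p.2‖ ^ 2 :=
        Finset.sum_le_sum_of_subset_of_nonneg Finset.subset_product
          fun _ _ _ => sq_nonneg _
    _ = ∑ j ∈ t.image Prod.fst, ∑ i ∈ t.image Prod.snd, ‖T (slice e f j) i‖ ^ 2 :=
        Finset.sum_product _ _ _
    _ ≤ ∑ j ∈ t.image Prod.fst, ‖T‖ ^ 2 * ‖slice e f j‖ ^ 2 := by
        refine Finset.sum_le_sum fun j _ => (sum_sq_le _ _).trans ?_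
        rw [← mul_pow]
        gcongr
        exact T.le_opNorm _
    _ ≤ (‖T‖ * ‖f‖) ^ 2 := by
        rw [← Finset.mul_sum, mul_pow]
        gcongr
        exact sum_slice_le e f _

/-- The operator on `ℓ²(ω) = ℓ²(κ) ⊗ ℓ²(ι)` that acts as `T` on the factor `ℓ²(ι)` and as the
identity on the factor `ℓ²(κ)`, where `ω ≃ κ × ι`. -/
def amp (T : L2 ι →L[ℂ] L2 ι) : L2 ω →L[ℂ] L2 ω :=
  LinearMap.mkContinuous
    { toFun := fun f =>
        ⟨fun i => T (slice e f (e.symm i).1) (e.symm i).2, memL2 (sum_amp_le e T f)⟩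
      map_add' := fun f g => by
        ext i
        have : slice e (f + g) (e.symm i).1 = slice e f (e.symm i).1 + slice e g (e.symm i).1 := by
          ext; rfl
        change T (slice e (f + g) (e.symm i).1) (e.symm i).2 = _
        rw [this, map_add]; rfl
      map_smul' := fun c f => by
        ext i
        have : slice e (c • f) (e.symm i).1 = c • slice e f (e.symm i).1 := by
          ext; rfl
        simp [this] }
    ‖T‖ (fun f => norm_le_of_sum (by positivity) (sum_amp_le e T f))

theorem amp_apply (T : L2 ι →L[ℂ] L2 ι) (f : L2 ω) (j : κ) (i : ι) :
    amp e T f (e (j, i)) = T (slice e f j) i := by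
  change T (slice e f (e.symm (e (j, i))).1) (e.symm (e (j, i))).2 = _
  rw [e.symm_apply_apply]

theorem slice_amp (T : L2 ι →L[ℂ] L2 ι) (f : L2 ω) (j : κ) :
    slice e (amp e T f) j = T (slice e f j) := by
  ext i
  rw [slice_apply, amp_apply]

theorem ext_slice {f g : L2 ω} (h : ∀ j, slice e f j = slice e g j) : f = g := by
  ext i
  obtain ⟨⟨j, k⟩, rfl⟩ := e.surjective i
  rw [← slice_apply, ← slice_apply, h]

/-- `amp` as a homomorphism of algebras. -/
def ampHom : (L2 ι →L[ℂ] L2 ι) →ₐ[ℂ] (L2 ω →L[ℂ] L2 ω) where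
  toFun := amp e
  map_one' := by
    ext1 f; refine ext_slice e fun j => ?_
    rw [slice_amp]; rfl
  map_mul' S T := by
    ext1 f; refine ext_slice e fun j => ?_
    rw [slice_amp, mul_apply_eq_comp, mul_apply_eq_comp, slice_amp,
      slice_amp]
  map_zero' := by
    ext1 f; refine ext_slice e fun j => ?_
    rw [slice_amp]; rfl
  map_add' S T := by
    ext1 f; refine ext_slice e fun j => ?_
    rw [slice_amp]
    change _ = slice e (amp e S f) j + slice e (amp e T f) j
    rw [slice_amp, slice_amp]; rfl
  commutes' c := by
    ext1 f; refine ext_slice e fun j => ?_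
    rw [slice_amp]; rfl

end amplification

/-- `T ↦ T ⊗ 1` on `ℓ²(ι) ⊗ ℓ²(κ) = ℓ²(ι × κ)`. -/
def ampLeft (ι κ : Type*) : (L2 ι →L[ℂ] L2 ι) →ₐ[ℂ] (L2 (ι × κ) →L[ℂ] L2 (ι × κ)) :=
  ampHom (Equiv.prodComm κ ι)

/-- `T ↦ 1 ⊗ T` on `ℓ²(ι) ⊗ ℓ²(κ) = ℓ²(ι × κ)`. -/
def ampRight (ι κ : Type*) : (L2 κ →L[ℂ] L2 κ) →ₐ[ℂ] (L2 (ι × κ) →L[ℂ] L2 (ι × κ)) :=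
  ampHom (Equiv.refl (ι × κ))

theorem ampLeft_apply {ι κ : Type*} (T : L2 ι →L[ℂ] L2 ι) (f : L2 (ι × κ)) (i : ι) (j : κ) :
    ampLeft ι κ T f (i, j) = T (slice (Equiv.prodComm κ ι) f j) i :=
  amp_apply (Equiv.prodComm κ ι) T f j i

theorem ampRight_apply {ι κ : Type*} (T : L2 κ →L[ℂ] L2 κ) (f : L2 (ι × κ)) (i : ι) (j : κ) :
    ampRight ι κ T f (i, j) = T (slice (Equiv.refl (ι × κ)) f i) j :=
  amp_apply (Equiv.refl (ι × κ)) T f i j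

theorem single_eq_smul {ι : Type*} [DecidableEq ι] (i : ι) (c : ℂ) :
    (lp.single 2 i c : L2 ι) = c • (lp.single 2 i 1 : L2 ι) := by
  rw [← lp.single_smul, smul_eq_mul, mul_one]

theorem commute_amp {ι κ : Type*} (S : L2 ι →L[ℂ] L2 ι) (T : L2 κ →L[ℂ] L2 κ) :
    Commute (ampLeft ι κ S) (ampRight ι κ T) := by
  classical
  have hL : ∀ (i : ι) (j : κ) (c : ℂ) (a : ι) (b : κ),
      ampLeft ι κ S (lp.single 2 (i, j) c) (a, b) =
        if b = j then c * S (lp.single 2 i 1) a else 0 := by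
    intro i j c a b
    rw [ampLeft_apply]
    split_ifs with h
    · have : slice (Equiv.prodComm κ ι) (lp.single 2 (i, j) c) b = c • lp.single 2 i 1 := by
        rw [← single_eq_smul]
        ext k
        simp [slice_apply, lp.single_apply, Pi.single_apply, h]
      rw [this, map_smul]; rfl
    · have : slice (Equiv.prodComm κ ι) (lp.single 2 (i, j) c) b = 0 := by
        ext k
        simp [slice_apply, lp.single_apply, h]
      rw [this]; simp
  have hR : ∀ (i : ι) (j : κ) (c : ℂ) (a : ι) (b : κ),
      ampRight ι κ T (lp.single 2 (i, j) c) (a, b) =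
        if a = i then c * T (lp.single 2 j 1) b else 0 := by
    intro i j c a b
    rw [ampRight_apply]
    split_ifs with h
    · have : slice (Equiv.refl (ι × κ)) (lp.single 2 (i, j) c) a = c • lp.single 2 j 1 := by
        rw [← single_eq_smul]
        ext k
        simp [slice_apply, lp.single_apply, Pi.single_apply, h]
      rw [this, map_smul]; rfl
    · have : slice (Equiv.refl (ι × κ)) (lp.single 2 (i, j) c) a = 0 := by
        ext k
        simp [slice_apply, lp.single_apply, h]
      rw [this]; simp
  refine lp.ext_continuousLinearMap (by norm_num) fun p => ?_
  obtain ⟨i, j⟩ := p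
  refine ContinuousLinearMap.ext_ring ?_
  ext ab
  obtain ⟨a, b⟩ := ab
  change ampLeft ι κ S (ampRight ι κ T (lp.single 2 (i, j) 1)) (a, b) =
    ampRight ι κ T (ampLeft ι κ S (lp.single 2 (i, j) 1)) (a, b)
  rw [ampLeft_apply, ampRight_apply]
  have h1 : slice (Equiv.prodComm κ ι) (ampRight ι κ T (lp.single 2 (i, j) 1)) b =
      T (lp.single 2 j 1) b • lp.single 2 i 1 := by
    rw [← single_eq_smul]
    ext k
    rw [slice_apply]
    change ampRight ι κ T (lp.single 2 (i, j) 1) (k, b) = _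
    rw [hR]
    by_cases h : k = i <;> simp [lp.single_apply, h]
  have h2 : slice (Equiv.refl (ι × κ)) (ampLeft ι κ S (lp.single 2 (i, j) 1)) a =
      S (lp.single 2 i 1) a • lp.single 2 j 1 := by
    rw [← single_eq_smul]
    ext k
    rw [slice_apply]
    change ampLeft ι κ S (lp.single 2 (i, j) 1) (a, k) = _
    rw [hL]
    by_cases h : k = j <;> simp [lp.single_apply, h]
  rw [h1, h2, map_smul, map_smul]
  exact mul_comm _ _

/-! ## The representation `π₀` and its tensor products -/

theorem abs_sqrt_le {q : ℝ} (hq : q ∈ Set.Ioo (0 : ℝ) 1) (k : ℕ) : |√(1 - q ^ k)| ≤ 1 := by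
  rw [abs_of_nonneg (Real.sqrt_nonneg _)]
  exact Real.sqrt_le_one.2 (by have := pow_nonneg hq.1.le k; linarith)

theorem abs_pow_le {q : ℝ} (hq : q ∈ Set.Ioo (0 : ℝ) 1) (k : ℕ) : |q ^ k| ≤ 1 := by
  rw [abs_of_nonneg (pow_nonneg hq.1.le k)]
  exact pow_le_one₀ hq.1.le hq.2.le

/-- The operators `π₀(α), π₀(β), π₀(γ), π₀(δ)` on `ℓ²(ℕ)`:
`α e_n = √(1 - q^{2n}) e_{n-1}`, `β e_n = -q^{n+1} e_n`, `γ e_n = q^n e_n`,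
`δ e_n = √(1 - q^{2n+2}) e_{n+1}`, written in terms of the coordinates of a vector. -/
def pi0Gen {q : ℝ} (hq : q ∈ Set.Ioo (0 : ℝ) 1) : Gen → (L2 ℕ →L[ℂ] L2 ℕ)
  | .al => weighted (fun n => √(1 - q ^ (2 * n + 2))) (fun n => n + 1)
      (fun _ => abs_sqrt_le hq _) (fun _ _ _ _ h => by simpa using h)
  | .be => weighted (fun n => -q ^ (n + 1)) id
      (fun _ => by rw [abs_neg]; exact abs_pow_le hq _) (fun _ _ _ _ h => h)
  | .ga => weighted (fun n => q ^ n) id (fun _ => abs_pow_le hq _) (fun _ _ _ _ h => h)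
  | .de => weighted (fun n => √(1 - q ^ (2 * n))) (fun n => n - 1)
      (fun _ => abs_sqrt_le hq _) (by
        rintro (_ | a) ha (_ | b) hb h
        · rfl
        · simp at ha
        · simp at hb
        · simpa using h)

theorem pi0Gen_apply {q : ℝ} (hq : q ∈ Set.Ioo (0 : ℝ) 1) (f : L2 ℕ) (n : ℕ) :
    pi0Gen hq .al f n = (√(1 - q ^ (2 * n + 2)) : ℝ) * f (n + 1) ∧
    pi0Gen hq .be f n = (-q ^ (n + 1) : ℝ) * f n ∧
    pi0Gen hq .ga f n = (q ^ n : ℝ) * f n ∧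
    pi0Gen hq .de f n = (√(1 - q ^ (2 * n)) : ℝ) * f (n - 1) :=
  ⟨rfl, rfl, rfl, rfl⟩

theorem sqrt_mul_sqrt {q : ℝ} (hq : q ∈ Set.Ioo (0 : ℝ) 1) (k : ℕ) :
    ((√(1 - q ^ k) : ℝ) : ℂ) * (√(1 - q ^ k) : ℝ) = 1 - (q : ℂ) ^ k := by
  have := Real.mul_self_sqrt (sub_nonneg.2 (pow_le_one₀ (n := k) hq.1.le hq.2.le))
  rw [← Complex.ofReal_mul, this]
  push_cast
  rfl

theorem pi0_rel {q : ℝ} (hq : q ∈ Set.Ioo (0 : ℝ) 1) ⦃x y : FreeAlgebra ℂ Gen⦄ (h : Rel q x y) :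
    FreeAlgebra.lift ℂ (pi0Gen hq) x = FreeAlgebra.lift ℂ (pi0Gen hq) y := by
  have hq' : (q : ℂ) ≠ 0 := by exact_mod_cast hq.1.ne'
  have ha := fun f n => (pi0Gen_apply hq f n).1
  have hb := fun f n => (pi0Gen_apply hq f n).2.1
  have hc := fun f n => (pi0Gen_apply hq f n).2.2.1
  have hd := fun f n => (pi0Gen_apply hq f n).2.2.2
  cases h <;>
    simp only [map_mul, map_smul, map_sub, map_one, FreeAlgebra.lift_ι_apply] <;>
    ext f n <;>
    simp only [mul_apply_eq_comp, sub_apply, smul_apply, lp.coeFn_sub, lp.coeFn_smul,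
      Pi.sub_apply, Pi.smul_apply, smul_eq_mul, one_apply_eq_self, ha, hb, hc, hd]
  · push_cast; ring
  · push_cast; ring
  · rcases n with _ | n
    · simp
    · push_cast [Nat.add_sub_cancel]; ring
  · rcases n with _ | n
    · simp
    · push_cast [Nat.add_sub_cancel]; ring
  · ring
  · rw [Nat.add_sub_cancel, ← mul_assoc, show 2 * (n + 1) = 2 * n + 2 by ring, sqrt_mul_sqrt hq]
    push_cast; ring
  · rcases n with _ | n
    · simp [hq']
    · rw [Nat.add_sub_cancel, ← mul_assoc, show 2 * (n + 1) = 2 * n + 2 by ring,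
        sqrt_mul_sqrt hq]
      push_cast; field_simp; ring

/-- The representation `π₀` of `𝒜_q(SU(2))` on `ℓ²(ℕ)`. -/
def pi0 {q : ℝ} (hq : q ∈ Set.Ioo (0 : ℝ) 1) : Alg q →ₐ[ℂ] (L2 ℕ →L[ℂ] L2 ℕ) :=
  Alg.lift (pi0Gen hq) (pi0_rel hq)

/-- `π₀ ⊗ π₀`, acting on `ℓ²(ℕ) ⊗ ℓ²(ℕ) = ℓ²(ℕ × ℕ)`. -/
def pi0Two {q : ℝ} (hq : q ∈ Set.Ioo (0 : ℝ) 1) :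
    Alg q ⊗[ℂ] Alg q →ₐ[ℂ] (L2 (ℕ × ℕ) →L[ℂ] L2 (ℕ × ℕ)) :=
  Algebra.TensorProduct.lift ((ampLeft ℕ ℕ).comp (pi0 hq)) ((ampRight ℕ ℕ).comp (pi0 hq))
    fun _ _ => commute_amp _ _

/-- `π₀ ⊗ π₀ ⊗ π₀`, acting on `ℓ²(ℕ) ⊗ ℓ²(ℕ) ⊗ ℓ²(ℕ) = ℓ²(ℕ × ℕ × ℕ)`. -/
def pi0Three {q : ℝ} (hq : q ∈ Set.Ioo (0 : ℝ) 1) :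
    Alg q ⊗[ℂ] (Alg q ⊗[ℂ] Alg q) →ₐ[ℂ] (L2 (ℕ × ℕ × ℕ) →L[ℂ] L2 (ℕ × ℕ × ℕ)) :=
  Algebra.TensorProduct.lift ((ampLeft ℕ (ℕ × ℕ)).comp (pi0 hq))
    ((ampRight ℕ (ℕ × ℕ)).comp (pi0Two hq)) fun _ _ => commute_amp _ _

/-- `π_{1(23)} = (π₀ ⊗ π₀ ⊗ π₀)(1 ⊗ Δ)Δ`. -/
def pi1_23 {q : ℝ} (hq : q ∈ Set.Ioo (0 : ℝ) 1) :
    Alg q →ₐ[ℂ] (L2 (ℕ × ℕ × ℕ) →L[ℂ] L2 (ℕ × ℕ × ℕ)) :=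
  (pi0Three hq).comp
    ((Algebra.TensorProduct.map (AlgHom.id ℂ (Alg q)) (comul hq.1.ne')).comp (comul hq.1.ne'))

/-- `π_{(12)3} = (π₀ ⊗ π₀ ⊗ π₀)(Δ ⊗ 1)Δ`. -/
def pi12_3 {q : ℝ} (hq : q ∈ Set.Ioo (0 : ℝ) 1) :
    Alg q →ₐ[ℂ] (L2 (ℕ × ℕ × ℕ) →L[ℂ] L2 (ℕ × ℕ × ℕ)) :=
  (pi0Three hq).comp
    (((Algebra.TensorProduct.assoc ℂ ℂ ℂ (Alg q) (Alg q) (Alg q)).toAlgHom.comp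
      (Algebra.TensorProduct.map (comul hq.1.ne') (AlgHom.id ℂ (Alg q)))).comp (comul hq.1.ne'))

/-! ## The bases `e^{1(23)}` and `e^{(12)3}` and the `6j`-symbols -/

open Classical in
/-- The vector of `ℓ²(ι)` with the given coordinates (and `0` if they are not
square-summable). -/
def ofCoord {ι : Type*} (f : ι → ℂ) : L2 ι := if h : Memℓp f 2 then ⟨f, h⟩ else 0

/-- The vector `e^{1(23)}_{x,p,r} = ∑_{n-m+k=x-r} C_{x,n,n+p} C_{n+p,m,k} e_n ⊗ e_m ⊗ e_k`. -/
def e1_23 (q : ℝ) (x : ℕ) (p r : ℤ) : L2 (ℕ × ℕ × ℕ) :=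
  ofCoord fun (n, m, k) =>
    if (n : ℤ) - m + k = x - r then
      ((clebschGordan q x n (n + p) * clebschGordan q (n + p) m k : ℝ) : ℂ)
    else 0

/-- The vector `e^{(12)3}_{x,p,r} = ∑_{n-m+k=x-r} C_{x,k-p,k} C_{k-p,n,m} e_n ⊗ e_m ⊗ e_k`. -/
def e12_3 (q : ℝ) (x : ℕ) (p r : ℤ) : L2 (ℕ × ℕ × ℕ) :=
  ofCoord fun (n, m, k) =>
    if (n : ℤ) - m + k = x - r then
      ((clebschGordan q x (k - p) k * clebschGordan q (k - p) n m : ℝ) : ℂ)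
    else 0

/-- The `6j`-symbol `R^x_{p₁,r₁;p₂,r₂} = ⟨e^{1(23)}_{x,p₁,r₁}, e^{(12)3}_{x,p₂,r₂}⟩`. -/
def sixJ (q : ℝ) (x : ℕ) (p₁ r₁ p₂ r₂ : ℤ) : ℂ :=
  inner ℂ (e1_23 q x p₁ r₁) (e12_3 q x p₂ r₂)

/-- A family of vectors is an orthonormal basis (in the Hilbert space sense). -/
def IsHilbertBasis {ι H : Type*} [NormedAddCommGroup H] [InnerProductSpace ℂ H] (v : ι → H) :
    Prop :=
  Orthonormal ℂ v ∧ (Submodule.span ℂ (Set.range v)).topologicalClosure = ⊤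

end QSU2

end

noncomputable section

namespace QSU2

/-! ## `q`-shifted factorials -/

/-! The coefficients $C_{x,n,m}$ intertwine representations, and everything except the final limit
follows from this. Reversing the Wall polynomial writes $C_{x,n,m}$ as an elementary factor times a
terminating sum `qSum` symmetric in $n,m$ (`wallBar_eq_cgNat`). Contiguous relations for that sum
become four relations for $C$, valid for all integer indices (`clebschGordan_gamma`, `_beta`,
`_alpha`, `_delta`). They say that $\sum_{k-m=s}C_{y,m,k}\,e_m\otimes e_k$ behaves under
$(\pi_0\otimes\pi_0)\Delta$ like $e_y$ under $\pi_0$, up to a shift of $s$ under $\gamma$ and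
$\gamma^*$. The vectors $e^{1(23)}_{x,p,r}$ iterate this construction, so $\alpha,\delta$ lower and
raise $x$ with the weights of $\pi_0$, while $\gamma$ and $\gamma^*$ multiply by $q^x$ and shift $p$
by $\mp1$. Coassociativity gives $\pi_{(12)3}=\pi_{1(23)}$. Exchanging the outer tensor factors and
replacing $p$ by $-p$ turns $e^{1(23)}$ into $e^{(12)3}$, so the second family obeys the same
formulas, and the eigenvalue $q^{2x}$ is immediate.

Orthonormality: $\alpha^*=\delta$ forces vectors with different $x$ to be orthogonal and makes inner
products independent of $x$ (`inner_eq_of_ladder`). For $x=0$ in the two-fold product, $\gamma$ is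
an isometric shift in $s$, and the norm is found as $s\to\infty$. Completeness: the dual relation
$\sum_x C_{x,n,m}^2=1$ comes from a similar ladder argument in $n$, started at $n=0$ by a
$q$-binomial sum. It shows that each standard basis vector satisfies Parseval's identity, which
suffices (`isHilbertBasis_of_hasSum`).

Value of the $6j$-symbol: the ladder in $x$ reduces to $x=0$, and the shift by $\gamma$ makes the
result depend only on $p_1-p_2=p$. Disjoint supports give $\delta_{r_1,r_2}$. Hence $R=\langle
e^{1(23)}_{0,j+p,r},e^{(12)3}_{0,j,r}\rangle$ for every $j$. As $j\to\infty$ the second vector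
approaches $e_0\otimes e_{j+r}\otimes e_j$, so $R=\lim_j C_{j+p,j+r,j}$
(`tendsto_clebschGordan_sixJ`). This is the classical limit from Wall polynomials to Hahn–Exton
$q$-Bessel functions (`tendsto_clebschGordan_qBessel`). -/

theorem qPoch_succ (a q : ℝ) (k : ℕ) : qPoch a q (k + 1) = qPoch a q k * (1 - a * q ^ k) :=
  Finset.prod_range_succ _ _

theorem qPoch_zero (a q : ℝ) : qPoch a q 0 = 1 := rfl

theorem one_sub_pow_succ_pos {q : ℝ} (h0 : 0 < q) (h1 : q < 1) (k : ℕ) : 0 < 1 - q ^ (k + 1) :=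
  sub_pos.2 (pow_lt_one₀ h0.le h1 k.succ_ne_zero)

theorem qPoch_pos {q : ℝ} (h0 : 0 < q) (h1 : q < 1) (s k : ℕ) : 0 < qPoch (q ^ (s + 1)) q k :=
  Finset.prod_pos fun i _ => by
    rw [← pow_add, show s + 1 + i = s + i + 1 by ring]
    exact one_sub_pow_succ_pos h0 h1 _

theorem qPoch_self_pos {q : ℝ} (h0 : 0 < q) (h1 : q < 1) (k : ℕ) : 0 < qPoch q q k := by
  simpa using qPoch_pos h0 h1 0 k

theorem qPoch_self_succ (q : ℝ) (k : ℕ) :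
    qPoch q q (k + 1) = qPoch q q k * (1 - q ^ (k + 1)) := by
  rw [qPoch_succ, pow_succ' q k]

theorem qPoch_add (a q : ℝ) (s n : ℕ) :
    qPoch a q (s + n) = qPoch a q s * qPoch (a * q ^ s) q n := by
  simp only [qPoch, Finset.prod_range_add, mul_assoc, pow_add]

theorem multipliable_qPochInf {q : ℝ} (h0 : 0 < q) (h1 : q < 1) (a : ℝ) :
    Multipliable fun i : ℕ => 1 - a * q ^ i := by
  have : Summable fun i : ℕ => -(a * q ^ i) :=
    ((summable_geometric_of_lt_one h0.le h1).mul_left a).neg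
  simpa [sub_eq_add_neg] using Real.multipliable_one_add_of_summable this

theorem tendsto_qPoch {q : ℝ} (h0 : 0 < q) (h1 : q < 1) (a : ℝ) :
    Filter.Tendsto (qPoch a q) Filter.atTop (nhds (qPochInf a q)) :=
  (multipliable_qPochInf h0 h1 a).hasProd.tendsto_prod_nat

theorem qPoch_mul_qPochInf {q : ℝ} (h0 : 0 < q) (h1 : q < 1) (a : ℝ) (s : ℕ) :
    qPoch a q s * qPochInf (a * q ^ s) q = qPochInf a q := by
  have h2 := (tendsto_qPoch h0 h1 (a * q ^ s)).const_mul (qPoch a q s)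
  have h3 := (tendsto_qPoch h0 h1 a).comp (Filter.tendsto_add_atTop_nat s)
  refine tendsto_nhds_unique h2 (h3.congr fun n => ?_)
  rw [Function.comp_apply, add_comm, qPoch_add]

theorem qPoch_self_anti {q : ℝ} (h0 : 0 < q) (h1 : q < 1) : Antitone (qPoch q q) :=
  antitone_nat_of_succ_le fun k => by
    rw [qPoch_self_succ]
    exact mul_le_of_le_one_right (qPoch_self_pos h0 h1 k).le
      (by have := pow_nonneg h0.le (k + 1); linarith)

/-- An absolutely convergent product without zero factors is nonzero; being a limit of positive
partial products, it is then positive. -/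
theorem qPochInf_self_pos {q : ℝ} (h0 : 0 < q) (h1 : q < 1) : 0 < qPochInf q q := by
  have hne : qPochInf q q ≠ 0 := by
    have hs : Summable fun i : ℕ => ‖-(q * q ^ i)‖ := by
      simpa using ((summable_geometric_of_lt_one h0.le h1).mul_left q).abs
    have := tprod_one_add_ne_zero_of_summable (f := fun i : ℕ => -(q * q ^ i)) (fun i => by
      have := one_sub_pow_succ_pos h0 h1 i
      rw [pow_succ'] at this
      linarith [this, this.ne']) hs
    simpa [qPochInf, sub_eq_add_neg] using this
  exact lt_of_le_of_ne (ge_of_tendsto' (tendsto_qPoch h0 h1 q)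
    fun k => (qPoch_self_pos h0 h1 k).le) hne.symm

theorem qPochInf_self_le {q : ℝ} (h0 : 0 < q) (h1 : q < 1) (k : ℕ) :
    qPochInf q q ≤ qPoch q q k :=
  (qPoch_self_anti h0 h1).le_of_tendsto (tendsto_qPoch h0 h1 q) k

theorem qPoch_pow_succ {q : ℝ} (h0 : 0 < q) (h1 : q < 1) (s n : ℕ) :
    qPoch (q ^ (s + 1)) q n = qPoch q q (s + n) / qPoch q q s := by
  rw [eq_div_iff (qPoch_self_pos h0 h1 s).ne', qPoch_add, pow_succ', mul_comm]

theorem qPochInf_pow_succ {q : ℝ} (h0 : 0 < q) (h1 : q < 1) (s : ℕ) :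
    qPochInf (q ^ (s + 1)) q = qPochInf q q / qPoch q q s := by
  rw [eq_div_iff (qPoch_self_pos h0 h1 s).ne', ← qPoch_mul_qPochInf h0 h1 q s, pow_succ', mul_comm]

/-! ## A terminating `q`-hypergeometric sum -/

/-- The product `(1 - q^n)(1 - q^{n-1}) ⋯ (1 - q^{n-j+1})`, which vanishes for `j > n`. -/
def qDesc (q : ℝ) (n j : ℕ) : ℝ := ∏ i ∈ Finset.range j, (1 - q ^ (n - i))

theorem qDesc_zero (q : ℝ) (n : ℕ) : qDesc q n 0 = 1 := rfl

theorem qDesc_succ (q : ℝ) (n j : ℕ) : qDesc q n (j + 1) = qDesc q n j * (1 - q ^ (n - j)) :=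
  Finset.prod_range_succ _ _

theorem qDesc_succ_succ (q : ℝ) (n j : ℕ) :
    qDesc q (n + 1) (j + 1) = (1 - q ^ (n + 1)) * qDesc q n j := by
  rw [qDesc, Finset.prod_range_succ', mul_comm]
  simp [qDesc]

theorem qDesc_eq_zero (q : ℝ) {n j : ℕ} (h : n < j) : qDesc q n j = 0 :=
  Finset.prod_eq_zero (Finset.mem_range.2 h) (by simp)

theorem qDesc_succ' (q : ℝ) (n j : ℕ) :
    qDesc q n (j + 1) = (1 - q ^ n) * qDesc q (n - 1) j := by
  rcases n with _ | n
  · simp [qDesc_eq_zero q (Nat.succ_pos j)]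
  · exact qDesc_succ_succ q n j

/-- The $q$-Pascal rule, which drives the recurrence of `qSum` in $n$. For $n<j$ all products
vanish, so the truncated exponent $n-j$ does no harm. -/
theorem qDesc_pascal (q : ℝ) (n j : ℕ) : qDesc q (n + 1) (j + 1) =
    qDesc q n (j + 1) + q ^ (n - j) * (1 - q ^ (j + 1)) * qDesc q n j := by
  rcases lt_or_ge n j with h | h
  · simp [qDesc_eq_zero q h, qDesc_eq_zero q (Nat.lt_succ_of_lt h),
      qDesc_eq_zero q (Nat.succ_lt_succ h)]
  · obtain ⟨i, rfl⟩ := Nat.exists_eq_add_of_le h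
    rw [qDesc_succ_succ, qDesc_succ, Nat.add_sub_cancel_left]
    ring

theorem qDesc_mul_qPoch (q : ℝ) (i j : ℕ) :
    qDesc q (i + j) j * qPoch q q i = qPoch q q (i + j) := by
  induction j with
  | zero => simp [qDesc_zero]
  | succ j ih => rw [← add_assoc, qDesc_succ_succ, qPoch_self_succ, ← ih]; ring

/-- The terminating sum `₂φ₀(q^{-n}, q^{-m}; -; q, z q^{n+m})`. -/
def qSum (q z : ℝ) (n m : ℕ) : ℝ := ∑ j ∈ Finset.range (n + 1),
  (-1) ^ j * q ^ j.choose 2 * z ^ j * qDesc q n j * qDesc q m j / qPoch q q j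

theorem qSum_eq (q z : ℝ) {n m N : ℕ} (h : n ≤ N ∨ m ≤ N) :
    qSum q z n m = ∑ j ∈ Finset.range (N + 1),
      (-1) ^ j * q ^ j.choose 2 * z ^ j * qDesc q n j * qDesc q m j / qPoch q q j := by
  rcases le_total n N with h1 | h1
  · refine Finset.sum_subset (Finset.range_mono (by lia)) fun j _ hj => ?_
    rw [qDesc_eq_zero q (n := n) (by simpa using hj)]; simp
  · symm
    refine Finset.sum_subset (Finset.range_mono (by lia)) fun j hj hj' => ?_
    rcases h with h | h
    · exact absurd hj (by simp at hj' ⊢; lia)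
    · rw [qDesc_eq_zero q (n := m) (by simp at hj'; lia)]; simp

theorem qSum_comm (q z : ℝ) (n m : ℕ) : qSum q z n m = qSum q z m n := by
  rw [qSum_eq q z (N := m) (Or.inr le_rfl)]
  exact Finset.sum_congr rfl fun j _ => by ring

theorem qSum_zero_left (q z : ℝ) (m : ℕ) : qSum q z 0 m = 1 := by
  simp [qSum, qDesc_zero, qPoch_zero]

/-- In the second term of the $q$-Pascal rule, $1-q^{j+1}$ cancels the last factor of $(q;q)_{j+1}$;
shifting $j$ leaves a sum with parameters $n,m-1$. The factor $1-q^m$ makes the truncated $m-1$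
harmless at $m=0$. -/
theorem qSum_succ_left {q : ℝ} (h0 : 0 < q) (h1 : q < 1) (z : ℝ) (n m : ℕ) :
    qSum q z (n + 1) m = qSum q z n m - z * q ^ n * (1 - q ^ m) * qSum q z n (m - 1) := by
  rw [qSum_eq q z (n := n) (N := n + 1) (by simp), qSum, qSum,
    Finset.sum_range_succ', Finset.sum_range_succ' _ (n + 1), Finset.mul_sum,
    add_sub_right_comm, ← Finset.sum_sub_distrib]
  congr 1
  refine Finset.sum_congr rfl fun j hj => ?_
  have hj' : j ≤ n := by simpa [Nat.lt_succ_iff] using hj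
  obtain ⟨i, rfl⟩ := Nat.exists_eq_add_of_le hj'
  have hp := (qPoch_self_pos h0 h1 j).ne'
  have hp' := (one_sub_pow_succ_pos h0 h1 j).ne'
  rw [qDesc_pascal, Nat.add_sub_cancel_left, qDesc_succ' q m, qPoch_self_succ,
    Nat.choose_succ_succ' j 1, Nat.choose_one_right, pow_add q j, pow_add q j i]
  field_simp
  ring

/-- Termwise, $(z/q)^j-z^j=z^jq^{-j}(1-q^j)$, and $1-q^j$ cancels the last factor of $(q;q)_j$.
Since $z=q^{-x}$ in the application, this raises $x$. -/
theorem qSum_div {q : ℝ} (h0 : 0 < q) (h1 : q < 1) (z : ℝ) (n m : ℕ) :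
    qSum q (z / q) n m = qSum q z n m -
      z / q * (1 - q ^ n) * (1 - q ^ m) * qSum q z (n - 1) (m - 1) := by
  rcases n with _ | n
  · simp [qSum_zero_left]
  rw [Nat.add_sub_cancel, qSum, qSum, qSum, Finset.sum_range_succ',
    Finset.sum_range_succ' _ (n + 1), Finset.mul_sum, add_sub_right_comm,
    ← Finset.sum_sub_distrib]
  congr 1
  refine Finset.sum_congr rfl fun j hj => ?_
  have hp := (qPoch_self_pos h0 h1 j).ne'
  have hp' := (one_sub_pow_succ_pos h0 h1 j).ne'
  rw [qDesc_succ' q m, qDesc_succ_succ, qPoch_self_succ,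
    Nat.choose_succ_succ' j 1, Nat.choose_one_right, pow_add q j, div_pow, pow_succ q j]
  rw [pow_succ q j] at hp'
  field_simp
  ring

/-- Obtained by induction from the recurrence in $n$ alone. With $z=q^{-x}$ it relates $x$ to $x-1$,
and at $z=1$ the second term disappears. -/
theorem qSum_succ_succ {q : ℝ} (h0 : 0 < q) (h1 : q < 1) (z : ℝ) (n m : ℕ) :
    qSum q z (n + 1) (m + 1) =
      z * q ^ (n + m + 1) * qSum q z n m - (z - 1) * qSum q (z * q) n m := by
  induction n generalizing m with
  | zero =>
    rw [qSum_succ_left h0 h1]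
    simp only [qSum_zero_left]
    ring
  | succ n ih =>
    rw [qSum_succ_left h0 h1, Nat.add_sub_cancel, ih m, qSum_succ_left h0 h1 (z * q)]
    rcases m with _ | m
    · have := qSum_succ_left h0 h1 z n 0
      simp at this
      rw [this]
      simp
      ring
    · rw [Nat.add_sub_cancel]
      have h2 := ih m
      have h3 := qSum_succ_left h0 h1 z n (m + 1)
      rw [Nat.add_sub_cancel] at h3
      linear_combination (-z * q ^ (n + 1) * (1 - q ^ (m + 1))) * h2 - (z * q ^ (n + m + 1 + 1)) * h3

/-! ## Wall polynomials in symmetric form -/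

theorem add_choose_two' (i j : ℕ) : (i + j).choose 2 = i.choose 2 + j.choose 2 + i * j := by
  induction j with
  | zero => simp
  | succ j ih =>
    rw [← add_assoc, Nat.choose_succ_succ' (i + j) 1, Nat.choose_succ_succ' j 1, ih]
    simp
    ring

theorem two_mul_choose_two_add (i : ℕ) : 2 * i.choose 2 + i = i * i := by
  induction i with
  | zero => simp
  | succ i ih => rw [Nat.choose_succ_succ' i 1]; simp; linarith

/-- The power $q^{nk}$ clears the negative exponents in $(q^{-n};q)_k$. The identity also encodes
termination for $k>n$, and its right side has an evident limit as $n\to\infty$. -/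
theorem qPoch_zpow_neg {q : ℝ} (h0 : 0 < q) (n k : ℕ) :
    qPoch (q ^ (-(n : ℤ))) q k * q ^ (n * k) = (-1) ^ k * q ^ k.choose 2 * qDesc q n k := by
  induction k with
  | zero => simp [qPoch_zero, qDesc_zero]
  | succ k ih =>
    rcases lt_or_ge n k with h | h
    · have hz : qPoch (q ^ (-(n : ℤ))) q k = 0 := by
        rw [qDesc_eq_zero q h, mul_zero] at ih
        exact (mul_eq_zero.1 ih).resolve_right (by positivity)
      rw [qDesc_eq_zero q (by lia), qPoch_succ, hz]
      simp
    · obtain ⟨i, rfl⟩ := Nat.exists_eq_add_of_le h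
      have h2 : (1 - q ^ (-((k + i : ℕ) : ℤ)) * q ^ k) * q ^ (k + i) = -q ^ k * (1 - q ^ i) := by
        rw [zpow_neg, zpow_natCast]
        field_simp
        ring
      rw [qPoch_succ, qDesc_succ, Nat.add_sub_cancel_left, Nat.choose_succ_succ' k 1,
        Nat.choose_one_right, pow_add q k, mul_add, pow_add q, mul_one]
      linear_combination (1 - q ^ (-((k + i : ℕ) : ℤ)) * q ^ k) * q ^ (k + i) * ih +
        (-1) ^ k * q ^ k.choose 2 * qDesc q (k + i) k * h2

/-- Reversing the order of summation in the terminating ${}_2\varphi_1$ turns it into a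
${}_2\varphi_0$ in which the degree $n$ and the shifted index $n+s$ play symmetric roles. The factor
$q^{\binom n2}$ keeps all exponents nonnegative. -/
theorem wall_pow {q : ℝ} (h0 : 0 < q) (h1 : q < 1) (n x s : ℕ) :
    wall n (q ^ x) (q ^ s) q * q ^ n.choose 2 =
      (-1) ^ n * q ^ (n * x) * (qPoch q q s / qPoch q q (n + s)) *
        qSum q (q ^ x)⁻¹ n (n + s) := by
  have hP := fun k => (qPoch_self_pos h0 h1 k).ne'
  have hz : ∀ k ∉ Finset.range (n + 1), qPoch (q ^ (-(n : ℤ))) q k * qPoch 0 q k /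
      (qPoch (q ^ s * q) q k * qPoch q q k) * (q * q ^ x) ^ k = 0 := by
    intro k hk
    have h2 := qPoch_zpow_neg h0 n k
    rw [qDesc_eq_zero q (by simpa [Nat.lt_succ_iff] using hk), mul_zero] at h2
    rw [(mul_eq_zero.1 h2).resolve_right (by positivity)]
    simp
  rw [wall, phi21, tsum_eq_sum hz, ← Finset.sum_range_reflect, qSum, Finset.mul_sum,
    Finset.sum_mul]
  refine Finset.sum_congr rfl fun j hj => ?_
  obtain ⟨i, rfl⟩ := Nat.exists_eq_add_of_le' (by simpa [Nat.lt_succ_iff] using hj : j ≤ n)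
  rw [show i + j + 1 - 1 - j = i by lia]
  have e1 : qPoch (q ^ (-((i + j : ℕ) : ℤ))) q i =
      (-1) ^ i * q ^ i.choose 2 * (qPoch q q (i + j) / qPoch q q j) / q ^ ((i + j) * i) := by
    rw [eq_div_iff (by positivity), qPoch_zpow_neg h0, add_comm i j, ← qDesc_mul_qPoch q j i,
      mul_div_cancel_right₀ _ (hP j)]
  have e2 : qDesc q (i + j) j = qPoch q q (i + j) / qPoch q q i := by
    rw [eq_div_iff (hP i), qDesc_mul_qPoch]
  have e3 : qDesc q (i + j + s) j = qPoch q q (i + j + s) / qPoch q q (s + i) := by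
    rw [eq_div_iff (hP _), show i + j + s = s + i + j by ring, qDesc_mul_qPoch]
  have e4 : qPoch 0 q i = 1 := by simp [qPoch]
  have e5 : q ^ (i * i) = q ^ i.choose 2 * q ^ i.choose 2 * q ^ i := by
    rw [← two_mul_choose_two_add, two_mul, pow_add, pow_add]
  have hs : (-1 : ℝ) ^ (j * 2) = 1 := by simp [pow_mul']
  rw [e1, e2, e3, e4, ← pow_succ, qPoch_pow_succ h0 h1, add_choose_two', add_mul, pow_add q (i * i),
    e5, pow_add q _ (i * j), pow_add q (i.choose 2), inv_pow]
  have := hP (i + j + s)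
  have := hP (s + i)
  have := hP i
  have := hP j
  have := hP s
  field_simp
  ring_nf
  simp only [hs, mul_one]

/-- The Clebsch-Gordan coefficients for natural indices, in a form symmetric in `n` and `m`. -/
def cgNat (q : ℝ) (x n m : ℕ) : ℝ :=
  (-1) ^ x * (q ^ (x * n + x * m + x) / q ^ (n * m)) *
    √(qPochInf (q ^ 2) (q ^ 2) /
      (qPoch (q ^ 2) (q ^ 2) x * qPoch (q ^ 2) (q ^ 2) n * qPoch (q ^ 2) (q ^ 2) m)) *
    qSum (q ^ 2) ((q ^ 2) ^ x)⁻¹ n m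

theorem cgNat_comm (q : ℝ) (x n m : ℕ) : cgNat q x n m = cgNat q x m n := by
  rw [cgNat, cgNat, qSum_comm, mul_comm n m, add_right_comm, mul_right_comm (qPoch _ _ x)]
  congr 4
  ring

theorem wallBar_eq_cgNat {q : ℝ} (h0 : 0 < q) (h1 : q < 1) (n x s : ℕ) :
    wallBar n x ((q ^ 2) ^ s) (q ^ 2) = cgNat q x n (n + s) := by
  have g0 : 0 < q ^ 2 := by positivity
  have g1 : q ^ 2 < 1 := pow_lt_one₀ h0.le h1 two_ne_zero
  have hP := qPoch_self_pos g0 g1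
  have hw := wall_pow g0 g1 n x s
  have hI := qPochInf_self_pos g0 g1
  set P := qPoch (q ^ 2) (q ^ 2) with hPdef
  -- The radicand is a perfect square times a normalization symmetric in $n$ and $n+s$, so the
  -- asymmetric part leaves the square root.
  have hr : ((q ^ 2) ^ s * q ^ 2) ^ ((x : ℤ) - n) * qPochInf ((q ^ 2) ^ s * q ^ 2) (q ^ 2) *
      qPoch ((q ^ 2) ^ s * q ^ 2) (q ^ 2) n / (P n * P x) =
      (q ^ ((s + 1) * x) / q ^ ((s + 1) * n) * (P (n + s) / P s)) ^ 2 *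
      (qPochInf (q ^ 2) (q ^ 2) / (P x * P n * P (n + s))) := by
    have := hP n
    have := hP x
    have := hP s
    have := hP (n + s)
    rw [← pow_succ, qPochInf_pow_succ g0 g1, qPoch_pow_succ g0 g1, zpow_sub₀ (by positivity),
      zpow_natCast, zpow_natCast, ← hPdef, add_comm s n]
    field_simp
    ring
  rw [wallBar, ← hPdef, hr, Real.sqrt_mul (by positivity), Real.sqrt_sq
    (by have := (hP s); have := hP (n + s); positivity), cgNat, ← hPdef]
  -- The remaining powers of $q$ combine into an expression symmetric in $n$ and $n+s$; the sign
  -- $(-1)^n$ from the reversal cancels the one in `wallBar`.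
  have hc : (q ^ 2) ^ (n * x) * (q ^ ((s + 1) * x) / q ^ ((s + 1) * n)) =
      (q ^ (x * n + x * (n + s) + x) / q ^ (n * (n + s))) * (q ^ 2) ^ n.choose 2 := by
    have : q ^ (n * n) = (q ^ 2) ^ n.choose 2 * q ^ n := by
      rw [← pow_mul, ← pow_add, two_mul_choose_two_add]
    rw [mul_add n, pow_add q (n * n), this]
    field_simp
    ring
  have hs : (-1 : ℝ) ^ (n + x) = (-1) ^ n * (-1) ^ x := pow_add _ _ _
  have hs2 : ((-1 : ℝ) ^ n) * (-1) ^ n = 1 := by rw [← mul_pow]; simp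
  have h3 : P (n + s) / P s * (P s / P (n + s)) = 1 := by
    have := (hP s).ne'; have := (hP (n + s)).ne'; field_simp
  have hq : (q ^ 2) ^ n.choose 2 ≠ 0 := by positivity
  apply mul_right_cancel₀ hq
  rw [hs, mul_assoc _ (wall _ _ _ _), hw]
  generalize √(qPochInf (q ^ 2) (q ^ 2) / (P x * P n * P (n + s))) = R
  generalize qSum (q ^ 2) ((q ^ 2) ^ x)⁻¹ n (n + s) = v
  generalize P (n + s) / P s = A at *
  generalize P s / P (n + s) = B at *
  generalize (q ^ ((s + 1) * x) / q ^ ((s + 1) * n)) = D at *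
  linear_combination (-1) ^ x * R * v * hc +
    (-1) ^ x * R * v * (q ^ 2) ^ (n * x) * D * (A * B * hs2 + h3)

theorem clebschGordan_natCast {q : ℝ} (h0 : 0 < q) (h1 : q < 1) (x n m : ℕ) :
    clebschGordan q x n m = cgNat q x n m := by
  have key : ∀ n s : ℕ, wallBar n x (q ^ (2 * (((n + s : ℕ) : ℤ) - n))) (q ^ 2) =
      cgNat q x n (n + s) := fun n s => by
    rw [← wallBar_eq_cgNat h0 h1]
    congr 1
    rw [← pow_mul, ← zpow_natCast]
    congr 1
    push_cast
    ring
  rw [clebschGordan, if_pos ⟨by positivity, by positivity, by positivity⟩]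
  split_ifs with h
  · obtain ⟨s, rfl⟩ := Nat.exists_eq_add_of_le (Int.ofNat_le.1 h)
    exact key n s
  · obtain ⟨s, rfl⟩ := Nat.exists_eq_add_of_le (Int.ofNat_le.1 (not_le.1 h).le)
    rw [cgNat_comm]
    exact key m s

theorem clebschGordan_of_neg (q : ℝ) {x n m : ℤ} (h : x < 0 ∨ n < 0 ∨ m < 0) :
    clebschGordan q x n m = 0 :=
  if_neg (by lia)

theorem clebschGordan_comm {q : ℝ} (h0 : 0 < q) (h1 : q < 1) (x n m : ℤ) :
    clebschGordan q x n m = clebschGordan q x m n := by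
  by_cases h : x < 0 ∨ n < 0 ∨ m < 0
  · rw [clebschGordan_of_neg q h, clebschGordan_of_neg q (by lia)]
  · lift x to ℕ using by lia
    lift n to ℕ using by lia
    lift m to ℕ using by lia
    rw [clebschGordan_natCast h0 h1, clebschGordan_natCast h0 h1, cgNat_comm]

/-! ## Contiguous relations for the Clebsch-Gordan coefficients -/

/-- The weight `√(1 - q^{2n})` of the shift operators. -/
def wt (q : ℝ) (n : ℤ) : ℝ := √(1 - q ^ (2 * n))

theorem wt_zero (q : ℝ) : wt q 0 = 0 := by simp [wt]

theorem wt_natCast (q : ℝ) (n : ℕ) : wt q n = √(1 - q ^ (2 * n)) := by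
  rw [wt, ← zpow_natCast]; push_cast; rfl

theorem wt_natCast_add_one (q : ℝ) (n : ℕ) : wt q (n + 1) = √(1 - q ^ (2 * n + 2)) := by
  rw [show (n : ℤ) + 1 = (n + 1 : ℕ) by push_cast; rfl, wt_natCast, mul_add]

theorem wt_succ_pos {q : ℝ} (h0 : 0 < q) (h1 : q < 1) (n : ℕ) : 0 < wt q (n + 1) := by
  rw [wt_natCast_add_one]
  exact Real.sqrt_pos.2 (one_sub_pow_succ_pos h0 h1 _)

theorem wt_succ_sq {q : ℝ} (h0 : 0 < q) (h1 : q < 1) (n : ℕ) :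
    wt q (n + 1) * wt q (n + 1) = 1 - (q ^ 2) ^ (n + 1) := by
  rw [wt_natCast_add_one, Real.mul_self_sqrt (one_sub_pow_succ_pos h0 h1 _).le, ← pow_mul, mul_add]

/-- For $n<0$ the radicand is negative and the real square root is $0$ by convention. The weights
thus cut off terms that would leave $\mathbb N$, and the relations below extend to all integers. -/
theorem wt_of_nonpos {q : ℝ} (h0 : 0 < q) (h1 : q < 1) {n : ℤ} (h : n ≤ 0) : wt q n = 0 := by
  refine Real.sqrt_eq_zero_of_nonpos (sub_nonpos.2 ?_)
  have := zpow_le_zpow_right_of_le_one₀ h0 h1.le (show 2 * n ≤ 0 by lia)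
  simpa using this

/-- The normalization of the Clebsch-Gordan coefficients. -/
def cgNorm (q : ℝ) (x n m : ℕ) : ℝ := √(qPochInf (q ^ 2) (q ^ 2) /
      (qPoch (q ^ 2) (q ^ 2) x * qPoch (q ^ 2) (q ^ 2) n * qPoch (q ^ 2) (q ^ 2) m))

theorem cgNat_eq (q : ℝ) (x n m : ℕ) : cgNat q x n m =
    (-1) ^ x * (q ^ (x * n + x * m + x) / q ^ (n * m)) * cgNorm q x n m *
      qSum (q ^ 2) ((q ^ 2) ^ x)⁻¹ n m := rfl

theorem cgNorm_succ_right {q : ℝ} (h0 : 0 < q) (h1 : q < 1) (x n m : ℕ) :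
    cgNorm q x n (m + 1) * wt q (m + 1) = cgNorm q x n m := by
  have g0 : 0 < q ^ 2 := by positivity
  have g1 : q ^ 2 < 1 := pow_lt_one₀ h0.le h1 two_ne_zero
  have h2 := one_sub_pow_succ_pos h0 h1 (2 * m + 1)
  rw [cgNorm, cgNorm, wt_natCast_add_one, mul_comm, ← Real.sqrt_mul h2.le, qPoch_self_succ,
    ← pow_mul q, mul_add]
  congr 1
  have := qPoch_self_pos g0 g1 x
  have := qPoch_self_pos g0 g1 n
  have := qPoch_self_pos g0 g1 m
  have h2 : 1 - q ^ (2 * m + 2 * 1) ≠ 0 := h2.ne'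
  simp only [mul_one] at h2 ⊢
  field_simp

theorem cgNorm_succ_mid {q : ℝ} (h0 : 0 < q) (h1 : q < 1) (x n m : ℕ) :
    cgNorm q x (n + 1) m * wt q (n + 1) = cgNorm q x n m := by
  rw [cgNorm, mul_right_comm, ← cgNorm, cgNorm_succ_right h0 h1, cgNorm, mul_right_comm, ← cgNorm]

theorem cgNorm_succ_left {q : ℝ} (h0 : 0 < q) (h1 : q < 1) (x n m : ℕ) :
    cgNorm q (x + 1) n m * wt q (x + 1) = cgNorm q x n m := by
  rw [cgNorm, mul_comm (qPoch _ _ (x + 1)), ← cgNorm, cgNorm_succ_mid h0 h1, cgNorm,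
    mul_comm (qPoch _ _ n), ← cgNorm]

theorem cgNat_gamma_zero {q : ℝ} (h0 : 0 < q) (h1 : q < 1) (x m : ℕ) :
    wt q (m + 1) * cgNat q x 0 (m + 1) = q ^ x * cgNat q x 0 m := by
  rw [cgNat_eq, cgNat_eq, ← cgNorm_succ_right h0 h1 x 0 m]
  simp only [qSum_zero_left, zero_mul, pow_zero]
  ring

/-- This is `qSum_succ_left` in the second index; the normalizations differ by the weights, whose
squares are the factors $1-q^{2(n+1)}$. -/
theorem cgNat_gamma_succ {q : ℝ} (h0 : 0 < q) (h1 : q < 1) (x n m : ℕ) :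
    q ^ (n + 1) * wt q (m + 1) * cgNat q x (n + 1) (m + 1) + q ^ m * wt q (n + 1) * cgNat q x n m =
      q ^ x * cgNat q x (n + 1) m := by
  have g0 : 0 < q ^ 2 := by positivity
  have g1 : q ^ 2 < 1 := pow_lt_one₀ h0.le h1 two_ne_zero
  have hv := qSum_succ_left g0 g1 ((q ^ 2) ^ x)⁻¹ m (n + 1)
  rw [Nat.add_sub_cancel, qSum_comm _ _ (m + 1), qSum_comm _ _ m, qSum_comm _ _ m] at hv
  rw [cgNat_eq, cgNat_eq, cgNat_eq, ← cgNorm_succ_mid h0 h1 x n m, hv,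
    ← cgNorm_succ_right h0 h1 x (n + 1) m]
  have hw := wt_succ_sq h0 h1 n
  generalize cgNorm q x (n + 1) (m + 1) = R
  generalize qSum (q ^ 2) ((q ^ 2) ^ x)⁻¹ n m = v
  generalize qSum (q ^ 2) ((q ^ 2) ^ x)⁻¹ (n + 1) m = u
  have e1 : q ^ (n + 1) * (q ^ (x * (n + 1) + x * (m + 1) + x) / q ^ ((n + 1) * (m + 1))) =
      q ^ x * (q ^ (x * (n + 1) + x * m + x) / q ^ ((n + 1) * m)) := by
    field_simp; ring
  have e2 : q ^ m * (q ^ (x * n + x * m + x) / q ^ (n * m)) =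
      q ^ x * (q ^ (x * (n + 1) + x * m + x) / q ^ ((n + 1) * m)) *
        (((q ^ 2) ^ x)⁻¹ * (q ^ 2) ^ m) := by
    field_simp; ring
  generalize q ^ (x * (n + 1) + x * (m + 1) + x) / q ^ ((n + 1) * (m + 1)) = A at *
  generalize q ^ (x * n + x * m + x) / q ^ (n * m) = B at *
  generalize q ^ (x * (n + 1) + x * m + x) / q ^ ((n + 1) * m) = D at *
  generalize ((q ^ 2) ^ x)⁻¹ * (q ^ 2) ^ m = z at *
  generalize (q ^ 2) ^ (n + 1) = t at *
  linear_combination ((-1) ^ x * R * wt q (m + 1) * (u - z * (1 - t) * v)) * e1 +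
    ((-1) ^ x * R * wt q (m + 1) * wt q (n + 1) * wt q (n + 1) * v) * e2 +
    ((-1) ^ x * R * wt q (m + 1) * v * q ^ x * D * z) * hw

/-- This is `qSum_succ_succ` in base $q^2$ at $z=q^{-2(x+1)}$: there $zq^2=q^{-2x}$, and $z-1$
supplies the squared weight $1-q^{2(x+1)}$. -/
theorem cgNat_alpha {q : ℝ} (h0 : 0 < q) (h1 : q < 1) (x n m : ℕ) :
    wt q (n + 1) * wt q (m + 1) * cgNat q (x + 1) (n + 1) (m + 1) -
      q ^ (n + m + 1) * cgNat q (x + 1) n m = wt q (x + 1) * cgNat q x n m := by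
  have g0 : 0 < q ^ 2 := by positivity
  have g1 : q ^ 2 < 1 := pow_lt_one₀ h0.le h1 two_ne_zero
  have hv := qSum_succ_succ g0 g1 ((q ^ 2) ^ (x + 1))⁻¹ n m
  have hz : ((q ^ 2) ^ (x + 1))⁻¹ * q ^ 2 = ((q ^ 2) ^ x)⁻¹ := by
    rw [pow_succ]; field_simp
  rw [hz] at hv
  rw [cgNat_eq, cgNat_eq, cgNat_eq, ← cgNorm_succ_left h0 h1 x n m, hv,
    ← cgNorm_succ_right h0 h1 (x + 1) n m, ← cgNorm_succ_mid h0 h1 (x + 1) n (m + 1)]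
  have hw := wt_succ_sq h0 h1 x
  generalize cgNorm q (x + 1) (n + 1) (m + 1) = R
  generalize qSum (q ^ 2) ((q ^ 2) ^ x)⁻¹ n m = v
  generalize qSum (q ^ 2) ((q ^ 2) ^ (x + 1))⁻¹ n m = u
  have e1 : q ^ ((x + 1) * (n + 1) + (x + 1) * (m + 1) + (x + 1)) / q ^ ((n + 1) * (m + 1)) *
      (((q ^ 2) ^ (x + 1))⁻¹ * (q ^ 2) ^ (n + m + 1)) =
      q ^ (n + m + 1) * (q ^ ((x + 1) * n + (x + 1) * m + (x + 1)) / q ^ (n * m)) := by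
    field_simp; ring
  have e2 : q ^ ((x + 1) * (n + 1) + (x + 1) * (m + 1) + (x + 1)) / q ^ ((n + 1) * (m + 1)) *
      ((q ^ 2) ^ (x + 1))⁻¹ = q ^ (x * n + x * m + x) / q ^ (n * m) := by
    field_simp; ring
  have e3 : ((q ^ 2) ^ (x + 1))⁻¹ * (q ^ 2) ^ (x + 1) = 1 := by field_simp
  rw [pow_succ (-1 : ℝ) x]
  generalize q ^ ((x + 1) * (n + 1) + (x + 1) * (m + 1) + (x + 1)) / q ^ ((n + 1) * (m + 1)) = A at *
  generalize q ^ (x * n + x * m + x) / q ^ (n * m) = B at *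
  generalize q ^ ((x + 1) * n + (x + 1) * m + (x + 1)) / q ^ (n * m) = D at *
  generalize ((q ^ 2) ^ (x + 1))⁻¹ = z at *
  generalize (q ^ 2) ^ (x + 1) = t at *
  generalize (q ^ 2) ^ (n + m + 1) = t' at *
  generalize q ^ (n + m + 1) = t'' at *
  generalize wt q (n + 1) = wn
  generalize wt q (m + 1) = wm
  linear_combination (-(-1) ^ x * wn * wm * R * u) * e1 +
    ((-1) ^ x * wn * wm * R * v) * ((1 - t) * e2 + A * e3 - B * hw)

theorem cgNat_alpha_zero {q : ℝ} (h0 : 0 < q) (h1 : q < 1) (n m : ℕ) :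
    wt q (n + 1) * wt q (m + 1) * cgNat q 0 (n + 1) (m + 1) = q ^ (n + m + 1) * cgNat q 0 n m := by
  have g0 : 0 < q ^ 2 := by positivity
  have g1 : q ^ 2 < 1 := pow_lt_one₀ h0.le h1 two_ne_zero
  have hv := qSum_succ_succ g0 g1 ((q ^ 2) ^ 0)⁻¹ n m
  rw [cgNat_eq, cgNat_eq, hv, ← cgNorm_succ_right h0 h1 0 n m,
    ← cgNorm_succ_mid h0 h1 0 n (m + 1)]
  simp only [zero_mul, add_zero, pow_zero, one_mul, inv_one, sub_self, sub_zero, zero_mul]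
  generalize qSum (q ^ 2) 1 n m = v
  field_simp
  ring

/-- This is `qSum_div` in base $q^2$: dividing $z=q^{-2x}$ by $q^2$ raises $x$ by one. -/
theorem cgNat_delta {q : ℝ} (h0 : 0 < q) (h1 : q < 1) (x n m : ℕ) :
    wt q (n + 1) * wt q (m + 1) * cgNat q x n m - q ^ (n + m + 3) * cgNat q x (n + 1) (m + 1) =
      wt q (x + 1) * cgNat q (x + 1) (n + 1) (m + 1) := by
  have g0 : 0 < q ^ 2 := by positivity
  have g1 : q ^ 2 < 1 := pow_lt_one₀ h0.le h1 two_ne_zero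
  have hv := qSum_div g0 g1 ((q ^ 2) ^ x)⁻¹ (n + 1) (m + 1)
  have hz : ((q ^ 2) ^ x)⁻¹ / q ^ 2 = ((q ^ 2) ^ (x + 1))⁻¹ := by
    rw [pow_succ (q ^ 2) x]; field_simp
  rw [hz, Nat.add_sub_cancel, Nat.add_sub_cancel] at hv
  rw [cgNat_eq, cgNat_eq, cgNat_eq, hv, ← cgNorm_succ_right h0 h1 x n m,
    ← cgNorm_succ_mid h0 h1 x n (m + 1), ← cgNorm_succ_left h0 h1 x]
  have hn := wt_succ_sq h0 h1 n
  have hm := wt_succ_sq h0 h1 m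
  generalize cgNorm q (x + 1) (n + 1) (m + 1) = R
  generalize qSum (q ^ 2) ((q ^ 2) ^ x)⁻¹ n m = v
  generalize qSum (q ^ 2) ((q ^ 2) ^ x)⁻¹ (n + 1) (m + 1) = u
  have e1 : q ^ ((x + 1) * (n + 1) + (x + 1) * (m + 1) + (x + 1)) / q ^ ((n + 1) * (m + 1)) =
      q ^ (n + m + 3) * (q ^ (x * (n + 1) + x * (m + 1) + x) / q ^ ((n + 1) * (m + 1))) := by
    field_simp; ring
  have e2 : q ^ ((x + 1) * (n + 1) + (x + 1) * (m + 1) + (x + 1)) / q ^ ((n + 1) * (m + 1)) *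
      ((q ^ 2) ^ (x + 1))⁻¹ = q ^ (x * n + x * m + x) / q ^ (n * m) := by
    field_simp; ring
  rw [pow_succ (-1 : ℝ) x]
  generalize q ^ ((x + 1) * (n + 1) + (x + 1) * (m + 1) + (x + 1)) / q ^ ((n + 1) * (m + 1)) = A at *
  generalize q ^ (x * n + x * m + x) / q ^ (n * m) = B at *
  generalize q ^ (x * (n + 1) + x * (m + 1) + x) / q ^ ((n + 1) * (m + 1)) = D at *
  generalize ((q ^ 2) ^ (x + 1))⁻¹ = z at *
  generalize (q ^ 2) ^ (n + 1) = t at *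
  generalize (q ^ 2) ^ (m + 1) = t' at *
  generalize q ^ (n + m + 3) = t'' at *
  generalize wt q (n + 1) = wn at *
  generalize wt q (m + 1) = wm at *
  generalize wt q (x + 1) = wx at *
  linear_combination ((-1) ^ x * R * wx * u) * e1 + ((-1) ^ x * R * wx * v) *
    (B * (wm * wm * hn + (1 - t) * hm) - (1 - t) * (1 - t') * e2)

theorem cgNat_delta_zero {q : ℝ} (h0 : 0 < q) (h1 : q < 1) (x m : ℕ) :
    -(q ^ (m + 1) * cgNat q x 0 m) = wt q (x + 1) * cgNat q (x + 1) 0 m := by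
  rw [cgNat_eq, cgNat_eq, ← cgNorm_succ_left h0 h1 x]
  simp only [qSum_zero_left, zero_mul, pow_zero, mul_zero]
  ring


/-- Zero coefficients at negative indices together with vanishing weights absorb every boundary
case, so later computations with shifts need no case distinctions. The same holds for the next three
relations. -/
theorem clebschGordan_gamma {q : ℝ} (hq : q ∈ Set.Ioo (0 : ℝ) 1) (x n m : ℤ) :
    q ^ n * wt q (m + 1) * clebschGordan q x n (m + 1) +
      q ^ m * wt q n * clebschGordan q x (n - 1) m = q ^ x * clebschGordan q x n m := by
  obtain ⟨h0, h1⟩ := hq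
  by_cases hx : x < 0
  · simp [clebschGordan_of_neg q (Or.inl hx)]
  by_cases hn : n < 0
  · rw [clebschGordan_of_neg q (n := n) (by lia), clebschGordan_of_neg q (n := n) (by lia),
      clebschGordan_of_neg q (n := n - 1) (by lia)]
    simp
  by_cases hm : m < 0
  · rw [wt_of_nonpos h0 h1 (n := m + 1) (by lia), clebschGordan_of_neg q (m := m) (by lia),
      clebschGordan_of_neg q (m := m) (by lia)]
    simp
  lift x to ℕ using by lia
  lift n to ℕ using by lia
  lift m to ℕ using by lia
  rcases n with _ | n
  · have := cgNat_gamma_zero h0 h1 x m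
    rw [← clebschGordan_natCast h0 h1, ← clebschGordan_natCast h0 h1] at this
    simpa [wt_zero] using this
  · have := cgNat_gamma_succ h0 h1 x n m
    simp only [← clebschGordan_natCast h0 h1] at this
    push_cast at this ⊢
    rw [add_sub_cancel_right]
    exact_mod_cast this

theorem clebschGordan_beta {q : ℝ} (hq : q ∈ Set.Ioo (0 : ℝ) 1) (x n m : ℤ) :
    q ^ m * wt q (n + 1) * clebschGordan q x (n + 1) m +
      q ^ n * wt q m * clebschGordan q x n (m - 1) = q ^ x * clebschGordan q x n m := by
  have := clebschGordan_gamma hq x m n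
  rwa [clebschGordan_comm hq.1 hq.2 x m, clebschGordan_comm hq.1 hq.2 x m,
    clebschGordan_comm hq.1 hq.2 x (m - 1)] at this

theorem clebschGordan_alpha {q : ℝ} (hq : q ∈ Set.Ioo (0 : ℝ) 1) (x n m : ℤ) :
    wt q (n + 1) * wt q (m + 1) * clebschGordan q x (n + 1) (m + 1) -
      q ^ (n + m + 1) * clebschGordan q x n m = wt q x * clebschGordan q (x - 1) n m := by
  obtain ⟨h0, h1⟩ := hq
  by_cases hx : x < 0
  · simp [clebschGordan_of_neg q (Or.inl hx),
      clebschGordan_of_neg q (x := x - 1) (Or.inl (by lia))]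
  by_cases hn : n < 0
  · rw [wt_of_nonpos h0 h1 (n := n + 1) (by lia), clebschGordan_of_neg q (n := n) (by lia),
      clebschGordan_of_neg q (n := n) (by lia)]
    simp
  by_cases hm : m < 0
  · rw [wt_of_nonpos h0 h1 (n := m + 1) (by lia), clebschGordan_of_neg q (m := m) (by lia),
      clebschGordan_of_neg q (m := m) (by lia)]
    simp
  lift x to ℕ using by lia
  lift n to ℕ using by lia
  lift m to ℕ using by lia
  rcases x with _ | x
  · have := cgNat_alpha_zero h0 h1 n m
    simp only [← clebschGordan_natCast h0 h1] at this
    push_cast at this ⊢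
    rw [wt_zero, zero_mul, sub_eq_zero]
    exact_mod_cast this
  · have := cgNat_alpha h0 h1 x n m
    simp only [← clebschGordan_natCast h0 h1] at this
    push_cast at this ⊢
    rw [add_sub_cancel_right]
    exact_mod_cast this

theorem clebschGordan_delta {q : ℝ} (hq : q ∈ Set.Ioo (0 : ℝ) 1) (x n m : ℤ) :
    wt q n * wt q m * clebschGordan q x (n - 1) (m - 1) -
      q ^ (n + m + 1) * clebschGordan q x n m = wt q (x + 1) * clebschGordan q (x + 1) n m := by
  obtain ⟨h0, h1⟩ := hq
  by_cases hx : x < 0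
  · simp [clebschGordan_of_neg q (Or.inl hx), wt_of_nonpos h0 h1 (n := x + 1) (by lia)]
  by_cases hn : n < 0
  · rw [wt_of_nonpos h0 h1 (n := n) (by lia), clebschGordan_of_neg q (n := n) (by lia),
      clebschGordan_of_neg q (n := n) (by lia)]
    simp
  by_cases hm : m < 0
  · rw [wt_of_nonpos h0 h1 (n := m) (by lia), clebschGordan_of_neg q (m := m) (by lia),
      clebschGordan_of_neg q (m := m) (by lia)]
    simp
  lift x to ℕ using by lia
  lift n to ℕ using by lia
  lift m to ℕ using by lia
  have h2 := cgNat_delta_zero h0 h1 x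
  simp only [← clebschGordan_natCast h0 h1] at h2
  push_cast at h2
  rcases n with _ | n
  · have := h2 m
    push_cast
    simp only [wt_zero, zero_mul, zero_sub, zero_add]
    exact_mod_cast this
  rcases m with _ | m
  · have := h2 (n + 1)
    rw [clebschGordan_comm h0 h1 x, clebschGordan_comm h0 h1 (x + 1)] at this
    push_cast at this ⊢
    simp only [wt_zero, zero_mul, mul_zero, zero_sub, add_zero]
    exact_mod_cast this
  · have := cgNat_delta h0 h1 x n m
    simp only [← clebschGordan_natCast h0 h1] at this
    push_cast at this ⊢
    rw [add_sub_cancel_right, add_sub_cancel_right,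
      show (n : ℤ) + 1 + (m + 1) + 1 = ((n + m + 3 : ℕ) : ℤ) by push_cast; ring, zpow_natCast]
    exact_mod_cast this

/-! ## Tensor product representations in coordinates -/

theorem comul_of {q : ℝ} (hq : q ≠ 0) (g : Gen) : comul hq (Alg.of q g) = comulGen q g :=
  Alg.lift_of _ _ _

theorem pi0_of {q : ℝ} (hq : q ∈ Set.Ioo (0 : ℝ) 1) (g : Gen) :
    pi0 hq (Alg.of q g) = pi0Gen hq g :=
  Alg.lift_of _ _ _

theorem algHom_ext {q : ℝ} {B : Type*} [Ring B] [Algebra ℂ B] {f g : Alg q →ₐ[ℂ] B}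
    (h : ∀ a, f (Alg.of q a) = g (Alg.of q a)) : f = g := by
  refine RingQuot.ringQuot_ext' (S := ℂ) f g ?_
  apply FreeAlgebra.hom_ext
  funext a
  exact h a

/-- Both sides are algebra homomorphisms, so a check on the four generators suffices. It makes the
two three-fold representations equal, and only one has to be studied. -/
theorem comul_coassoc {q : ℝ} (hq : q ≠ 0) :
    ((Algebra.TensorProduct.assoc ℂ ℂ ℂ (Alg q) (Alg q) (Alg q)).toAlgHom.comp
      (Algebra.TensorProduct.map (comul hq) (AlgHom.id ℂ (Alg q)))).comp (comul hq) =
    (Algebra.TensorProduct.map (AlgHom.id ℂ (Alg q)) (comul hq)).comp (comul hq) := by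
  refine algHom_ext (B := Alg q ⊗[ℂ] (Alg q ⊗[ℂ] Alg q)) fun a => ?_
  cases a <;>
  · simp [comul_of, comulGen, TensorProduct.add_tmul, TensorProduct.tmul_add]
    abel

theorem pi12_3_eq_pi1_23 {q : ℝ} (hq : q ∈ Set.Ioo (0 : ℝ) 1) : pi12_3 hq = pi1_23 hq := by
  rw [pi12_3, pi1_23, comul_coassoc]

/-- The action of `π₀` on a generator, on sequences indexed by the integers. -/
def act (q : ℝ) : Gen → (ℤ → ℂ) → ℤ → ℂ
  | .al, F, n => wt q (n + 1) * F (n + 1)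
  | .be, F, n => -(q : ℂ) ^ (n + 1) * F n
  | .ga, F, n => (q : ℂ) ^ n * F n
  | .de, F, n => wt q n * F (n - 1)

/-- Any extension `F` of the coordinates to $\mathbb Z$ is allowed: the value at $-1$ is only met
with the weight $0$. -/
theorem pi0Gen_eq_act {q : ℝ} (hq : q ∈ Set.Ioo (0 : ℝ) 1) (g : Gen) {f : L2 ℕ} {F : ℤ → ℂ}
    (hF : ∀ n : ℕ, f n = F n) (n : ℕ) : pi0Gen hq g f n = act q g F n := by
  obtain ⟨h1, h2, h3, h4⟩ := pi0Gen_apply hq f n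
  cases g
  · rw [h1, act, wt_natCast_add_one, hF]; push_cast; rfl
  · rw [h2, act, hF, ← Nat.cast_add_one, zpow_natCast]; push_cast; rfl
  · rw [h3, act, hF, zpow_natCast]; push_cast; rfl
  · rw [h4, act]
    rcases n with _ | n
    · simp [wt_zero]
    · rw [hF, wt_natCast]; simp

/-- The action of `(π₀ ⊗ π₀)Δ` on a generator, on functions indexed by pairs of integers. -/
def actTwo (q : ℝ) (g : Gen) (F : ℤ → ℤ → ℂ) (n m : ℤ) : ℂ :=
  let t (a b : Gen) := act q a (fun n => act q b (F n) m) n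
  match g with
  | .al => t .al .al + t .be .ga
  | .be => t .al .be + t .be .de
  | .ga => t .ga .al + t .de .ga
  | .de => t .de .de + t .ga .be

/-- The action of `(π₀ ⊗ π₀ ⊗ π₀)(1 ⊗ Δ)Δ` on a generator, on functions indexed by triples of
integers. -/
def actThree (q : ℝ) (g : Gen) (F : ℤ → ℤ → ℤ → ℂ) (n m k : ℤ) : ℂ :=
  let t (a b : Gen) := act q a (fun n => actTwo q b (F n) m k) n
  match g with
  | .al => t .al .al + t .be .ga
  | .be => t .al .be + t .be .de
  | .ga => t .ga .al + t .de .ga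
  | .de => t .de .de + t .ga .be

/-- The representation `(π₀ ⊗ π₀)Δ`. -/
def piTwo {q : ℝ} (hq : q ∈ Set.Ioo (0 : ℝ) 1) :
    Alg q →ₐ[ℂ] (L2 (ℕ × ℕ) →L[ℂ] L2 (ℕ × ℕ)) :=
  (pi0Two hq).comp (comul hq.1.ne')

theorem pi0Two_tmul {q : ℝ} (hq : q ∈ Set.Ioo (0 : ℝ) 1) (a b : Alg q) :
    pi0Two hq (a ⊗ₜ b) = ampLeft ℕ ℕ (pi0 hq a) * ampRight ℕ ℕ (pi0 hq b) :=
  Algebra.TensorProduct.lift_tmul _ _ _ _ _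

theorem pi0Three_tmul {q : ℝ} (hq : q ∈ Set.Ioo (0 : ℝ) 1) (a : Alg q) (b : Alg q ⊗[ℂ] Alg q) :
    pi0Three hq (a ⊗ₜ b) = ampLeft ℕ (ℕ × ℕ) (pi0 hq a) * ampRight ℕ (ℕ × ℕ) (pi0Two hq b) :=
  Algebra.TensorProduct.lift_tmul _ _ _ _ _

theorem piTwo_of {q : ℝ} (hq : q ∈ Set.Ioo (0 : ℝ) 1) (g : Gen) :
    piTwo hq (Alg.of q g) =
      let t (a b : Gen) := ampLeft ℕ ℕ (pi0Gen hq a) * ampRight ℕ ℕ (pi0Gen hq b)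
      match g with
      | .al => t .al .al + t .be .ga
      | .be => t .al .be + t .be .de
      | .ga => t .ga .al + t .de .ga
      | .de => t .de .de + t .ga .be := by
  cases g <;> simp [piTwo, comul_of, comulGen, pi0Two_tmul, pi0_of]

theorem pi1_23_of {q : ℝ} (hq : q ∈ Set.Ioo (0 : ℝ) 1) (g : Gen) :
    pi1_23 hq (Alg.of q g) =
      let t (a b : Gen) := ampLeft ℕ (ℕ × ℕ) (pi0Gen hq a) *
        ampRight ℕ (ℕ × ℕ) (piTwo hq (Alg.of q b))
      match g with
      | .al => t .al .al + t .be .ga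
      | .be => t .al .be + t .be .de
      | .ga => t .ga .al + t .de .ga
      | .de => t .de .de + t .ga .be := by
  cases g <;>
  · rw [pi1_23, AlgHom.comp_apply, AlgHom.comp_apply, comul_of]
    simp only [comulGen, map_add, Algebra.TensorProduct.map_tmul, pi0Three_tmul,
      AlgHom.id_apply, pi0_of]
    rfl

theorem ampLeft_mul_ampRight_apply {κ : Type*} {q : ℝ} (hq : q ∈ Set.Ioo (0 : ℝ) 1) (a : Gen)
    (T : L2 κ →L[ℂ] L2 κ) (f : L2 (ℕ × κ)) {G : ℤ → κ → ℂ}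
    (hG : ∀ (n : ℕ) (j : κ), T (slice (Equiv.refl (ℕ × κ)) f n) j = G n j) (n : ℕ) (j : κ) :
    (ampLeft ℕ κ (pi0Gen hq a) * ampRight ℕ κ T) f (n, j) = act q a (fun n => G n j) n := by
  rw [mul_apply_eq_comp, ampLeft_apply]
  refine pi0Gen_eq_act hq a (fun i => ?_) n
  rw [slice_apply]
  exact (ampRight_apply T f i j).trans (hG i j)

theorem piTwo_apply {q : ℝ} (hq : q ∈ Set.Ioo (0 : ℝ) 1) (g : Gen) {f : L2 (ℕ × ℕ)}
    {F : ℤ → ℤ → ℂ} (hF : ∀ n m : ℕ, f (n, m) = F n m) (n m : ℕ) :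
    piTwo hq (Alg.of q g) f (n, m) = actTwo q g F n m := by
  have key : ∀ a b : Gen, (ampLeft ℕ ℕ (pi0Gen hq a) * ampRight ℕ ℕ (pi0Gen hq b)) f (n, m) =
      act q a (fun n => act q b (F n) m) n := fun a b =>
    ampLeft_mul_ampRight_apply hq a _ f (G := fun n j => act q b (F n) j)
      (fun n j => pi0Gen_eq_act hq b (fun m => hF n m) j) n m
  rw [piTwo_of]
  cases g <;>
  · simp only [add_apply, lp.coeFn_add, Pi.add_apply, key]
    rfl

theorem pi1_23_apply {q : ℝ} (hq : q ∈ Set.Ioo (0 : ℝ) 1) (g : Gen) {f : L2 (ℕ × ℕ × ℕ)}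
    {F : ℤ → ℤ → ℤ → ℂ} (hF : ∀ n m k : ℕ, f (n, m, k) = F n m k) (n m k : ℕ) :
    pi1_23 hq (Alg.of q g) f (n, m, k) = actThree q g F n m k := by
  have key : ∀ a b : Gen, (ampLeft ℕ (ℕ × ℕ) (pi0Gen hq a) *
      ampRight ℕ (ℕ × ℕ) (piTwo hq (Alg.of q b))) f (n, m, k) =
      act q a (fun n => actTwo q b (F n) m k) n := fun a b =>
    ampLeft_mul_ampRight_apply hq a _ f (G := fun n j => actTwo q b (F n) j.1 j.2)
      (fun n j => piTwo_apply hq b (fun m k => hF n m k) j.1 j.2) n (m, k)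
  rw [pi1_23_of]
  cases g <;>
  · simp only [add_apply, lp.coeFn_add, Pi.add_apply, key]
    rfl

/-! ## Adjoints -/

theorem inner_eq_tsum_slice {ι κ ω : Type*} (e : κ × ι ≃ ω) (f g : L2 ω) :
    HasSum (fun j => inner ℂ (slice e f j) (slice e g j)) (inner ℂ f g) := by
  have h1 : HasSum (fun p : κ × ι => inner ℂ (f (e p)) (g (e p))) (inner ℂ f g) :=
    (e.hasSum_iff (f := fun i => inner ℂ (f i) (g i))).2 (lp.hasSum_inner (𝕜 := ℂ) f g)
  exact h1.prod_fiberwise fun j => lp.hasSum_inner (𝕜 := ℂ) (slice e f j) (slice e g j)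

theorem star_ampHom {ι κ ω : Type*} (e : κ × ι ≃ ω) (T : L2 ι →L[ℂ] L2 ι) :
    star (ampHom e T) = ampHom e (star T) := by
  refine ((ContinuousLinearMap.eq_adjoint_iff _ _).2 fun f g => ?_).symm
  refine (inner_eq_tsum_slice e _ g).unique ?_
  convert inner_eq_tsum_slice e f (ampHom e T g) using 2 with j
  change inner ℂ (slice e (amp e (star T) f) j) _ = inner ℂ _ (slice e (amp e T g) j)
  rw [slice_amp, slice_amp, ContinuousLinearMap.star_eq_adjoint,
    ContinuousLinearMap.adjoint_inner_left]

theorem star_pi0Gen {q : ℝ} (hq : q ∈ Set.Ioo (0 : ℝ) 1) :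
    star (pi0Gen hq .al) = pi0Gen hq .de ∧ star (pi0Gen hq .de) = pi0Gen hq .al ∧
    star (pi0Gen hq .be) = pi0Gen hq .be ∧ star (pi0Gen hq .ga) = pi0Gen hq .ga := by
  have h1 : star (pi0Gen hq .al) = pi0Gen hq .de := by
    refine ((ContinuousLinearMap.eq_adjoint_iff _ _).2 fun f g => ?_).symm
    have h := lp.hasSum_inner (𝕜 := ℂ) (pi0Gen hq .de f) g
    -- The zeroth coordinate of $\pi_0(\delta)f$ vanishes, so dropping it and shifting the summation
    -- index matches the two inner products.
    rw [← hasSum_nat_add_iff' 1, Finset.sum_range_one, (pi0Gen_apply hq f 0).2.2.2] at h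
    simp only [mul_zero, pow_zero, sub_self, Real.sqrt_zero, Complex.ofReal_zero, zero_mul,
      inner_zero_left, sub_zero] at h
    refine (h.congr_fun fun n => ?_).unique (lp.hasSum_inner (𝕜 := ℂ) f (pi0Gen hq .al g))
    rw [(pi0Gen_apply hq f _).2.2.2, (pi0Gen_apply hq g _).1]
    simp [mul_add]
    ring
  refine ⟨h1, by rw [← h1, star_star], ?_, ?_⟩
  · refine ((ContinuousLinearMap.eq_adjoint_iff _ _).2 fun f g => ?_).symm
    rw [lp.inner_eq_tsum (𝕜 := ℂ), lp.inner_eq_tsum (𝕜 := ℂ)]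
    congr 1 with n
    rw [(pi0Gen_apply hq f _).2.1, (pi0Gen_apply hq g _).2.1]
    simp
    ring
  · refine ((ContinuousLinearMap.eq_adjoint_iff _ _).2 fun f g => ?_).symm
    rw [lp.inner_eq_tsum (𝕜 := ℂ), lp.inner_eq_tsum (𝕜 := ℂ)]
    congr 1 with n
    rw [(pi0Gen_apply hq f _).2.2.1, (pi0Gen_apply hq g _).2.2.1]
    simp
    ring

theorem star_amp_mul {ι κ : Type*} (S : L2 ι →L[ℂ] L2 ι) (T : L2 κ →L[ℂ] L2 κ) :
    star (ampLeft ι κ S * ampRight ι κ T) = ampLeft ι κ (star S) * ampRight ι κ (star T) := by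
  rw [star_mul, ampLeft, ampRight, star_ampHom, star_ampHom]
  exact (commute_amp (star S) (star T)).eq.symm

/-- Combined with self-adjointness of $\pi_0(\gamma)$, this gives
$\pi_0(\gamma)^*=\pi_0(-q^{-1}\beta)$, which passes to the tensor products through the formulas for
$\Delta$. -/
theorem pi0Gen_be {q : ℝ} (hq : q ∈ Set.Ioo (0 : ℝ) 1) :
    pi0Gen hq .be = -(q : ℂ) • pi0Gen hq .ga := by
  ext f n
  rw [(pi0Gen_apply hq f n).2.1, smul_apply, lp.coeFn_smul, Pi.smul_apply,
    (pi0Gen_apply hq f n).2.2.1]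
  push_cast [smul_eq_mul]
  ring

theorem star_piTwo {q : ℝ} (hq : q ∈ Set.Ioo (0 : ℝ) 1) :
    star (piTwo hq (Alg.of q .al)) = piTwo hq (Alg.of q .de) ∧
    star (piTwo hq (Alg.of q .de)) = piTwo hq (Alg.of q .al) ∧
    star (piTwo hq (Alg.of q .ga)) = piTwo hq (gaStar q) := by
  obtain ⟨h1, h2, h3, h4⟩ := star_pi0Gen hq
  have hq' : (q : ℂ) ≠ 0 := by exact_mod_cast hq.1.ne'
  have key : star (piTwo hq (Alg.of q .al)) = piTwo hq (Alg.of q .de) := by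
    simp only [piTwo_of, star_add, star_amp_mul, h1, h3, h4]
    simp only [pi0Gen_be, map_smul, smul_mul_assoc, mul_smul_comm]
  refine ⟨key, by rw [← key, star_star], ?_⟩
  simp only [gaStar, map_neg, map_smul, piTwo_of, star_add, star_amp_mul, h1, h2, h4]
  simp only [pi0Gen_be, map_smul, smul_mul_assoc, mul_smul_comm, smul_add, smul_smul]
  field_simp
  simp [add_comm]

theorem star_pi1_23 {q : ℝ} (hq : q ∈ Set.Ioo (0 : ℝ) 1) :
    star (pi1_23 hq (Alg.of q .al)) = pi1_23 hq (Alg.of q .de) ∧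
    star (pi1_23 hq (Alg.of q .de)) = pi1_23 hq (Alg.of q .al) ∧
    star (pi1_23 hq (Alg.of q .ga)) = pi1_23 hq (gaStar q) := by
  obtain ⟨h1, h2, h3, h4⟩ := star_pi0Gen hq
  obtain ⟨g1, g2, g3⟩ := star_piTwo hq
  have hq' : (q : ℂ) ≠ 0 := by exact_mod_cast hq.1.ne'
  rw [gaStar, map_neg, map_smul] at g3
  have key : star (pi1_23 hq (Alg.of q .al)) = pi1_23 hq (Alg.of q .de) := by
    simp only [pi1_23_of, star_add, star_amp_mul, h1, h3, g1, g3]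
    simp only [pi0Gen_be, map_smul, map_neg, smul_mul_assoc, mul_smul_comm, mul_neg, neg_smul,
      smul_neg, neg_neg, neg_mul, smul_smul, inv_mul_cancel₀ hq', one_smul]
  refine ⟨key, by rw [← key, star_star], ?_⟩
  simp only [gaStar, map_neg, map_smul, pi1_23_of, star_add, star_amp_mul, h2, h4, g1, g3]
  simp only [pi0Gen_be, map_smul, map_neg, smul_mul_assoc, mul_smul_comm, mul_neg, neg_smul,
      smul_neg, neg_neg, neg_mul, smul_smul, smul_add,
      inv_mul_cancel₀ hq', one_smul, neg_add]
  exact add_comm _ _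

/-! ## Eigenvectors in the two-fold tensor product -/

theorem ofCoord_eq {ι : Type*} {f : ι → ℂ} {g : L2 ι} (h : ∀ i, g i = f i) : ofCoord f = g := by
  obtain rfl : (fun i => g i) = f := funext h
  exact dif_pos (lp.memℓp g)

/-- The coordinates of the vector `∑_{k - m = s} C_{y,m,k} e_m ⊗ e_k`. -/
def cgFun (q : ℝ) (y s m k : ℤ) : ℂ := if k - m = s then (clebschGordan q y m k : ℂ) else 0

/-- The vector `∑_{k - m = s} C_{y,m,k} e_m ⊗ e_k` of `ℓ²(ℕ) ⊗ ℓ²(ℕ)`. -/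
def cgVec (q : ℝ) (y s : ℤ) : L2 (ℕ × ℕ) := ofCoord fun p => cgFun q y s p.1 p.2

section

variable {q : ℝ} (hq : q ∈ Set.Ioo (0 : ℝ) 1) (y s n m : ℤ)

theorem ofReal_ne_zero_of_mem {q : ℝ} (hq : q ∈ Set.Ioo (0 : ℝ) 1) : (q : ℂ) ≠ 0 := by
  exact_mod_cast hq.1.ne'

include hq

/-- Both terms of $\Delta(\alpha)$ preserve the difference of the two indices, so a single
contiguous relation settles the whole action. The other generators work likewise, $\beta$ and
$\gamma$ shifting the difference by one. -/
theorem actTwo_al_cgFun : actTwo q .al (cgFun q y s) n m = wt q y * cgFun q (y - 1) s n m := by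
  have h := congrArg Complex.ofReal (clebschGordan_alpha hq y n m)
  push_cast at h
  simp only [actTwo, act, cgFun]
  simp only [show m + 1 - (n + 1) = m - n by ring]
  split_ifs
  · rw [← h, add_right_comm, zpow_add₀ (ofReal_ne_zero_of_mem hq) (n + 1)]
    ring
  · simp

theorem actTwo_de_cgFun :
    actTwo q .de (cgFun q y s) n m = wt q (y + 1) * cgFun q (y + 1) s n m := by
  have h := congrArg Complex.ofReal (clebschGordan_delta hq y n m)
  push_cast at h
  simp only [actTwo, act, cgFun]
  simp only [show m - 1 - (n - 1) = m - n by ring]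
  split_ifs
  · rw [← h, add_assoc, zpow_add₀ (ofReal_ne_zero_of_mem hq) n]
    ring
  · simp

theorem actTwo_ga_cgFun :
    actTwo q .ga (cgFun q y s) n m = (q : ℂ) ^ y * cgFun q y (s - 1) n m := by
  have h := congrArg Complex.ofReal (clebschGordan_gamma hq y n m)
  push_cast at h
  simp only [actTwo, act, cgFun]
  simp only [show m + 1 - n = s ↔ m - n = s - 1 by lia, show m - (n - 1) = s ↔ m - n = s - 1 by lia]
  split_ifs
  · rw [← h]
    ring
  · simp

theorem actTwo_be_cgFun :
    actTwo q .be (cgFun q y s) n m = -(q : ℂ) ^ (y + 1) * cgFun q y (s + 1) n m := by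
  have h := congrArg Complex.ofReal (clebschGordan_beta hq y n m)
  push_cast at h
  have h0 := ofReal_ne_zero_of_mem hq
  simp only [actTwo, act, cgFun]
  simp only [show m - (n + 1) = s ↔ m - n = s + 1 by lia, show m - 1 - n = s ↔ m - n = s + 1 by lia]
  split_ifs
  · rw [zpow_add_one₀ h0, zpow_add_one₀ h0, zpow_add_one₀ h0]
    linear_combination -(q : ℂ) * h
  · simp

end

/-! ### Lowest coefficients ($x=0$) and square-summability -/

theorem qSum_one {q : ℝ} (h0 : 0 < q) (h1 : q < 1) (n m : ℕ) : qSum q 1 n m = q ^ (n * m) := by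
  induction n generalizing m with
  | zero => rw [qSum_zero_left, zero_mul, pow_zero]
  | succ n ih =>
    rcases m with _ | m
    · rw [qSum_comm, qSum_zero_left, mul_zero, pow_zero]
    · rw [qSum_succ_succ h0 h1, ih]; ring

theorem cgNat_zero {q : ℝ} (h0 : 0 < q) (h1 : q < 1) (n m : ℕ) :
    cgNat q 0 n m = q ^ (n * m) * √(qPochInf (q ^ 2) (q ^ 2) /
      (qPoch (q ^ 2) (q ^ 2) n * qPoch (q ^ 2) (q ^ 2) m)) := by
  simp only [cgNat, pow_zero, inv_one, zero_mul, add_zero, one_mul, qPoch_zero]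
  rw [qSum_one (by positivity) (pow_lt_one₀ h0.le h1 two_ne_zero)]
  field_simp
  ring

theorem cgNat_zero_sq {q : ℝ} (h0 : 0 < q) (h1 : q < 1) (n m : ℕ) :
    cgNat q 0 n m ^ 2 = (q ^ 2) ^ (n * m) * (qPochInf (q ^ 2) (q ^ 2) /
      (qPoch (q ^ 2) (q ^ 2) n * qPoch (q ^ 2) (q ^ 2) m)) := by
  have g0 : 0 < q ^ 2 := by positivity
  have g1 : q ^ 2 < 1 := pow_lt_one₀ h0.le h1 two_ne_zero
  have := qPoch_self_pos g0 g1 n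
  have := qPoch_self_pos g0 g1 m
  have := qPochInf_self_pos g0 g1
  rw [cgNat_zero h0 h1, mul_pow, Real.sq_sqrt (by positivity)]
  ring

theorem cgNat_zero_sq_le {q : ℝ} (h0 : 0 < q) (h1 : q < 1) (n m : ℕ) :
    cgNat q 0 n m ^ 2 ≤ (q ^ 2) ^ (n * m) * (qPochInf (q ^ 2) (q ^ 2))⁻¹ := by
  have g0 : 0 < q ^ 2 := by positivity
  have g1 : q ^ 2 < 1 := pow_lt_one₀ h0.le h1 two_ne_zero
  have a1 := qPochInf_self_pos g0 g1
  have a2 := qPochInf_self_le g0 g1 n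
  have a3 := qPochInf_self_le g0 g1 m
  have a4 := qPoch_self_pos g0 g1 n
  rw [cgNat_zero_sq h0 h1]
  gcongr
  rw [← one_div, ← div_div]
  gcongr
  exact div_le_one_of_le₀ a2 a4.le

theorem clebschGordan_zero_sq_le {q : ℝ} (hq : q ∈ Set.Ioo (0 : ℝ) 1) {s : ℤ} {n m : ℕ}
    (h : (m : ℤ) - n = s) : clebschGordan q 0 n m ^ 2 ≤
      (qPochInf (q ^ 2) (q ^ 2))⁻¹ * (q ^ s.natAbs)⁻¹ * (q ^ n * q ^ m) := by
  obtain ⟨h0, h1⟩ := hq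
  have a1 := qPochInf_self_pos (by positivity) (pow_lt_one₀ h0.le h1 two_ne_zero)
  have h2 := clebschGordan_natCast h0 h1 0 n m
  rw [Nat.cast_zero] at h2
  rw [h2]
  refine (cgNat_zero_sq_le h0 h1 n m).trans ?_
  rw [mul_comm, mul_assoc]
  gcongr
  rw [inv_mul_eq_div, le_div_iff₀ (by positivity), ← pow_mul, ← pow_add, ← pow_add]
  -- The exponent inequality is $n+m\le 2nm+|m-n|$, that is, $\min(n,m)\le nm$ when both are
  -- positive; the term $|s|$ covers the case where one of them is $0$.
  refine pow_le_pow_of_le_one h0.le h1.le ?_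
  rcases n with _ | n
  · lia
  rcases m with _ | m
  · lia
  · ring_nf; lia

section

variable {q : ℝ} (hq : q ∈ Set.Ioo (0 : ℝ) 1)

include hq

theorem summable_geometric_prod : Summable fun p : ℕ × ℕ => q ^ p.1 * q ^ p.2 :=
  (summable_geometric_of_lt_one hq.1.le hq.2).mul_of_nonneg
    (summable_geometric_of_lt_one hq.1.le hq.2) (fun _ => pow_nonneg hq.1.le _)
    (fun _ => pow_nonneg hq.1.le _)

/-- Only $y=0$ needs an estimate. For larger $y$ the vector is a multiple of the image of its
predecessor under the bounded operator of $\delta$. -/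
theorem exists_cgVec (y : ℕ) (s : ℤ) :
    ∃ g : L2 (ℕ × ℕ), ∀ p : ℕ × ℕ, g p = cgFun q y s p.1 p.2 := by
  induction y with
  | zero =>
    refine ⟨⟨fun p => cgFun q 0 s p.1 p.2, ?_⟩, fun _ => rfl⟩
    refine memℓp_gen ?_
    refine Summable.of_nonneg_of_le (fun _ => by positivity) (fun p => ?_)
      ((summable_geometric_prod hq).mul_left
        ((qPochInf (q ^ 2) (q ^ 2))⁻¹ * (q ^ s.natAbs)⁻¹))
    simp only [ENNReal.toReal_ofNat, Real.rpow_ofNat, cgFun]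
    split_ifs with h
    · rw [Complex.norm_real, Real.norm_eq_abs, sq_abs]
      exact clebschGordan_zero_sq_le hq h
    · have := hq.1
      have a1 := qPochInf_self_pos (by positivity) (pow_lt_one₀ hq.1.le hq.2 two_ne_zero)
      rw [norm_zero, zero_pow two_ne_zero]
      positivity
  | succ y ih =>
    obtain ⟨g, hg⟩ := ih
    refine ⟨((wt q (y + 1) : ℂ))⁻¹ • piTwo hq (Alg.of q .de) g, fun p => ?_⟩
    have hw : (wt q (y + 1) : ℂ) ≠ 0 := by exact_mod_cast (wt_succ_pos hq.1 hq.2 y).ne'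
    rw [lp.coeFn_smul, Pi.smul_apply]
    obtain ⟨n, m⟩ := p
    rw [piTwo_apply hq .de (F := cgFun q y s) (fun n m => hg (n, m)), actTwo_de_cgFun hq,
      smul_eq_mul, inv_mul_cancel_left₀ hw]
    push_cast
    rfl

theorem cgVec_apply (y s : ℤ) (p : ℕ × ℕ) : cgVec q y s p = cgFun q y s p.1 p.2 := by
  by_cases hy : y < 0
  · rw [cgVec, ofCoord_eq (g := 0)]
    · simp [cgFun, clebschGordan_of_neg q (Or.inl hy)]
    · simp [cgFun, clebschGordan_of_neg q (Or.inl hy)]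
  · lift y to ℕ using by lia
    obtain ⟨g, hg⟩ := exists_cgVec hq y s
    rw [cgVec, ofCoord_eq hg, hg]

theorem cgVec_of_neg {y : ℤ} (hy : y < 0) (s : ℤ) : cgVec q y s = 0 := by
  ext p
  rw [cgVec_apply hq]
  simp [cgFun, clebschGordan_of_neg q (Or.inl hy)]

theorem piTwo_al_cgVec (y s : ℤ) :
    piTwo hq (Alg.of q .al) (cgVec q y s) = (wt q y : ℂ) • cgVec q (y - 1) s := by
  ext ⟨n, m⟩
  rw [piTwo_apply hq .al (fun n m => cgVec_apply hq y s (n, m)), actTwo_al_cgFun hq,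
    lp.coeFn_smul, Pi.smul_apply, cgVec_apply hq, smul_eq_mul]

theorem piTwo_de_cgVec (y s : ℤ) :
    piTwo hq (Alg.of q .de) (cgVec q y s) = (wt q (y + 1) : ℂ) • cgVec q (y + 1) s := by
  ext ⟨n, m⟩
  rw [piTwo_apply hq .de (fun n m => cgVec_apply hq y s (n, m)), actTwo_de_cgFun hq,
    lp.coeFn_smul, Pi.smul_apply, cgVec_apply hq, smul_eq_mul]

theorem piTwo_ga_cgVec (y s : ℤ) :
    piTwo hq (Alg.of q .ga) (cgVec q y s) = (q : ℂ) ^ y • cgVec q y (s - 1) := by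
  ext ⟨n, m⟩
  rw [piTwo_apply hq .ga (fun n m => cgVec_apply hq y s (n, m)), actTwo_ga_cgFun hq,
    lp.coeFn_smul, Pi.smul_apply, cgVec_apply hq, smul_eq_mul]

theorem piTwo_gaStar_cgVec (y s : ℤ) :
    piTwo hq (gaStar q) (cgVec q y s) = (q : ℂ) ^ y • cgVec q y (s + 1) := by
  have h0 := ofReal_ne_zero_of_mem hq
  rw [gaStar, map_neg, map_smul]
  ext ⟨n, m⟩
  rw [neg_apply, smul_apply, lp.coeFn_neg, Pi.neg_apply, lp.coeFn_smul, Pi.smul_apply,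
    piTwo_apply hq .be (fun n m => cgVec_apply hq y s (n, m)), actTwo_be_cgFun hq,
    lp.coeFn_smul, Pi.smul_apply, cgVec_apply hq, smul_eq_mul, smul_eq_mul, zpow_add_one₀ h0]
  field_simp

end

/-- Vectors obtained from each other by a weighted lowering operator and its adjoint are
orthogonal. -/
theorem inner_eq_of_ladder {q : ℝ} (hq : q ∈ Set.Ioo (0 : ℝ) 1) {H : Type*}
    [NormedAddCommGroup H] [InnerProductSpace ℂ H] [CompleteSpace H] {A D : H →L[ℂ] H}
    (hA : star A = D) {u v : ℤ → H}
    (hAu : ∀ x, A (u x) = (wt q x : ℂ) • u (x - 1)) (hDu : ∀ x, D (u x) = (wt q (x + 1) : ℂ) • u (x + 1))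
    (hAv : ∀ x, A (v x) = (wt q x : ℂ) • v (x - 1)) (hDv : ∀ x, D (v x) = (wt q (x + 1) : ℂ) • v (x + 1))
    (x y : ℕ) : inner ℂ (u x) (v y) = if x = y then inner ℂ (u 0) (v 0) else 0 := by
  have hw : ∀ n : ℕ, (wt q (n + 1) : ℂ) ≠ 0 := fun n => by
    exact_mod_cast (wt_succ_pos hq.1 hq.2 n).ne'
  -- Moving the operators across the inner product relates the pairs $(x-1,y)$ and $(x,y+1)$, and in
  -- `h2` the pairs $(x+1,y)$ and $(x,y-1)$. The induction descends until one index is $0$, where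
  -- the weight vanishes.
  have h1 : ∀ x y : ℤ, (wt q x : ℂ) * inner ℂ (u (x - 1)) (v y) =
      wt q (y + 1) * inner ℂ (u x) (v (y + 1)) := fun x y => by
    have := ContinuousLinearMap.adjoint_inner_right A (u x) (v y)
    rw [← ContinuousLinearMap.star_eq_adjoint, hA, hDv, hAu, inner_smul_left, inner_smul_right,
      Complex.conj_ofReal] at this
    exact this.symm
  have h2 : ∀ x y : ℤ, (wt q (x + 1) : ℂ) * inner ℂ (u (x + 1)) (v y) =
      wt q y * inner ℂ (u x) (v (y - 1)) := fun x y => by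
    have := ContinuousLinearMap.adjoint_inner_left A (v y) (u x)
    rw [← ContinuousLinearMap.star_eq_adjoint, hA, hDu, hAv, inner_smul_left, inner_smul_right,
      Complex.conj_ofReal] at this
    exact this
  induction x generalizing y with
  | zero =>
    rcases y with _ | y
    · simp
    · have := h1 0 y
      rw [wt_zero, Complex.ofReal_zero, zero_mul, eq_comm, mul_eq_zero] at this
      simpa using this.resolve_left (hw y)
  | succ x ih =>
    rcases y with _ | y
    · have := h2 x 0
      rw [wt_zero, Complex.ofReal_zero, zero_mul, mul_eq_zero] at this
      simpa using this.resolve_left (hw x)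
    · have := h2 x (y + 1)
      rw [add_sub_cancel_right, ih] at this
      push_cast
      rcases eq_or_ne x y with rfl | hxy
      · have h4 := mul_left_cancel₀ (hw _) this
        rw [h4]
      · rw [if_neg hxy, mul_zero] at this
        rw [if_neg (by simpa using hxy)]
        exact (mul_eq_zero.1 this).resolve_left (hw x)

/-! ### Orthonormality of the two-fold Clebsch–Gordan vectors -/

section

variable {q : ℝ} (hq : q ∈ Set.Ioo (0 : ℝ) 1)

theorem q_sq_mem {q : ℝ} (hq : q ∈ Set.Ioo (0 : ℝ) 1) : q ^ 2 ∈ Set.Ioo (0 : ℝ) 1 :=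
  ⟨pow_pos hq.1 2, pow_lt_one₀ hq.1.le hq.2 two_ne_zero⟩

theorem hasSum_cgFun_right (y s : ℤ) (c : ℤ → ℂ) (n : ℕ) :
    HasSum (fun m : ℕ => cgFun q y s n m * c m) (clebschGordan q y n (n + s) * c (n + s)) := by
  by_cases h : 0 ≤ n + s
  · obtain ⟨m, hm⟩ := Int.eq_ofNat_of_zero_le h
    convert hasSum_single m fun k hk => ?_ using 1
    · rw [cgFun, if_pos (by lia), hm]
    · rw [cgFun, if_neg (by lia), zero_mul]
  · rw [clebschGordan_of_neg q (by lia), Complex.ofReal_zero, zero_mul]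
    convert hasSum_zero with m
    rw [cgFun, if_neg (by lia), zero_mul]

include hq

theorem hasSum_inner_cgVec (y y' s : ℤ) :
    HasSum (fun n : ℕ => ((clebschGordan q y n (n + s) * clebschGordan q y' n (n + s) : ℝ) : ℂ))
      (inner ℂ (cgVec q y s) (cgVec q y' s)) := by
  refine (lp.hasSum_inner (𝕜 := ℂ) (cgVec q y s) (cgVec q y' s)).prod_fiberwise fun n => ?_
  have h := hasSum_cgFun_right (q := q) y s (fun m => cgFun q y' s n m) n
  rw [cgFun, if_pos (by ring), ← Complex.ofReal_mul] at h
  refine h.congr_fun fun m => ?_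
  rw [cgVec_apply hq, cgVec_apply hq]
  simp only [cgFun]
  split_ifs <;> simp [mul_comm]

theorem inner_cgVec_of_ne (y y' : ℤ) {s s' : ℤ} (h : s ≠ s') :
    inner ℂ (cgVec q y s) (cgVec q y' s') = 0 := by
  rw [lp.inner_eq_tsum (𝕜 := ℂ)]
  convert tsum_zero with p
  rw [cgVec_apply hq, cgVec_apply hq, cgFun, cgFun]
  split_ifs <;> first | lia | simp

/-- At $y=0$ the eigenvalue $q^y$ is $1$, so $\gamma$ and its adjoint $\gamma^*$ act as mutually
inverse shifts of $s$. -/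
theorem inner_cgVec_zero_succ (s : ℤ) :
    inner ℂ (cgVec q 0 (s + 1)) (cgVec q 0 (s + 1)) = inner ℂ (cgVec q 0 s) (cgVec q 0 s) := by
  have h := ContinuousLinearMap.adjoint_inner_right (piTwo hq (Alg.of q .ga)) (cgVec q 0 (s + 1))
    (cgVec q 0 s)
  rw [← ContinuousLinearMap.star_eq_adjoint, (star_piTwo hq).2.2, piTwo_gaStar_cgVec,
    piTwo_ga_cgVec, zpow_zero, one_smul, one_smul, add_sub_cancel_right] at h
  exact h

/-- The factor $q^{2n(n+s)}$ in $C_{0,n,n+s}^2$ kills every term with $n>0$ as $s\to\infty$, and the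
term $n=0$ tends to $1$. As the norm does not depend on $s$, this determines it. -/
theorem tendsto_inner_cgVec_zero :
    Filter.Tendsto (fun s : ℕ => inner ℂ (cgVec q 0 s) (cgVec q 0 s)) Filter.atTop (nhds 1) := by
  have h0 := hq.1
  have h1 := hq.2
  obtain ⟨g0, g1⟩ := q_sq_mem hq
  have hI := qPochInf_self_pos g0 g1
  have hP := qPoch_self_pos g0 g1
  have hg : ∑' n : ℕ, (if n = 0 then (1 : ℂ) else 0) = 1 := tsum_ite_eq 0 _
  simp_rw [fun s : ℕ => (hasSum_inner_cgVec hq 0 0 s).tsum_eq.symm]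
  rw [← hg]
  have hC : ∀ n s : ℕ, clebschGordan q 0 n (n + s) * clebschGordan q 0 n (n + s) =
      cgNat q 0 n (n + s) ^ 2 := fun n s => by
    rw [← Nat.cast_add, ← Nat.cast_zero, clebschGordan_natCast h0 h1, sq]
  simp_rw [hC]
  refine tendsto_tsum_of_dominated_convergence
    (bound := fun n => (q ^ 2) ^ n * (qPochInf (q ^ 2) (q ^ 2))⁻¹)
    ((summable_geometric_of_lt_one g0.le g1).mul_right _) (fun n => ?_)
    (Filter.Eventually.of_forall fun s n => ?_)
  · have hlim : Filter.Tendsto (fun s => qPochInf (q ^ 2) (q ^ 2) /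
        (qPoch (q ^ 2) (q ^ 2) n * qPoch (q ^ 2) (q ^ 2) (n + s))) Filter.atTop
        (nhds (qPochInf (q ^ 2) (q ^ 2) /
          (qPoch (q ^ 2) (q ^ 2) n * qPochInf (q ^ 2) (q ^ 2)))) := by
      refine Filter.Tendsto.div tendsto_const_nhds (Filter.Tendsto.const_mul _ ?_)
        (mul_pos (hP n) hI).ne'
      simp_rw [add_comm n]
      exact (tendsto_qPoch g0 g1 _).comp (Filter.tendsto_add_atTop_nat n)
    have hmain : Filter.Tendsto (fun s : ℕ => cgNat q 0 n (n + s) ^ 2) Filter.atTop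
        (nhds (if n = 0 then 1 else 0)) := by
      simp_rw [cgNat_zero_sq h0 h1]
      rcases eq_or_ne n 0 with rfl | hn
      · simpa [qPoch_zero, hI.ne'] using hlim
      · rw [if_neg hn, ← zero_mul (qPochInf (q ^ 2) (q ^ 2) /
          (qPoch (q ^ 2) (q ^ 2) n * qPochInf (q ^ 2) (q ^ 2)))]
        refine Filter.Tendsto.mul ?_ hlim
        refine (tendsto_pow_atTop_nhds_zero_of_lt_one g0.le g1).comp ?_
        refine Filter.tendsto_atTop_mono (fun s => ?_) Filter.tendsto_id
        have : 1 ≤ n := Nat.one_le_iff_ne_zero.2 hn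
        simp only [id]
        nlinarith
    have := (Complex.continuous_ofReal.tendsto _).comp hmain
    rwa [show (((if n = 0 then 1 else 0 : ℝ)) : ℂ) = if n = 0 then 1 else 0 by
      split_ifs <;> simp] at this
  · rw [Complex.norm_real, Real.norm_of_nonneg (sq_nonneg _)]
    refine (cgNat_zero_sq_le h0 h1 n (n + s)).trans ?_
    gcongr ?_ * _
    refine pow_le_pow_of_le_one g0.le g1.le ?_
    rcases n with _ | n
    · simp
    · nlinarith

theorem inner_cgVec_zero (s : ℤ) : inner ℂ (cgVec q 0 s) (cgVec q 0 s) = 1 := by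
  have h : ∀ s : ℤ, inner ℂ (cgVec q 0 s) (cgVec q 0 s) = inner ℂ (cgVec q 0 0) (cgVec q 0 0) := by
    intro s
    induction s using Int.induction_on with
    | zero => rfl
    | succ s ih => rw [inner_cgVec_zero_succ hq, ih]
    | pred s ih => rw [← inner_cgVec_zero_succ hq, sub_add_cancel, ih]
  have h2 := tendsto_inner_cgVec_zero hq
  simp_rw [h] at h2
  rw [h]
  exact tendsto_nhds_unique tendsto_const_nhds h2

theorem inner_cgVec (y y' : ℕ) (s s' : ℤ) :
    inner ℂ (cgVec q y s) (cgVec q y' s') = if y = y' ∧ s = s' then 1 else 0 := by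
  rcases eq_or_ne s s' with rfl | h
  · rw [inner_eq_of_ladder hq (star_piTwo hq).1 (fun x => piTwo_al_cgVec hq x s)
      (fun x => piTwo_de_cgVec hq x s) (fun x => piTwo_al_cgVec hq x s)
      (fun x => piTwo_de_cgVec hq x s), inner_cgVec_zero hq]
    simp
  · rw [inner_cgVec_of_ne hq _ _ h]
    simp [h]

theorem inner_cgVec_int (y y' s s' : ℤ) :
    inner ℂ (cgVec q y s) (cgVec q y' s') = if 0 ≤ y ∧ y = y' ∧ s = s' then 1 else 0 := by
  by_cases hy : y < 0
  · rw [cgVec_of_neg hq hy, inner_zero_left, if_neg (by lia)]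
  by_cases hy' : y' < 0
  · rw [cgVec_of_neg hq hy', inner_zero_right, if_neg (by lia)]
  lift y to ℕ using by lia
  lift y' to ℕ using by lia
  rw [inner_cgVec hq]
  simp

theorem hasSum_clebschGordan_mul (y y' : ℕ) (s : ℤ) :
    HasSum (fun n : ℕ => clebschGordan q y n (n + s) * clebschGordan q y' n (n + s))
      (if y = y' then 1 else 0) := by
  have h := hasSum_inner_cgVec hq y y' s
  rw [inner_cgVec hq] at h
  have h2 : (if y = y' ∧ s = s then (1 : ℂ) else 0) = ((if y = y' then 1 else 0 : ℝ) : ℂ) := by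
    split_ifs <;> simp_all
  rw [h2] at h
  exact_mod_cast h

end

/-! ## The dual orthogonality relations -/

section

variable {q : ℝ} (hq : q ∈ Set.Ioo (0 : ℝ) 1)

include hq

theorem cgNat_zero_mid_sq (x m : ℕ) : cgNat q x 0 m ^ 2 =
    qPochInf (q ^ 2) (q ^ 2) / qPoch (q ^ 2) (q ^ 2) m *
      (((q ^ 2) ^ (m + 1)) ^ x / qPoch (q ^ 2) (q ^ 2) x) := by
  obtain ⟨g0, g1⟩ := q_sq_mem hq
  have := qPochInf_self_pos g0 g1
  have := qPoch_self_pos g0 g1 m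
  have := qPoch_self_pos g0 g1 x
  rw [cgNat, qSum_zero_left, mul_one, mul_pow, Real.sq_sqrt (by rw [qPoch_zero]; positivity),
    mul_pow, ← pow_mul, mul_comm x 2, pow_mul, neg_one_sq, one_pow, qPoch_zero]
  simp only [zero_mul, mul_zero, pow_zero, div_one, zero_add, mul_one]
  field_simp
  ring

theorem summable_pow_div_qPoch {z : ℝ} (hz : z ∈ Set.Ioo (0 : ℝ) 1) :
    Summable fun x : ℕ => z ^ x / qPoch q q x := by
  refine Summable.of_nonneg_of_le (fun x => ?_) (fun x => ?_)
    ((summable_geometric_of_lt_one hz.1.le hz.2).mul_right (qPochInf q q)⁻¹)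
  · exact div_nonneg (pow_nonneg hz.1.le x) (qPoch_self_pos hq.1 hq.2 x).le
  · rw [← div_eq_mul_inv]
    have := qPochInf_self_pos hq.1 hq.2
    have := hz.1
    gcongr
    exact qPochInf_self_le hq.1 hq.2 x

/-- The case $z=q^{m+1}$ of the $q$-binomial series $\sum_x z^x/(q;q)_x=1/(z;q)_\infty$. The
recurrence makes the quotient by $(q;q)_m$ constant in $m$, and $m\to\infty$ gives the constant. -/
theorem tsum_pow_div_qPoch (m : ℕ) :
    ∑' x : ℕ, (q ^ (m + 1)) ^ x / qPoch q q x = qPoch q q m / qPochInf q q := by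
  have hz : ∀ m : ℕ, q ^ (m + 1) ∈ Set.Ioo (0 : ℝ) 1 := fun m =>
    ⟨pow_pos hq.1 _, pow_lt_one₀ hq.1.le hq.2 m.succ_ne_zero⟩
  have hs := fun m => summable_pow_div_qPoch hq (hz m)
  have hP := qPoch_self_pos hq.1 hq.2
  have hI := qPochInf_self_pos hq.1 hq.2
  set N : ℕ → ℝ := fun m => ∑' x : ℕ, (q ^ (m + 1)) ^ x / qPoch q q x with hN
  -- In the difference of consecutive sums the factor $1-q^x$ cancels against $(q;q)_x$, and
  -- reindexing returns the original sum.
  have hrec : ∀ m, N (m + 1) = (1 - q ^ (m + 1)) * N m := fun m => by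
    have h1 : N m - N (m + 1) = ∑' x : ℕ, ((q ^ (m + 1)) ^ x / qPoch q q x -
        (q ^ (m + 2)) ^ x / qPoch q q x) := ((hs m).tsum_sub (hs (m + 1))).symm
    have h2 : N m - N (m + 1) = q ^ (m + 1) * N m := by
      rw [h1, (((hs m).sub (hs (m + 1)))).tsum_eq_zero_add, hN]
      simp only [pow_zero, sub_self, zero_add]
      rw [← tsum_mul_left]
      congr 1 with x
      have a1 := (hP x).ne'
      have a2 := (one_sub_pow_succ_pos hq.1 hq.2 x).ne'
      rw [qPoch_self_succ, ← sub_div, div_eq_iff (mul_ne_zero a1 a2)]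
      field_simp
      ring
    linarith
  have hconst : ∀ m, N m / qPoch q q m = N 0 := fun m => by
    induction m with
    | zero => simp [qPoch_zero]
    | succ m ih =>
      have a1 := (hP m).ne'
      have a2 := (one_sub_pow_succ_pos hq.1 hq.2 m).ne'
      rw [hrec, qPoch_self_succ, ← ih]
      field_simp
  have hlim : Filter.Tendsto N Filter.atTop (nhds 1) := by
    have hg : ∑' n : ℕ, (if n = 0 then (1 : ℝ) else 0) = 1 := tsum_ite_eq 0 _
    rw [← hg]
    refine tendsto_tsum_of_dominated_convergence (hs 0) (fun x => ?_)
      (Filter.Eventually.of_forall fun m x => ?_)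
    · rcases eq_or_ne x 0 with rfl | hx
      · simp [qPoch_zero]
      · rw [if_neg hx]
        have h2 := (((tendsto_pow_atTop_nhds_zero_of_lt_one hq.1.le hq.2).comp
          (Filter.tendsto_add_atTop_nat 1)).pow x).div_const (qPoch q q x)
        simpa [hx] using h2
    · have := hP x
      have := hq.1
      rw [Real.norm_of_nonneg (by positivity), zero_add, pow_one]
      gcongr
      exact pow_le_of_le_one hq.1.le hq.2.le m.succ_ne_zero
  have h1 := hlim.div (tendsto_qPoch hq.1 hq.2 q) hI.ne'
  have h2 : N 0 = 1 / qPochInf q q :=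
    tendsto_nhds_unique (tendsto_const_nhds.congr fun m => (hconst m).symm) h1
  have h3 := hconst m
  rw [h2, div_eq_iff (hP m).ne'] at h3
  change N m = _
  rw [h3]
  ring

theorem hasSum_cgNat_zero_mid_sq (m : ℕ) : HasSum (fun x : ℕ => cgNat q x 0 m ^ 2) 1 := by
  have hQ := q_sq_mem hq
  simp_rw [cgNat_zero_mid_sq hq]
  have h := (summable_pow_div_qPoch hQ (z := (q ^ 2) ^ (m + 1))
    ⟨pow_pos hQ.1 _, pow_lt_one₀ hQ.1.le hQ.2 m.succ_ne_zero⟩).hasSum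
  rw [tsum_pow_div_qPoch hQ] at h
  have h2 := h.mul_left (qPochInf (q ^ 2) (q ^ 2) / qPoch (q ^ 2) (q ^ 2) m)
  rwa [div_mul_div_cancel₀ (qPoch_self_pos hQ.1 hQ.2 m).ne',
    div_self (qPochInf_self_pos hQ.1 hQ.2).ne'] at h2

/-- The vector `(C_{x,n,m})_x` of `ℓ²(ℕ)`. -/
def cgDual (q : ℝ) (n m : ℤ) : L2 ℕ := ofCoord fun x : ℕ => (clebschGordan q x n m : ℂ)

/-- Read in the variable $x$, the $\alpha$-relation expresses $C_{\cdot,n+1,m+1}$ through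
$C_{\cdot,n,m}$ and $\pi_0(\delta)C_{\cdot,n,m}$. Summability is therefore inherited from the case
where one index is $0$. -/
theorem exists_cgDual (n m : ℕ) :
    ∃ g : L2 ℕ, ∀ x : ℕ, g x = clebschGordan q x n m := by
  have base : ∀ m : ℕ, ∃ g : L2 ℕ, ∀ x : ℕ, g x = clebschGordan q x 0 m := fun m => by
    refine ⟨⟨fun x : ℕ => (clebschGordan q x 0 m : ℂ), memℓp_gen ?_⟩, fun _ => rfl⟩
    convert (hasSum_cgNat_zero_mid_sq hq m).summable using 2 with x
    rw [← clebschGordan_natCast hq.1 hq.2]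
    simp [sq_abs]
  induction n generalizing m with
  | zero => exact base m
  | succ n ih =>
    rcases m with _ | m
    · obtain ⟨g, hg⟩ := base (n + 1)
      exact ⟨g, fun x => by rw [hg, clebschGordan_comm hq.1 hq.2]; rfl⟩
    obtain ⟨g, hg⟩ := ih m
    refine ⟨(wt q (n + 1) * wt q (m + 1) : ℂ)⁻¹ •
      ((q : ℂ) ^ (n + m + 1) • g + pi0Gen hq .de g), fun x => ?_⟩
    have hw : (wt q (n + 1) * wt q (m + 1) : ℂ) ≠ 0 := by
      exact_mod_cast (mul_pos (wt_succ_pos hq.1 hq.2 n) (wt_succ_pos hq.1 hq.2 m)).ne'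
    have h := congrArg Complex.ofReal (clebschGordan_alpha hq x n m)
    push_cast at h ⊢
    rw [lp.coeFn_smul, Pi.smul_apply, lp.coeFn_add, Pi.add_apply, lp.coeFn_smul, Pi.smul_apply,
      pi0Gen_eq_act hq .de (F := fun x => clebschGordan q x n m) hg, hg, act, smul_eq_mul,
      inv_mul_eq_iff_eq_mul₀ hw, ← h, smul_eq_mul,
      show (n : ℤ) + m + 1 = (n + m + 1 : ℕ) by push_cast; rfl, zpow_natCast]
    ring

theorem cgDual_apply (n m : ℤ) (x : ℕ) : cgDual q n m x = clebschGordan q x n m := by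
  by_cases h : n < 0 ∨ m < 0
  · rw [cgDual, ofCoord_eq (g := 0)]
    · simp [clebschGordan_of_neg q (Or.inr h)]
    · simp [clebschGordan_of_neg q (Or.inr h)]
  · lift n to ℕ using by lia
    lift m to ℕ using by lia
    obtain ⟨g, hg⟩ := exists_cgDual hq n m
    rw [cgDual, ofCoord_eq hg, hg]

theorem pi0Gen_de_cgDual (n m : ℤ) : pi0Gen hq .de (cgDual q n m) =
    (wt q (n + 1) * wt q (m + 1) : ℂ) • cgDual q (n + 1) (m + 1) -
      (q : ℂ) ^ (n + m + 1) • cgDual q n m := by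
  ext x
  have h := congrArg Complex.ofReal (clebschGordan_alpha hq x n m)
  push_cast at h
  rw [pi0Gen_eq_act hq .de (F := fun x => clebschGordan q x n m) (cgDual_apply hq n m), act,
    lp.coeFn_sub, Pi.sub_apply, lp.coeFn_smul, Pi.smul_apply, lp.coeFn_smul, Pi.smul_apply,
    cgDual_apply hq, cgDual_apply hq, smul_eq_mul, smul_eq_mul, h]

theorem pi0Gen_al_cgDual (n m : ℤ) : pi0Gen hq .al (cgDual q n m) =
    (wt q n * wt q m : ℂ) • cgDual q (n - 1) (m - 1) - (q : ℂ) ^ (n + m + 1) • cgDual q n m := by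
  ext x
  have h := congrArg Complex.ofReal (clebschGordan_delta hq x n m)
  push_cast at h
  rw [pi0Gen_eq_act hq .al (F := fun x => clebschGordan q x n m) (cgDual_apply hq n m), act,
    lp.coeFn_sub, Pi.sub_apply, lp.coeFn_smul, Pi.smul_apply, lp.coeFn_smul, Pi.smul_apply,
    cgDual_apply hq, cgDual_apply hq, smul_eq_mul, smul_eq_mul, h]

theorem inner_cgDual_zero (m : ℕ) : inner ℂ (cgDual q 0 m) (cgDual q 0 m) = 1 := by
  have h : HasSum (fun x : ℕ => ((cgNat q x 0 m ^ 2 : ℝ) : ℂ)) ((1 : ℝ) : ℂ) := by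
    exact_mod_cast hasSum_cgNat_zero_mid_sq hq m
  rw [← Complex.ofReal_one]
  refine (lp.hasSum_inner (𝕜 := ℂ) (cgDual q 0 m) (cgDual q 0 m)).unique (h.congr_fun fun x => ?_)
  rw [cgDual_apply hq, ← clebschGordan_natCast hq.1 hq.2]
  simp [sq]
  rw [← Complex.ofReal_mul, ← Complex.ofReal_mul, abs_mul_abs_self]

/-- Along a fixed difference $s$, $\pi_0(\delta)$ sends $d_n$ to a combination of $d_{n+1}$ and
$d_n$, and its adjoint $\pi_0(\alpha)$ sends $d_n$ to one of $d_{n-1}$ and $d_n$ with the same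
diagonal coefficient $-t_n$. Comparing the two propagates orthonormality from $d_0$. -/
theorem inner_cgDual (s n n' : ℕ) : inner ℂ (cgDual q n (n + s)) (cgDual q n' (n' + s)) =
    if n = n' then 1 else 0 := by
  set d : ℤ → L2 ℕ := fun n => cgDual q n (n + s) with hd
  set W : ℤ → ℝ := fun n => wt q n * wt q (n + s) with hW
  set t : ℤ → ℝ := fun n => q ^ (n + (n + s) + 1) with ht
  have hD : ∀ n, pi0Gen hq .de (d n) = (W (n + 1) : ℂ) • d (n + 1) - (t n : ℂ) • d n := fun n => by
    rw [hd, pi0Gen_de_cgDual, hW, ht]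
    push_cast
    rw [add_right_comm n s 1]
  have hA : ∀ n, pi0Gen hq .al (d n) = (W n : ℂ) • d (n - 1) - (t n : ℂ) • d n := fun n => by
    rw [hd, pi0Gen_al_cgDual, hW, ht]
    push_cast
    rw [add_sub_right_comm n s 1]
  have hWne : ∀ n : ℕ, (W (n + 1) : ℂ) ≠ 0 := fun n => by
    have h2 := wt_succ_pos hq.1 hq.2 (n + s)
    rw [Nat.cast_add, add_right_comm] at h2
    exact_mod_cast (mul_pos (wt_succ_pos hq.1 hq.2 n) h2).ne'
  have hW0 : W 0 = 0 := by simp [hW, wt_zero]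
  have h1 : ∀ n m : ℤ, (W (n + 1) : ℂ) * inner ℂ (d (n + 1)) (d m) =
      (t n - t m) * inner ℂ (d n) (d m) + W m * inner ℂ (d n) (d (m - 1)) := fun n m => by
    have := ContinuousLinearMap.adjoint_inner_left (pi0Gen hq .al) (d m) (d n)
    rw [← ContinuousLinearMap.star_eq_adjoint, (star_pi0Gen hq).1, hD, hA, inner_sub_left,
      inner_sub_right, inner_smul_left, inner_smul_left, inner_smul_right, inner_smul_right,
      Complex.conj_ofReal, Complex.conj_ofReal] at this
    linear_combination this
  have h2 : ∀ n m : ℤ, (W (m + 1) : ℂ) * inner ℂ (d n) (d (m + 1)) =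
      (t m - t n) * inner ℂ (d n) (d m) + W n * inner ℂ (d (n - 1)) (d m) := fun n m => by
    have := ContinuousLinearMap.adjoint_inner_right (pi0Gen hq .al) (d n) (d m)
    rw [← ContinuousLinearMap.star_eq_adjoint, (star_pi0Gen hq).1, hD, hA, inner_sub_left,
      inner_sub_right, inner_smul_left, inner_smul_left, inner_smul_right, inner_smul_right,
      Complex.conj_ofReal, Complex.conj_ofReal] at this
    linear_combination this
  have h0 : ∀ m : ℕ, inner ℂ (d 0) (d m) = if 0 = m then (1 : ℂ) else 0 := fun m => by
    induction m with
    | zero => simpa [hd] using inner_cgDual_zero hq s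
    | succ m ih =>
      have := h2 0 m
      rw [ih, hW0, Complex.ofReal_zero, zero_mul, add_zero] at this
      rw [if_neg (by lia)]
      push_cast
      refine (mul_eq_zero.1 (this.trans ?_)).resolve_left (hWne m)
      rcases m with _ | m <;> simp
  change inner ℂ (d n) (d n') = _
  induction n generalizing n' with
  | zero => exact h0 n'
  | succ n ih =>
    have h3 := h1 n n'
    rw [ih] at h3
    apply mul_left_cancel₀ (hWne n)
    push_cast
    rw [h3]
    -- The diagonal contribution vanishes either way: equal indices give equal coefficients $t_n$,
    -- different ones are orthogonal by induction.
    have h4 : ((t n : ℂ) - t n') * (if n = n' then 1 else 0) = 0 := by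
      split_ifs with h
      · rw [h]; simp
      · simp
    rw [h4, zero_add]
    rcases n' with _ | n'
    · simp [hW0]
    · have := ih n'
      push_cast
      rw [add_sub_cancel_right, this]
      rcases eq_or_ne n n' with rfl | h <;> simp [*]

theorem hasSum_clebschGordan_sq (n m : ℕ) :
    HasSum (fun x : ℕ => clebschGordan q x n m ^ 2) 1 := by
  have key : ∀ n s : ℕ, HasSum (fun x : ℕ => clebschGordan q x n (n + s) ^ 2) 1 := fun n s => by
    have h := lp.hasSum_inner (𝕜 := ℂ) (cgDual q n (n + s)) (cgDual q n (n + s))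
    rw [inner_cgDual hq, if_pos rfl] at h
    have h2 : HasSum (fun x : ℕ => ((clebschGordan q x n (n + s) ^ 2 : ℝ) : ℂ)) ((1 : ℝ) : ℂ) := by
      rw [Complex.ofReal_one]
      refine h.congr_fun fun x => ?_
      rw [cgDual_apply hq]
      simp [sq]
      rw [← Complex.ofReal_mul, ← Complex.ofReal_mul, abs_mul_abs_self]
    exact_mod_cast h2
  rcases le_total n m with h | h
  · obtain ⟨s, rfl⟩ := Nat.exists_eq_add_of_le h
    simpa using key n s
  · obtain ⟨s, rfl⟩ := Nat.exists_eq_add_of_le h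
    simp_rw [clebschGordan_comm hq.1 hq.2 _ ((m + s : ℕ) : ℤ)]
    simpa using key m s

end

/-! ## Hilbert bases of `ℓ²` -/

theorem hasSum_prod_of_nonneg {α β : Type*} {f : α × β → ℝ} {g : α → ℝ} {a : ℝ} (hf : 0 ≤ f)
    (h1 : ∀ i, HasSum (fun j => f (i, j)) (g i)) (h2 : HasSum g a) : HasSum f a := by
  have hs : Summable f := (summable_prod_of_nonneg hf).2
    ⟨fun i => (h1 i).summable, by simpa only [(h1 _).tsum_eq] using h2.summable⟩
  rw [← (hs.hasSum.prod_fiberwise h1).unique h2]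
  exact hs.hasSum

theorem exists_slice_eq {ι κ ω : Type*} (e : κ × ι ≃ ω) {F : κ → L2 ι}
    (h : Summable fun j => ‖F j‖ ^ 2) : ∃ G : L2 ω, ∀ j, slice e G j = F j := by
  have h1 : HasSum (fun p : κ × ι => ‖F p.1 p.2‖ ^ 2) (∑' j, ‖F j‖ ^ 2) :=
    hasSum_prod_of_nonneg (fun _ => sq_nonneg _) (fun j => hasSum_sq (F j)) h.hasSum
  refine ⟨⟨fun i => F (e.symm i).1 (e.symm i).2, memℓp_gen ?_⟩, fun j => ?_⟩
  · simpa [Function.comp_def] using (e.symm.summable_iff (f := fun p : κ × ι => ‖F p.1 p.2‖ ^ 2)).2 h1.summable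
  · ext i
    rw [slice_apply]
    change F (e.symm (e (j, i))).1 (e.symm (e (j, i))).2 = _
    rw [e.symm_apply_apply]

/-- Let $y$ be the projection of a standard basis vector $e_j$ to the closed span. Bessel's
inequality gives $1=\sum_i|\langle v_i,e_j\rangle|^2\le\|y\|^2\le\|e_j\|^2=1$, so $e_j=y$ lies in
the span's closure. -/
theorem isHilbertBasis_of_hasSum {ι ω : Type*} {v : ι → L2 ω} (hv : Orthonormal ℂ v)
    (h : ∀ j, HasSum (fun i => ‖v i j‖ ^ 2) 1) : IsHilbertBasis v := by
  classical
  refine ⟨hv, ?_⟩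
  set K := (Submodule.span ℂ (Set.range v)).topologicalClosure with hK
  have hcl : IsClosed (K : Set (L2 ω)) := Submodule.isClosed_topologicalClosure _
  have : CompleteSpace K := hcl.completeSpace_coe
  have hvK : ∀ i, v i ∈ K := fun i =>
    Submodule.le_topologicalClosure _ (Submodule.subset_span ⟨i, rfl⟩)
  have key : ∀ j, (lp.single 2 j 1 : L2 ω) ∈ K := fun j => by
    obtain ⟨y, hy, z, hz, hyz⟩ := K.exists_add_mem_mem_orthogonal (lp.single 2 j 1 : L2 ω)
    have h1 : ∀ i, ‖inner ℂ (v i) y‖ ^ 2 = ‖v i j‖ ^ 2 := fun i => by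
      have h2 : inner ℂ (v i) (lp.single 2 j 1 : L2 ω) = inner ℂ (v i) y := by
        rw [hyz, inner_add_right, (Submodule.mem_orthogonal _ _).1 hz _ (hvK i), add_zero]
      rw [← h2, lp.inner_single_right]
      simp
    have h2 : 1 ≤ ‖y‖ ^ 2 := by
      rw [← (h j).tsum_eq]
      simp_rw [← h1]
      exact hv.tsum_inner_products_le y
    have h3 : ‖(lp.single 2 j 1 : L2 ω)‖ ^ 2 = ‖y‖ ^ 2 + ‖z‖ ^ 2 := by
      rw [hyz, sq, sq, sq]
      exact norm_add_sq_eq_norm_sq_add_norm_sq_of_inner_eq_zero y z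
        ((Submodule.mem_orthogonal _ _).1 hz _ hy)
    have h4 : ‖(lp.single 2 j 1 : L2 ω)‖ = 1 := by
      rw [lp.norm_single (by norm_num)]; simp
    have h5 : z = 0 := by
      rw [h4] at h3
      have : ‖z‖ ^ 2 = 0 := le_antisymm (by linarith) (sq_nonneg _)
      simpa using this
    rw [hyz, h5, add_zero]
    exact hy
  refine eq_top_iff.2 fun f _ => ?_
  refine hcl.mem_of_tendsto (lp.hasSum_single (by norm_num) f) (Filter.Eventually.of_forall fun s => ?_)
  refine K.sum_mem fun i _ => ?_
  rw [single_eq_smul]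
  exact K.smul_mem _ (key i)

/-! ## The basis `e^{1(23)}` -/

/-- The coordinates of the vector `e^{1(23)}_{x,p,r}`. -/
def eFun (q : ℝ) (x p r n m k : ℤ) : ℂ :=
  clebschGordan q x n (n + p) * cgFun q (n + p) (x - r - n) m k

/-- The vector `e^{1(23)}_{x,p,r}` for an integer `x`; it vanishes if `x` is negative. -/
def eVec (q : ℝ) (x p r : ℤ) : L2 (ℕ × ℕ × ℕ) :=
  ofCoord fun i => eFun q x p r i.1 i.2.1 i.2.2

/-- The vector `e^{(12)3}_{x,p,r}` for an integer `x`; it vanishes if `x` is negative. -/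
def eVec' (q : ℝ) (x p r : ℤ) : L2 (ℕ × ℕ × ℕ) :=
  ofCoord fun i => eFun q x (-p) r i.2.2 i.2.1 i.1

theorem e1_23_eq (q : ℝ) (x : ℕ) (p r : ℤ) : e1_23 q x p r = eVec q x p r := by
  rw [e1_23, eVec]
  congr 1
  funext ⟨n, m, k⟩
  simp only [eFun, cgFun]
  split_ifs <;> first | lia | simp

/-- Symmetry of $C$ in its last two indices makes the second family the mirror image of the first,
with $p$ replaced by $-p$; all results for `eVec` can then be transported. -/
theorem e12_3_eq {q : ℝ} (hq : q ∈ Set.Ioo (0 : ℝ) 1) (x : ℕ) (p r : ℤ) :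
    e12_3 q x p r = eVec' q x p r := by
  rw [e12_3, eVec']
  congr 1
  funext ⟨n, m, k⟩
  simp only [eFun, cgFun, ← sub_eq_add_neg]
  rw [clebschGordan_comm hq.1 hq.2 x k, clebschGordan_comm hq.1 hq.2 _ m]
  split_ifs <;> first | lia | simp

/-- The exchange of the first and the third coordinate. -/
def swapEquiv : ℕ × ℕ × ℕ ≃ ℕ × ℕ × ℕ where
  toFun i := (i.2.2, i.2.1, i.1)
  invFun i := (i.2.2, i.2.1, i.1)
  left_inv _ := rfl
  right_inv _ := rfl

section

variable {q : ℝ} (hq : q ∈ Set.Ioo (0 : ℝ) 1)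

include hq

theorem norm_cgVec_sq_le (y s : ℤ) : ‖cgVec q y s‖ ^ 2 ≤ 1 := by
  rw [← inner_self_eq_norm_sq (𝕜 := ℂ), inner_cgVec_int hq]
  split_ifs <;> simp

/-- The slices at fixed first index are multiples of the orthonormal two-fold vectors, so
square-summability reduces to that of $n\mapsto C_{x,n,n+p}$. -/
theorem exists_eVec (x : ℕ) (p r : ℤ) : ∃ G : L2 (ℕ × ℕ × ℕ),
    ∀ n : ℕ, slice (Equiv.refl (ℕ × ℕ × ℕ)) G n =
      (clebschGordan q x n (n + p) : ℂ) • cgVec q (n + p) (x - r - n) := by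
  refine exists_slice_eq (Equiv.refl (ℕ × ℕ × ℕ)) (F := fun n : ℕ =>
    (clebschGordan q x n (n + p) : ℂ) • cgVec q (n + p) (x - r - n)) ?_
  refine Summable.of_nonneg_of_le (fun _ => sq_nonneg _) (fun n => ?_)
    (hasSum_clebschGordan_mul hq x x p).summable
  rw [norm_smul, mul_pow, Complex.norm_real, Real.norm_eq_abs, sq_abs, ← sq]
  exact mul_le_of_le_one_right (sq_nonneg _) (norm_cgVec_sq_le hq _ _)

theorem eVec_apply (x p r : ℤ) (i : ℕ × ℕ × ℕ) :
    eVec q x p r i = eFun q x p r i.1 i.2.1 i.2.2 := by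
  by_cases hx : x < 0
  · rw [eVec, ofCoord_eq (g := 0)] <;> simp [eFun, clebschGordan_of_neg q (Or.inl hx)]
  · lift x to ℕ using by lia
    obtain ⟨G, hG⟩ := exists_eVec hq x p r
    have h : ∀ i : ℕ × ℕ × ℕ, G i = eFun q x p r i.1 i.2.1 i.2.2 := fun ⟨n, j⟩ => by
      have := slice_apply (Equiv.refl (ℕ × ℕ × ℕ)) G n j
      rw [hG, lp.coeFn_smul, Pi.smul_apply, cgVec_apply hq] at this
      exact this.symm
    rw [eVec, ofCoord_eq h, h]

theorem slice_eVec (x p r : ℤ) (n : ℕ) : slice (Equiv.refl (ℕ × ℕ × ℕ)) (eVec q x p r) n =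
    (clebschGordan q x n (n + p) : ℂ) • cgVec q (n + p) (x - r - n) := by
  ext j
  rw [slice_apply, lp.coeFn_smul, Pi.smul_apply, cgVec_apply hq]
  exact eVec_apply hq x p r (n, j)

theorem eVec'_apply (x p r : ℤ) (i : ℕ × ℕ × ℕ) :
    eVec' q x p r i = eFun q x (-p) r i.2.2 i.2.1 i.1 := by
  have h : Memℓp (fun i => eVec q x (-p) r (swapEquiv i)) 2 := by
    refine memℓp_gen ?_
    simpa [Function.comp_def] using (swapEquiv.summable_iff (f := fun i => ‖eVec q x (-p) r i‖ ^ 2)).2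
      (hasSum_sq _).summable
  have h2 : ∀ i, (⟨_, h⟩ : L2 (ℕ × ℕ × ℕ)) i = eFun q x (-p) r i.2.2 i.2.1 i.1 := fun i =>
    eVec_apply hq x (-p) r (swapEquiv i)
  rw [eVec', ofCoord_eq h2, h2]

theorem eVec'_apply_eq (x p r : ℤ) (i : ℕ × ℕ × ℕ) :
    eVec' q x p r i = eVec q x (-p) r (swapEquiv i) := by
  rw [eVec'_apply hq, eVec_apply hq]; rfl

theorem inner_eVec (x x' : ℕ) (p r p' r' : ℤ) : inner ℂ (eVec q x p r) (eVec q x' p' r') =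
    if x = x' ∧ p = p' ∧ r = r' then 1 else 0 := by
  have h := inner_eq_tsum_slice (Equiv.refl (ℕ × ℕ × ℕ)) (eVec q x p r) (eVec q x' p' r')
  simp_rw [slice_eVec hq, inner_smul_left, inner_smul_right, inner_cgVec_int hq,
    Complex.conj_ofReal] at h
  refine h.unique ?_
  by_cases hp : p = p' ∧ (x : ℤ) - r = x' - r'
  · obtain ⟨rfl, hr⟩ := hp
    have h2 : HasSum (fun n : ℕ => ((clebschGordan q x n (n + p) *
        clebschGordan q x' n (n + p) : ℝ) : ℂ)) ((if x = x' then 1 else 0 : ℝ) : ℂ) := by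
      exact_mod_cast hasSum_clebschGordan_mul hq x x' p
    have h3 : ((if x = x' then 1 else 0 : ℝ) : ℂ) =
        if x = x' ∧ p = p ∧ r = r' then 1 else 0 := by
      by_cases hx : x = x'
      · rw [if_pos hx, if_pos (by lia), Complex.ofReal_one]
      · rw [if_neg hx, if_neg (by lia), Complex.ofReal_zero]
    rw [← h3]
    refine h2.congr_fun fun n => ?_
    by_cases hn : 0 ≤ (n : ℤ) + p
    · rw [if_pos (by lia)]; push_cast; ring
    · rw [clebschGordan_of_neg q (m := n + p) (by lia)]; simp
  · rw [if_neg (by lia)]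
    refine hasSum_zero.congr_fun fun n => ?_
    rw [if_neg (by lia)]
    simp

theorem inner_eVec' (x x' : ℕ) (p r p' r' : ℤ) : inner ℂ (eVec' q x p r) (eVec' q x' p' r') =
    if x = x' ∧ p = p' ∧ r = r' then 1 else 0 := by
  have h := lp.hasSum_inner (𝕜 := ℂ) (eVec' q x p r) (eVec' q x' p' r')
  simp_rw [eVec'_apply_eq hq] at h
  have h2 := (swapEquiv.hasSum_iff (f := fun i =>
    inner ℂ (eVec q x (-p) r i) (eVec q x' (-p') r' i))).1 h
  rw [h2.unique (lp.hasSum_inner (𝕜 := ℂ) _ _), inner_eVec hq]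
  simp

/-- The coordinate $(n,m,k)$ determines $r$ from $x$. Summing over $x$ first and over $p$ second
then uses $\sum_xC_{x,n,l}^2=1$ twice, with $l=n+p$ as the new summation index. -/
theorem hasSum_eVec_sq (i : ℕ × ℕ × ℕ) :
    HasSum (fun j : ℕ × ℤ × ℤ => ‖eVec q j.1 j.2.1 j.2.2 i‖ ^ 2) 1 := by
  obtain ⟨n, m, k⟩ := i
  let e : ℤ × ℕ × ℤ ≃ ℕ × ℤ × ℤ :=
    { toFun := fun j => (j.2.1, j.1, j.2.2)
      invFun := fun j => (j.2.1, j.1, j.2.2)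
      left_inv := fun _ => rfl
      right_inv := fun _ => rfl }
  rw [← e.hasSum_iff]
  have h1 : ∀ (x : ℕ) (p : ℤ), HasSum (fun r : ℤ => ‖eVec q x p r (n, m, k)‖ ^ 2)
      (clebschGordan q x n (n + p) ^ 2 * clebschGordan q (n + p) m k ^ 2) := fun x p => by
    convert hasSum_single ((x : ℤ) - n - k + m) fun r hr => ?_ using 1
    · rw [eVec_apply hq, eFun, cgFun, if_pos (by lia), ← Complex.ofReal_mul, Complex.norm_real,
        Real.norm_eq_abs, sq_abs, mul_pow]
    · rw [eVec_apply hq, eFun, cgFun, if_neg (by lia)]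
      simp
  refine hasSum_prod_of_nonneg (fun _ => sq_nonneg _)
    (g := fun p : ℤ => clebschGordan q (n + p) m k ^ 2) (fun p => ?_) ?_
  · refine hasSum_prod_of_nonneg (fun _ => sq_nonneg _) (fun x => h1 x p) ?_
    by_cases hp : 0 ≤ n + p
    · obtain ⟨l, hl⟩ := Int.eq_ofNat_of_zero_le hp
      rw [hl]
      simpa using (hasSum_clebschGordan_sq hq n l).mul_right (clebschGordan q l m k ^ 2)
    · rw [clebschGordan_of_neg q (x := n + p) (by lia)]
      simp
  -- Only $p$ with $n+p\ge0$ contribute, so the sum over $p\in\mathbb Z$ becomes one over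
  -- $n+p\in\mathbb N$.
  · have hinj : Function.Injective fun y : ℕ => (y : ℤ) - n := fun a b h => by
      simpa using h
    rw [← hinj.hasSum_iff]
    · simpa [Function.comp_def] using hasSum_clebschGordan_sq hq m k
    · intro p hp
      rw [clebschGordan_of_neg q (Or.inl _)]
      · simp
      · by_contra h
        refine hp ⟨(n + p).toNat, ?_⟩
        simp only
        lia

theorem isHilbertBasis_eVec :
    IsHilbertBasis fun i : ℕ × ℤ × ℤ => eVec q i.1 i.2.1 i.2.2 := by
  refine isHilbertBasis_of_hasSum ?_ (hasSum_eVec_sq hq)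
  rw [orthonormal_iff_ite]
  rintro ⟨x, p, r⟩ ⟨x', p', r'⟩
  rw [inner_eVec hq]
  simp

theorem isHilbertBasis_eVec' :
    IsHilbertBasis fun i : ℕ × ℤ × ℤ => eVec' q i.1 i.2.1 i.2.2 := by
  refine isHilbertBasis_of_hasSum ?_ fun i => ?_
  · rw [orthonormal_iff_ite]
    rintro ⟨x, p, r⟩ ⟨x', p', r'⟩
    rw [inner_eVec' hq]
    simp
  · let e : ℕ × ℤ × ℤ ≃ ℕ × ℤ × ℤ :=
      (Equiv.refl ℕ).prodCongr ((Equiv.neg ℤ).prodCongr (Equiv.refl ℤ))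
    simp_rw [eVec'_apply_eq hq]
    exact (e.hasSum_iff (f := fun j : ℕ × ℤ × ℤ => ‖eVec q j.1 j.2.1 j.2.2 (swapEquiv i)‖ ^ 2)).2
      (hasSum_eVec_sq hq (swapEquiv i))

end

/-! ## The action of the generators on the three-fold bases -/

theorem actTwo_mul (q : ℝ) (g : Gen) (c : ℂ) (F : ℤ → ℤ → ℂ) (n m : ℤ) :
    actTwo q g (fun n m => c * F n m) n m = c * actTwo q g F n m := by
  cases g <;> simp only [actTwo, act] <;> ring

theorem actTwo_eFun (q : ℝ) (x p r : ℤ) (g : Gen) (n m k : ℤ) : actTwo q g (eFun q x p r n) m k =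
    clebschGordan q x n (n + p) * actTwo q g (cgFun q (n + p) (x - r - n)) m k :=
  actTwo_mul _ _ _ _ _ _

theorem tendsto_intCast_shift (j : ℤ) :
    Filter.Tendsto (fun i : ℕ => (i + j).toNat) Filter.atTop Filter.atTop := by
  refine Filter.tendsto_atTop.2 fun b => ?_
  filter_upwards [Filter.eventually_ge_atTop (b + j.natAbs)] with i hi
  lia

section

variable {q : ℝ} (hq : q ∈ Set.Ioo (0 : ℝ) 1) (x p r n m k : ℤ)

include hq

/-- After the action on the last two factors, both terms of $\Delta(\alpha)$ carry the same two-fold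
vector, and what remains is the $\alpha$-relation for $C_{x,n,n+p}$. The other three generators
follow this pattern. -/
theorem actThree_al_eFun :
    actThree q .al (eFun q x p r) n m k = wt q x * eFun q (x - 1) p r n m k := by
  have h := congrArg Complex.ofReal (clebschGordan_alpha hq x n (n + p))
  push_cast at h
  simp only [actThree, act, actTwo_eFun, actTwo_al_cgFun hq, actTwo_ga_cgFun hq, eFun]
  rw [show n + 1 + p - 1 = n + p by ring, show x - r - (n + 1) = x - 1 - r - n by ring,
    show x - r - n - 1 = x - 1 - r - n by ring, show n + 1 + p = n + p + 1 by ring,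
    ← mul_assoc (wt q x : ℂ), ← h, show n + (n + p) + 1 = (n + 1) + (n + p) by ring,
    zpow_add₀ (ofReal_ne_zero_of_mem hq) (n + 1)]
  ring

theorem actThree_de_eFun :
    actThree q .de (eFun q x p r) n m k = wt q (x + 1) * eFun q (x + 1) p r n m k := by
  have h := congrArg Complex.ofReal (clebschGordan_delta hq x n (n + p))
  push_cast at h
  simp only [actThree, act, actTwo_eFun, actTwo_de_cgFun hq, actTwo_be_cgFun hq, eFun]
  rw [show n - 1 + p + 1 = n + p by ring, show x - r - (n - 1) = x + 1 - r - n by ring,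
    show x - r - n + 1 = x + 1 - r - n by ring, show n - 1 + p = n + p - 1 by ring,
    ← mul_assoc (wt q (x + 1) : ℂ), ← h, show n + (n + p) + 1 = n + (n + p + 1) by ring,
    zpow_add₀ (ofReal_ne_zero_of_mem hq) n]
  ring

theorem actThree_ga_eFun :
    actThree q .ga (eFun q x p r) n m k = (q : ℂ) ^ x * eFun q x (p - 1) r n m k := by
  have h := congrArg Complex.ofReal (clebschGordan_gamma hq x n (n + (p - 1)))
  push_cast at h
  simp only [actThree, act, actTwo_eFun, actTwo_al_cgFun hq, actTwo_ga_cgFun hq, eFun]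
  rw [← mul_assoc ((q : ℂ) ^ x), ← h, show n + (p - 1) + 1 = n + p by ring,
    show n + p - 1 = n + (p - 1) by ring, show n - 1 + p = n + (p - 1) by ring,
    show x - r - (n - 1) - 1 = x - r - n by ring]
  ring

theorem actThree_be_eFun :
    actThree q .be (eFun q x p r) n m k = -(q : ℂ) ^ (x + 1) * eFun q x (p + 1) r n m k := by
  have h := congrArg Complex.ofReal (clebschGordan_beta hq x n (n + (p + 1)))
  have h0 := ofReal_ne_zero_of_mem hq
  push_cast at h
  simp only [actThree, act, actTwo_eFun, actTwo_be_cgFun hq, actTwo_de_cgFun hq, eFun]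
  rw [zpow_add_one₀ h0 x, ← mul_comm (q : ℂ), ← neg_mul, mul_assoc, ← mul_assoc ((q : ℂ) ^ x), ← h,
    show n + (p + 1) - 1 = n + p by ring, show n + 1 + p = n + (p + 1) by ring,
    show n + p + 1 = n + (p + 1) by ring, show x - r - (n + 1) + 1 = x - r - n by ring,
    zpow_add_one₀ h0 (n + (p + 1)), zpow_add_one₀ h0 n]
  ring

/-- The substitution $\beta\mapsto-q\gamma$, $\gamma\mapsto-q^{-1}\beta$, fixing $\alpha$ and
$\delta$, reverses the comultiplication and leaves $\pi_0$ unchanged. Reversing the tensor factors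
therefore fixes $\alpha,\delta$ and exchanges $\gamma$ with $\gamma^*$. -/
theorem actThree_swap (F : ℤ → ℤ → ℤ → ℂ) :
    actThree q .al (fun n m k => F k m n) n m k = actThree q .al F k m n ∧
    actThree q .de (fun n m k => F k m n) n m k = actThree q .de F k m n ∧
    (q : ℂ) * actThree q .ga (fun n m k => F k m n) n m k = -actThree q .be F k m n ∧
    actThree q .be (fun n m k => F k m n) n m k = -(q : ℂ) * actThree q .ga F k m n := by
  have h0 := ofReal_ne_zero_of_mem hq
  refine ⟨?_, ?_, ?_, ?_⟩ <;> simp only [actThree, actTwo, act, zpow_add_one₀ h0] <;> ring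

theorem pi1_23_al_eVec :
    pi1_23 hq (Alg.of q .al) (eVec q x p r) = (wt q x : ℂ) • eVec q (x - 1) p r := by
  ext ⟨n, m, k⟩
  rw [pi1_23_apply hq .al (fun n m k => eVec_apply hq x p r (n, m, k)), actThree_al_eFun hq,
    lp.coeFn_smul, Pi.smul_apply, eVec_apply hq, smul_eq_mul]

theorem pi1_23_de_eVec :
    pi1_23 hq (Alg.of q .de) (eVec q x p r) = (wt q (x + 1) : ℂ) • eVec q (x + 1) p r := by
  ext ⟨n, m, k⟩
  rw [pi1_23_apply hq .de (fun n m k => eVec_apply hq x p r (n, m, k)), actThree_de_eFun hq,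
    lp.coeFn_smul, Pi.smul_apply, eVec_apply hq, smul_eq_mul]

theorem pi1_23_ga_eVec :
    pi1_23 hq (Alg.of q .ga) (eVec q x p r) = (q : ℂ) ^ x • eVec q x (p - 1) r := by
  ext ⟨n, m, k⟩
  rw [pi1_23_apply hq .ga (fun n m k => eVec_apply hq x p r (n, m, k)), actThree_ga_eFun hq,
    lp.coeFn_smul, Pi.smul_apply, eVec_apply hq, smul_eq_mul]

theorem pi1_23_gaStar_eVec :
    pi1_23 hq (gaStar q) (eVec q x p r) = (q : ℂ) ^ x • eVec q x (p + 1) r := by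
  have h0 := ofReal_ne_zero_of_mem hq
  rw [gaStar, map_neg, map_smul]
  ext ⟨n, m, k⟩
  rw [neg_apply, smul_apply, lp.coeFn_neg, Pi.neg_apply, lp.coeFn_smul, Pi.smul_apply,
    pi1_23_apply hq .be (fun n m k => eVec_apply hq x p r (n, m, k)), actThree_be_eFun hq,
    lp.coeFn_smul, Pi.smul_apply, eVec_apply hq, smul_eq_mul, smul_eq_mul, zpow_add_one₀ h0]
  field_simp

theorem pi1_23_al_eVec' :
    pi1_23 hq (Alg.of q .al) (eVec' q x p r) = (wt q x : ℂ) • eVec' q (x - 1) p r := by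
  ext ⟨n, m, k⟩
  rw [pi1_23_apply hq .al (F := fun n m k => eFun q x (-p) r k m n)
    (fun n m k => eVec'_apply hq x p r (n, m, k)), (actThree_swap hq _ _ _ _).1,
    actThree_al_eFun hq, lp.coeFn_smul, Pi.smul_apply, eVec'_apply hq, smul_eq_mul]

theorem pi1_23_de_eVec' :
    pi1_23 hq (Alg.of q .de) (eVec' q x p r) = (wt q (x + 1) : ℂ) • eVec' q (x + 1) p r := by
  ext ⟨n, m, k⟩
  rw [pi1_23_apply hq .de (F := fun n m k => eFun q x (-p) r k m n)
    (fun n m k => eVec'_apply hq x p r (n, m, k)), (actThree_swap hq _ _ _ _).2.1,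
    actThree_de_eFun hq, lp.coeFn_smul, Pi.smul_apply, eVec'_apply hq, smul_eq_mul]

theorem pi1_23_ga_eVec' :
    pi1_23 hq (Alg.of q .ga) (eVec' q x p r) = (q : ℂ) ^ x • eVec' q x (p - 1) r := by
  have h0 := ofReal_ne_zero_of_mem hq
  ext ⟨n, m, k⟩
  apply mul_left_cancel₀ h0
  rw [pi1_23_apply hq .ga (F := fun n m k => eFun q x (-p) r k m n)
    (fun n m k => eVec'_apply hq x p r (n, m, k)), (actThree_swap hq _ _ _ _).2.2.1,
    actThree_be_eFun hq, lp.coeFn_smul, Pi.smul_apply, eVec'_apply hq, smul_eq_mul,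
    zpow_add_one₀ h0, neg_sub, sub_eq_neg_add]
  ring

theorem pi1_23_gaStar_eVec' :
    pi1_23 hq (gaStar q) (eVec' q x p r) = (q : ℂ) ^ x • eVec' q x (p + 1) r := by
  have h0 := ofReal_ne_zero_of_mem hq
  rw [gaStar, map_neg, map_smul]
  ext ⟨n, m, k⟩
  rw [neg_apply, smul_apply, lp.coeFn_neg, Pi.neg_apply, lp.coeFn_smul, Pi.smul_apply,
    pi1_23_apply hq .be (F := fun n m k => eFun q x (-p) r k m n)
    (fun n m k => eVec'_apply hq x p r (n, m, k)), (actThree_swap hq _ _ _ _).2.2.2,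
    actThree_ga_eFun hq, lp.coeFn_smul, Pi.smul_apply, eVec'_apply hq, smul_eq_mul, smul_eq_mul,
    neg_add']
  field_simp

theorem pi1_23_gamma_gammaStar_eVec (x : ℕ) :
    pi1_23 hq (Alg.of q .ga * gaStar q) (eVec q x p r) = (q : ℂ) ^ (2 * x) • eVec q x p r := by
  rw [map_mul, mul_apply_eq_comp, pi1_23_gaStar_eVec, map_smul, pi1_23_ga_eVec,
    add_sub_cancel_right, smul_smul, zpow_natCast, two_mul, pow_add]

theorem pi1_23_gamma_gammaStar_eVec' (x : ℕ) :
    pi1_23 hq (Alg.of q .ga * gaStar q) (eVec' q x p r) = (q : ℂ) ^ (2 * x) • eVec' q x p r := by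
  rw [map_mul, mul_apply_eq_comp, pi1_23_gaStar_eVec', map_smul, pi1_23_ga_eVec',
    add_sub_cancel_right, smul_smul, zpow_natCast, two_mul, pow_add]

/-! ## Invariance properties of the `6j`-symbols -/

/-- Both families obey the same ladder formulas for the same representation; this is why the
$6j$-symbols do not depend on $x$. -/
theorem inner_eVec_eVec' (x y : ℕ) (p₁ r₁ p₂ r₂ : ℤ) :
    inner ℂ (eVec q x p₁ r₁) (eVec' q y p₂ r₂) =
      if x = y then inner ℂ (eVec q 0 p₁ r₁) (eVec' q 0 p₂ r₂) else 0 :=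
  inner_eq_of_ladder hq (star_pi1_23 hq).1 (fun x => pi1_23_al_eVec hq x p₁ r₁)
    (fun x => pi1_23_de_eVec hq x p₁ r₁) (fun x => pi1_23_al_eVec' hq x p₂ r₂)
    (fun x => pi1_23_de_eVec' hq x p₂ r₂) x y

/-- For $x=0$ the operators $\gamma$ and $\gamma^*$ are pure shifts of $p$ on both families, and
they are adjoint to each other. -/
theorem inner_eVec_eVec'_succ (p₁ r₁ p₂ r₂ : ℤ) :
    inner ℂ (eVec q 0 (p₁ + 1) r₁) (eVec' q 0 (p₂ + 1) r₂) =
      inner ℂ (eVec q 0 p₁ r₁) (eVec' q 0 p₂ r₂) := by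
  have h := ContinuousLinearMap.adjoint_inner_right (pi1_23 hq (Alg.of q .ga))
    (eVec q 0 (p₁ + 1) r₁) (eVec' q 0 p₂ r₂)
  rw [← ContinuousLinearMap.star_eq_adjoint, (star_pi1_23 hq).2.2, pi1_23_gaStar_eVec',
    pi1_23_ga_eVec, zpow_zero, one_smul, one_smul, add_sub_cancel_right] at h
  exact h

theorem inner_eVec_eVec'_add (p₁ r₁ p₂ r₂ : ℤ) (j : ℤ) :
    inner ℂ (eVec q 0 (p₁ + j) r₁) (eVec' q 0 (p₂ + j) r₂) =
      inner ℂ (eVec q 0 p₁ r₁) (eVec' q 0 p₂ r₂) := by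
  induction j using Int.induction_on with
  | zero => simp
  | succ j ih => rw [← add_assoc, ← add_assoc, inner_eVec_eVec'_succ hq, ih]
  | pred j ih =>
    rw [← inner_eVec_eVec'_succ hq, add_assoc, sub_add_cancel, add_assoc p₂, sub_add_cancel, ih]

theorem inner_eVec_eVec'_of_ne {r₁ r₂ : ℤ} (h : r₁ ≠ r₂) (p₁ p₂ : ℤ) :
    inner ℂ (eVec q 0 p₁ r₁) (eVec' q 0 p₂ r₂) = 0 := by
  rw [lp.inner_eq_tsum (𝕜 := ℂ)]
  convert tsum_zero with i
  rw [eVec_apply hq, eVec'_apply hq, eFun, eFun, cgFun, cgFun]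
  split_ifs <;> first | lia | simp

/-! ## The `6j`-symbols as limits of Clebsch-Gordan coefficients -/

theorem tendsto_clebschGordan_zero_zero :
    Filter.Tendsto (fun j : ℕ => clebschGordan q 0 0 j) Filter.atTop (nhds 1) := by
  have hQ := q_sq_mem hq
  have hI := qPochInf_self_pos hQ.1 hQ.2
  have h1 : ∀ j : ℕ, clebschGordan q 0 0 j =
      √(qPochInf (q ^ 2) (q ^ 2) / qPoch (q ^ 2) (q ^ 2) j) := fun j => by
    have := clebschGordan_natCast hq.1 hq.2 0 0 j
    rw [Nat.cast_zero, cgNat_zero hq.1 hq.2] at this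
    rw [this]
    simp [qPoch_zero]
  simp_rw [h1]
  have h2 := (tendsto_const_nhds (x := qPochInf (q ^ 2) (q ^ 2))).div
    (tendsto_qPoch hQ.1 hQ.2 (q ^ 2)) hI.ne'
  rw [div_self hI.ne'] at h2
  simpa [Function.comp_def] using (Real.continuous_sqrt.tendsto 1).comp h2

theorem tendsto_clebschGordan_zero_zero_add (j : ℤ) :
    Filter.Tendsto (fun i : ℕ => clebschGordan q 0 0 (i + j)) Filter.atTop (nhds 1) := by
  refine ((tendsto_clebschGordan_zero_zero hq).comp (tendsto_intCast_shift j)).congr' ?_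
  filter_upwards [Filter.eventually_ge_atTop j.natAbs] with i hi
  rw [Function.comp_apply, Int.toNat_of_nonneg (by lia)]

/-- Shifting both $p$-indices by $j$ leaves the $6j$-symbol fixed, while $e^{(12)3}_{0,j,r}$
concentrates on one standard basis vector. The symbol is thus the limit of a single coordinate of
$e^{1(23)}_{0,j+p,r}$, namely $C_{0,0,j+p}\,C_{j+p,j+r,j}$, whose first factor tends to $1$. -/
theorem tendsto_clebschGordan_sixJ (p r : ℤ) :
    Filter.Tendsto (fun j : ℕ => (clebschGordan q (j + p) (j + r) j : ℂ)) Filter.atTop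
      (nhds (inner ℂ (eVec q 0 p r) (eVec' q 0 0 r))) := by
  classical
  let i : ℕ → ℕ × ℕ × ℕ := fun j => (0, (j + r).toNat, j)
  let E : ℕ → L2 (ℕ × ℕ × ℕ) := fun j => lp.single 2 (i j) 1
  have hj : ∀ᶠ j : ℕ in Filter.atTop, 0 ≤ (j : ℤ) + r := by
    filter_upwards [Filter.eventually_ge_atTop r.natAbs] with j hj
    lia
  have hnorm : ∀ v : L2 (ℕ × ℕ × ℕ), inner ℂ v v = 1 → ‖v‖ = 1 := fun v hv => by
    have h := inner_self_eq_norm_sq (𝕜 := ℂ) v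
    rw [hv] at h
    exact (pow_eq_one_iff_of_nonneg (norm_nonneg v) two_ne_zero).1 (h.symm.trans (by simp))
  have hu : ∀ j : ℕ, ‖eVec q 0 (j + p) r‖ = 1 := fun j => hnorm _ (by
    simpa using inner_eVec hq 0 0 (j + p) r (j + p) r)
  have hv : ∀ j : ℕ, ‖eVec' q 0 j r‖ = 1 := fun j => hnorm _ (by
    simpa using inner_eVec' hq 0 0 j r j r)
  have hE : ∀ j, ‖E j‖ = 1 := fun j => by
    rw [lp.norm_single (by norm_num)]; simp
  -- For unit vectors $\|E-v\|^2=2-2\,\mathrm{Re}\langle E,v\rangle$, and the inner product is a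
  -- coordinate of $v$ that tends to $1$.
  have hvi : ∀ᶠ j : ℕ in Filter.atTop, ‖E j - eVec' q 0 j r‖ ^ 2 =
      2 - 2 * (clebschGordan q 0 0 j * clebschGordan q 0 0 (j + r)) := by
    filter_upwards [hj] with j hj
    have h1 : inner ℂ (E j) (eVec' q 0 j r) =
        ((clebschGordan q 0 0 j * clebschGordan q 0 0 (j + r) : ℝ) : ℂ) := by
      rw [lp.inner_single_left, eVec'_apply hq, eFun, cgFun, Int.toNat_of_nonneg hj,
        if_pos (by ring), clebschGordan_comm hq.1 hq.2 0 j,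
        clebschGordan_comm hq.1 hq.2 _ (j + r), add_neg_cancel]
      simp
    rw [norm_sub_sq (𝕜 := ℂ), hE, hv, h1]
    simp
    ring
  have hc : Filter.Tendsto (fun j : ℕ => ‖E j - eVec' q 0 j r‖) Filter.atTop (nhds 0) := by
    have h1 : Filter.Tendsto (fun j : ℕ => ‖E j - eVec' q 0 j r‖ ^ 2) Filter.atTop (nhds 0) := by
      have h2 := (((tendsto_clebschGordan_zero_zero hq).mul
        (tendsto_clebschGordan_zero_zero_add hq r)).const_mul 2).const_sub 2
      norm_num at h2
      exact h2.congr' (hvi.mono fun j hj => hj.symm)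
    simpa [Function.comp_def, Real.sqrt_sq] using (Real.continuous_sqrt.tendsto 0).comp h1
  have hd : Filter.Tendsto (fun j : ℕ => inner ℂ (eVec q 0 (j + p) r) (E j)) Filter.atTop
      (nhds (inner ℂ (eVec q 0 p r) (eVec' q 0 0 r))) := by
    rw [tendsto_iff_norm_sub_tendsto_zero]
    -- The constant $6j$-symbol is the inner product with $e^{(12)3}_{0,j,r}$; replacing that vector
    -- by `E j` costs at most their distance, by Cauchy–Schwarz.
    refine squeeze_zero (fun _ => norm_nonneg _) (fun j => ?_) hc
    have h1 := inner_eVec_eVec'_add hq p r 0 r j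
    rw [zero_add, add_comm] at h1
    rw [← h1, ← inner_sub_right]
    refine (norm_inner_le_norm _ _).trans ?_
    rw [hu, one_mul]
  have hui : ∀ᶠ j : ℕ in Filter.atTop, inner ℂ (eVec q 0 (j + p) r) (E j) =
      (clebschGordan q 0 0 (j + p) : ℂ) * clebschGordan q (j + p) (j + r) j := by
    filter_upwards [hj] with j hj
    rw [lp.inner_single_right, eVec_apply hq, eFun, cgFun, Int.toNat_of_nonneg hj,
      if_pos (by ring)]
    simp [i]
  have hz := tendsto_clebschGordan_zero_zero_add hq p
  have h1 := hd.div ((Complex.continuous_ofReal.tendsto 1).comp hz) (by simp)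
  rw [Complex.ofReal_one, div_one] at h1
  refine h1.congr' ?_
  filter_upwards [hui, hz.eventually_ne one_ne_zero] with j hj hne
  have hne' : (clebschGordan q 0 0 (j + p) : ℂ) ≠ 0 := by exact_mod_cast hne
  rw [Pi.div_apply, hj, Function.comp_apply, mul_div_cancel_left₀ _ hne']

end

/-! ## Wall polynomials converge to `q`-Bessel functions -/

theorem summable_pow_choose_two_mul_pow {q : ℝ} (h0 : 0 < q) (h1 : q < 1) (z : ℝ) :
    Summable fun k : ℕ => q ^ k.choose 2 * z ^ k := by
  rcases eq_or_ne z 0 with rfl | hz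
  · exact summable_of_ne_finset_zero (s := {0}) fun k hk => by
      rw [zero_pow (by simpa using hk), mul_zero]
  refine summable_of_ratio_test_tendsto_lt_one zero_lt_one
    (Filter.Eventually.of_forall fun k => mul_ne_zero (by positivity) (pow_ne_zero _ hz)) ?_
  have h2 := ((tendsto_pow_atTop_nhds_zero_of_lt_one h0.le h1).mul_const z).norm
  rw [zero_mul, norm_zero] at h2
  refine h2.congr fun k => ?_
  rw [← norm_div, Nat.choose_succ_succ' k 1, Nat.choose_one_right, pow_add]
  congr 1
  rw [pow_succ z]
  field_simp

theorem qDesc_nonneg {q : ℝ} (h0 : 0 < q) (h1 : q < 1) (n j : ℕ) : 0 ≤ qDesc q n j :=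
  Finset.prod_nonneg fun _ _ => sub_nonneg.2 (pow_le_one₀ h0.le h1.le)

theorem qDesc_le_one {q : ℝ} (h0 : 0 < q) (h1 : q < 1) (n j : ℕ) : qDesc q n j ≤ 1 :=
  Finset.prod_le_one (fun _ _ => sub_nonneg.2 (pow_le_one₀ h0.le h1.le))
    fun _ _ => sub_le_self _ (pow_nonneg h0.le _)

theorem tendsto_qDesc {q : ℝ} (h0 : 0 < q) (h1 : q < 1) (j : ℕ) :
    Filter.Tendsto (fun n => qDesc q n j) Filter.atTop (nhds 1) := by
  have h : ∀ i ∈ Finset.range j, Filter.Tendsto (fun n : ℕ => 1 - q ^ (n - i)) Filter.atTop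
      (nhds 1) := fun i _ => by
    simpa using ((tendsto_pow_atTop_nhds_zero_of_lt_one h0.le h1).comp
      (Filter.tendsto_sub_atTop_nat i)).const_sub 1
  simpa [qDesc] using tendsto_finsetProd _ h

/-- Termwise, $(q^{-i};q)_k\,q^{ik}\to(-1)^kq^{\binom k2}$, which turns the ${}_2\varphi_1$ into the
${}_1\varphi_1$. Dominated convergence applies: these factors are at most $q^{\binom k2}$ in
absolute value and the denominators stay above $(q;q)_\infty^2$. -/
theorem tendsto_wall {q : ℝ} (h0 : 0 < q) (h1 : q < 1) (s : ℕ) (z : ℝ) :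
    Filter.Tendsto (fun i : ℕ => wall i (q ^ i * z) (q ^ s) q) Filter.atTop
      (nhds (phi11 0 (q ^ (s + 1)) q (q * z))) := by
  have hI := qPochInf_self_pos h0 h1
  have hP : ∀ k, 0 < qPoch (q ^ (s + 1)) q k * qPoch q q k := fun k =>
    mul_pos (qPoch_pos h0 h1 s k) (qPoch_self_pos h0 h1 k)
  have hb : ∀ k, qPochInf q q * qPochInf q q ≤ qPoch (q ^ (s + 1)) q k * qPoch q q k := fun k => by
    have a1 := qPochInf_self_le h0 h1 k
    have a2 := qPochInf_self_le h0 h1 (s + k)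
    have a3 : qPoch q q s ≤ 1 := by simpa [qPoch_zero] using qPoch_self_anti h0 h1 (Nat.zero_le s)
    have a4 : qPochInf q q ≤ qPoch (q ^ (s + 1)) q k := by
      rw [qPoch_pow_succ h0 h1, le_div_iff₀ (qPoch_self_pos h0 h1 s)]
      exact (mul_le_of_le_one_right hI.le a3).trans a2
    have := hI.le
    have := (qPoch_pos h0 h1 s k).le
    gcongr
  have hterm : ∀ i : ℕ, wall i (q ^ i * z) (q ^ s) q = ∑' k : ℕ,
      qDesc q i k * ((-1) ^ k * (q ^ k.choose 2 * (q * z) ^ k) /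
        (qPoch (q ^ (s + 1)) q k * qPoch q q k)) := fun i => by
    rw [wall, phi21]
    congr 1 with k
    have h2 := qPoch_zpow_neg h0 i k
    have h3 : qPoch 0 q k = 1 := by simp [qPoch]
    rw [h3, ← pow_succ, mul_one, div_mul_eq_mul_div, ← mul_div_assoc]
    congr 1
    rw [show q * (q ^ i * z) = q ^ i * (q * z) by ring, mul_pow, ← pow_mul]
    linear_combination (q * z) ^ k * h2
  have hlim : phi11 0 (q ^ (s + 1)) q (q * z) = ∑' k : ℕ,
      (1 * ((-1) ^ k * (q ^ k.choose 2 * (q * z) ^ k) /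
        (qPoch (q ^ (s + 1)) q k * qPoch q q k))) := by
    rw [phi11]
    congr 1 with k
    have h3 : qPoch 0 q k = 1 := by simp [qPoch]
    rw [h3, Nat.choose_two_right]
    ring
  rw [hlim]
  simp_rw [hterm]
  refine tendsto_tsum_of_dominated_convergence
    (bound := fun k => ‖q ^ k.choose 2 * (q * z) ^ k‖ * (qPochInf q q * qPochInf q q)⁻¹)
    ((summable_pow_choose_two_mul_pow h0 h1 (q * z)).norm.mul_right _)
    (fun k => (tendsto_qDesc h0 h1 k).mul_const _)
    (Filter.Eventually.of_forall fun i k => ?_)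
  rw [norm_mul, norm_div, norm_mul, norm_pow, norm_neg, norm_one, one_pow, one_mul,
    Real.norm_of_nonneg (qDesc_nonneg h0 h1 i k), Real.norm_of_nonneg (hP k).le,
    ← div_eq_mul_inv]
  have := hb k
  refine (mul_le_of_le_one_left (by have := hP k; positivity) (qDesc_le_one h0 h1 i k)).trans ?_
  gcongr

theorem jackson3_zpow {q : ℝ} (h0 : 0 < q) (s : ℕ) (p : ℤ) :
    jackson3 s (q ^ (2 * p)) (q ^ 2) = q ^ (p * s) *
      (qPochInf ((q ^ 2) ^ (s + 1)) (q ^ 2) / qPochInf (q ^ 2) (q ^ 2)) *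
        phi11 0 ((q ^ 2) ^ (s + 1)) (q ^ 2) (q ^ 2 * (q ^ 2) ^ p) := by
  have e1 : (q ^ 2 : ℝ) ^ ((s : ℝ) + 1) = (q ^ 2) ^ (s + 1) := by
    rw [← Real.rpow_natCast (q ^ 2) (s + 1)]
    push_cast
    rfl
  have e2 : (q ^ (2 * p)) ^ ((s : ℝ) / 2) = q ^ (p * s) := by
    rw [Real.rpow_div_two_eq_sqrt _ (by positivity), mul_comm, zpow_mul, zpow_ofNat,
      Real.sqrt_sq (by positivity), Real.rpow_natCast, zpow_mul, zpow_natCast]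
  have e3 : q ^ (2 * p) = (q ^ 2) ^ p := by rw [zpow_mul, zpow_ofNat]
  rw [jackson3, e1, e2, e3]

theorem tendsto_clebschGordan_jackson3 {q : ℝ} (hq : q ∈ Set.Ioo (0 : ℝ) 1) (s : ℕ) (p : ℤ) :
    Filter.Tendsto (fun i : ℕ => clebschGordan q (i + p) i (i + s)) Filter.atTop
      (nhds ((-q) ^ p * jackson3 s (q ^ (2 * p)) (q ^ 2))) := by
  have h0 := hq.1
  have hQ := q_sq_mem hq
  have hI := qPochInf_self_pos hQ.1 hQ.2
  have hS : 0 < qPochInf ((q ^ 2) ^ (s + 1)) (q ^ 2) := by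
    rw [qPochInf_pow_succ hQ.1 hQ.2]
    exact div_pos hI (qPoch_self_pos hQ.1 hQ.2 s)
  have hw := tendsto_wall hQ.1 hQ.2 s ((q ^ 2) ^ p)
  -- With $x=i+p$ the exponent $x-i$ in the normalization is constantly $p$, so the square root
  -- converges; the sign $(-1)^{i+x}$ is likewise constantly $(-1)^p$.
  have hr : Filter.Tendsto (fun i : ℕ => √(((q ^ 2) ^ (s + 1)) ^ p *
      qPochInf ((q ^ 2) ^ (s + 1)) (q ^ 2) * qPoch ((q ^ 2) ^ (s + 1)) (q ^ 2) i /
      (qPoch (q ^ 2) (q ^ 2) i * qPoch (q ^ 2) (q ^ 2) (i + p).toNat))) Filter.atTop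
      (nhds (q ^ ((s + 1) * p) *
        (qPochInf ((q ^ 2) ^ (s + 1)) (q ^ 2) / qPochInf (q ^ 2) (q ^ 2)))) := by
    have h2 := ((tendsto_qPoch hQ.1 hQ.2 ((q ^ 2) ^ (s + 1))).const_mul (((q ^ 2) ^ (s + 1)) ^ p *
      qPochInf ((q ^ 2) ^ (s + 1)) (q ^ 2))).div ((tendsto_qPoch hQ.1 hQ.2 (q ^ 2)).mul
      ((tendsto_qPoch hQ.1 hQ.2 (q ^ 2)).comp (tendsto_intCast_shift p))) (mul_pos hI hI).ne'
    have h3 := (Real.continuous_sqrt.tendsto _).comp h2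
    have h4 : ((q ^ 2) ^ (s + 1)) ^ p * qPochInf ((q ^ 2) ^ (s + 1)) (q ^ 2) *
        qPochInf ((q ^ 2) ^ (s + 1)) (q ^ 2) / (qPochInf (q ^ 2) (q ^ 2) *
        qPochInf (q ^ 2) (q ^ 2)) = (q ^ ((s + 1) * p) *
        (qPochInf ((q ^ 2) ^ (s + 1)) (q ^ 2) / qPochInf (q ^ 2) (q ^ 2))) ^ 2 := by
      have e : ((q ^ 2) ^ (s + 1)) ^ p = (q ^ ((s + 1) * p)) ^ 2 := by
        rw [← pow_mul, mul_comm 2, pow_mul, zpow_mul, ← Nat.cast_add_one, zpow_natCast,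
          ← zpow_natCast, ← zpow_natCast (_ ^ p), zpow_comm]
      rw [e]
      field_simp
    rw [h4, Real.sqrt_sq (by positivity)] at h3
    exact h3
  have hmain := (hr.mul hw).const_mul ((-1) ^ p)
  have hval : (-q) ^ p * jackson3 s (q ^ (2 * p)) (q ^ 2) = (-1) ^ p * (q ^ ((s + 1) * p) *
      (qPochInf ((q ^ 2) ^ (s + 1)) (q ^ 2) / qPochInf (q ^ 2) (q ^ 2)) *
        phi11 0 ((q ^ 2) ^ (s + 1)) (q ^ 2) (q ^ 2 * (q ^ 2) ^ p)) := by
    rw [jackson3_zpow h0, neg_eq_neg_one_mul, mul_zpow, add_mul, zpow_add₀ h0.ne', one_mul,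
      mul_comm p]
    ring
  rw [hval]
  refine hmain.congr' ?_
  filter_upwards [Filter.eventually_ge_atTop p.natAbs] with i hi
  obtain ⟨x, hx⟩ := Int.eq_ofNat_of_zero_le (show 0 ≤ (i : ℤ) + p by lia)
  have ha : q ^ (2 * ((i : ℤ) + s - i)) = (q ^ 2) ^ s := by
    rw [add_sub_cancel_left, zpow_mul, zpow_natCast, zpow_ofNat]
  have hsgn : (-1 : ℝ) ^ (i + x) = (-1) ^ p := by
    rw [← zpow_natCast, show ((i + x : ℕ) : ℤ) = 2 * i + p by push_cast; lia,
      zpow_add₀ (by norm_num), zpow_mul]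
    simp
  have hpow : (q ^ 2) ^ x = (q ^ 2) ^ i * (q ^ 2) ^ p := by
    rw [← zpow_natCast, ← hx, zpow_add₀ (by positivity), zpow_natCast]
  rw [clebschGordan, if_pos (by lia), if_pos (by lia), hx, Int.toNat_natCast, Int.toNat_natCast,
    wallBar, ha, hsgn, ← pow_succ, hpow, show (x : ℤ) - i = p by lia]
  ring

theorem tendsto_clebschGordan_qBessel {q : ℝ} (hq : q ∈ Set.Ioo (0 : ℝ) 1) (p r : ℤ) :
    Filter.Tendsto (fun j : ℕ => clebschGordan q (j + p) (j + r) j) Filter.atTop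
      (nhds ((-q) ^ p * qBessel r (q ^ (2 * p)) (q ^ 2))) := by
  have h0 := hq.1
  rcases r with s | s
  · refine (tendsto_clebschGordan_jackson3 hq s p).congr fun j => ?_
    rw [clebschGordan_comm hq.1 hq.2]
    rfl
  -- For $r=-(s+1)$, putting $i=j-(s+1)$ gives the positive-order case with $p+s+1$ in place of $p$.
  -- The definition of $J_{-n}$ matches exactly this shift of the argument, including sign and power
  -- of $q$.
  · have h := tendsto_clebschGordan_jackson3 hq (s + 1) (p + (s + 1))
    have hval : (-q) ^ p * qBessel (Int.negSucc s) (q ^ (2 * p)) (q ^ 2) =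
        (-q) ^ (p + (s + 1)) * jackson3 ((s + 1 : ℕ) : ℝ) (q ^ (2 * (p + (s + 1)))) (q ^ 2) := by
      have e1 : (q ^ 2 : ℝ) ^ (((s + 1 : ℕ) : ℝ) / 2) = q ^ (s + 1) := by
        rw [Real.rpow_div_two_eq_sqrt _ (by positivity), Real.sqrt_sq h0.le, Real.rpow_natCast]
      have e2 : q ^ (2 * (p + (s + 1))) = q ^ (2 * p) * (q ^ 2) ^ (s + 1) := by
        rw [mul_add, zpow_add₀ h0.ne', ← pow_mul, ← zpow_natCast q (2 * (s + 1))]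
        push_cast
        rfl
      rw [qBessel, e1, e2, zpow_add₀ (neg_ne_zero.2 h0.ne'), ← Nat.cast_add_one, zpow_natCast,
        neg_pow q]
      ring
    rw [hval]
    rw [← Filter.tendsto_add_atTop_iff_nat (s + 1)]
    refine h.congr fun i => ?_
    congr 1 <;> push_cast <;> lia

/-! ## The main theorem -/

theorem inner_eVec_eVec'_zero {q : ℝ} (hq : q ∈ Set.Ioo (0 : ℝ) 1) (p₁ r₁ p₂ r₂ : ℤ) :
    inner ℂ (eVec q 0 p₁ r₁) (eVec' q 0 p₂ r₂) = if r₁ = r₂ then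
      (((-q) ^ (p₁ - p₂) * qBessel r₁ (q ^ (2 * p₁ - 2 * p₂)) (q ^ 2) : ℝ) : ℂ) else 0 := by
  split_ifs with h
  · subst h
    have h1 := inner_eVec_eVec'_add hq (p₁ - p₂) r₁ 0 r₁ p₂
    rw [sub_add_cancel, zero_add] at h1
    rw [h1, ← mul_sub]
    exact tendsto_nhds_unique (tendsto_clebschGordan_sixJ hq (p₁ - p₂) r₁)
      ((Complex.continuous_ofReal.tendsto _).comp (tendsto_clebschGordan_qBessel hq (p₁ - p₂) r₁))
  · exact inner_eVec_eVec'_of_ne hq h p₁ p₂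

theorem sixJ_eq {q : ℝ} (hq : q ∈ Set.Ioo (0 : ℝ) 1) (x : ℕ) (p₁ r₁ p₂ r₂ : ℤ) :
    sixJ q x p₁ r₁ p₂ r₂ = if r₁ = r₂ then
      (((-q) ^ (p₁ - p₂) * qBessel r₁ (q ^ (2 * p₁ - 2 * p₂)) (q ^ 2) : ℝ) : ℂ) else 0 := by
  rw [sixJ, e1_23_eq, e12_3_eq hq, inner_eVec_eVec' hq, if_pos rfl, inner_eVec_eVec'_zero hq]

theorem hasSum_sixJ {q : ℝ} (hq : q ∈ Set.Ioo (0 : ℝ) 1) (x : ℕ) (p₁ r₁ : ℤ) :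
    HasSum (fun i : ℤ × ℤ => sixJ q x p₁ r₁ i.1 i.2 • e12_3 q x i.1 i.2) (e1_23 q x p₁ r₁) := by
  obtain ⟨hon, hsp⟩ := isHilbertBasis_eVec' hq
  let b := HilbertBasis.mk hon hsp.ge
  have hb : ∀ i : ℕ × ℤ × ℤ, b i = eVec' q i.1 i.2.1 i.2.2 := fun i =>
    congrFun (HilbertBasis.coe_mk hon hsp.ge) i
  have h := b.hasSum_repr (eVec q x p₁ r₁)
  simp_rw [HilbertBasis.repr_apply_apply, hb] at h
  have hinj : Function.Injective fun i : ℤ × ℤ => (x, i) := fun i j hij => (Prod.ext_iff.1 hij).2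
  -- In the expansion over the whole basis only indices with the same $x$ survive. The coefficients
  -- appear as conjugates of the $6j$-symbols, which are real by the explicit formula.
  rw [← hinj.hasSum_iff] at h
  · rw [e1_23_eq]
    refine h.congr_fun fun i => ?_
    rw [Function.comp_apply, ← inner_conj_symm, e12_3_eq hq]
    congr 1
    have h2 := sixJ_eq hq x p₁ r₁ i.1 i.2
    have h3 : (starRingEnd ℂ) (sixJ q x p₁ r₁ i.1 i.2) = sixJ q x p₁ r₁ i.1 i.2 := by
      rw [h2]
      split_ifs
      · exact Complex.conj_ofReal _
      · exact map_zero _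
    rw [← h3, sixJ, e1_23_eq, e12_3_eq hq]
  · rintro ⟨y, j⟩ hy
    have hxy : x ≠ y := fun hxy => hy ⟨j, by rw [hxy]⟩
    rw [← inner_conj_symm, inner_eVec_eVec' hq, if_neg hxy, map_zero, zero_smul]

end QSU2

end
open QSU2 in
theorem mainTheorem1 (q : ℝ) (hq : q ∈ Set.Ioo (0 : ℝ) 1) :
    -- both families are orthonormal bases of the three-fold tensor product space
    IsHilbertBasis (fun i : ℕ × ℤ × ℤ => e1_23 q i.1 i.2.1 i.2.2) ∧
    IsHilbertBasis (fun i : ℕ × ℤ × ℤ => e12_3 q i.1 i.2.1 i.2.2) ∧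
    -- they consist of eigenvectors of `γγ*` in the three-fold tensor product of `π₀`
    (∀ (x : ℕ) (p r : ℤ),
      pi1_23 hq (Alg.of q .ga * gaStar q) (e1_23 q x p r) = (q : ℂ) ^ (2 * x) • e1_23 q x p r ∧
      pi12_3 hq (Alg.of q .ga * gaStar q) (e12_3 q x p r) = (q : ℂ) ^ (2 * x) • e12_3 q x p r) ∧
    -- the `6j`-symbols are the coefficients of the transition between the two bases
    (∀ (x : ℕ) (p₁ r₁ : ℤ),
      HasSum (fun i : ℤ × ℤ => sixJ q x p₁ r₁ i.1 i.2 • e12_3 q x i.1 i.2) (e1_23 q x p₁ r₁)) ∧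
    -- the explicit value of the `6j`-symbols
    (∀ (x : ℕ) (p₁ r₁ p₂ r₂ : ℤ),
      sixJ q x p₁ r₁ p₂ r₂ =
        if r₁ = r₂ then
          (((-q) ^ (p₁ - p₂) * qBessel r₁ (q ^ (2 * p₁ - 2 * p₂)) (q ^ 2) : ℝ) : ℂ)
        else 0) := by
  refine ⟨?_, ?_, fun x p r => ⟨?_, ?_⟩, hasSum_sixJ hq, sixJ_eq hq⟩
  · simp_rw [e1_23_eq]
    exact isHilbertBasis_eVec hq
  · simp_rw [e12_3_eq hq]
    exact isHilbertBasis_eVec' hq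
  · rw [e1_23_eq]
    exact pi1_23_gamma_gammaStar_eVec hq p r x
  · rw [pi12_3_eq_pi1_23, e12_3_eq hq]
    exact pi1_23_gamma_gammaStar_eVec' hq p r x
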